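/- Let $G$ be a finite graph or digraph (parallel edges and loops allowed), $\lambda\ge 1$ and $k\ge 0$ integers. $G$ is $\lambda$-edge-connected if deleting any $\lambda-1$ or fewer edges leaves it connected (strongly connected, if $G$ is a digraph). Suppose that $G$ is $\lambda$-edge-connected. An edge $e$ is deletable if $G-e$ is $\lambda$-edge-connected; a deletion set of cardinality $k$ is a set $F\subseteq E(G)$ with $|F|=k$ such that $G-F$ is $\lambda$-edge-connected. A set $R\subseteq E(G)$ is irrelevant if, whenever $G$ has a deletion set of cardinality $k$, it has one that is disjoint from $R$. There is an algorithm (a program for a random access machine with unit-cost addition and subtraction) that takes as input $G$, $\lambda$, $k$ and an irrelevant set $R$ (the edges marked as irrelevant so far; initially $R=\emptyset$), runs in time polynomial in $|V(G)|+|E(G)|$ and the bit lengths of $\lambda$ and $k$, and does one of the following: 1. it outputs a deletion set $F$ of cardinality $k$; 2. it outputs a deletable edge $e\notin R$ such that $R\cup\{e\}$ is again irrelevant; 3. it correctly concludes that at most $7\lambda k^3$ deletable edges of $G$ lie outside $R$. Furthermore, if $G$ is a digraph, then the second outcome never occurs, and in the third outcome $G$ has at most $\lambda k^2$ deletable edges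 in total. If $G$ is undirected and $\lambda$ is even, then the second outcome never occurs, and in the third outcome $G$ has at most $2\lambda k^2$ deletable edges in total. -/

import Mathlib

/-! ### Graphs and digraphs -/

/-- A finite graph (`directed = false`) or digraph (`directed = true`) with vertices `0, …, n-1` and
edges `0, …, m-1`. Edge `e` joins `tail e` to `head e`; in a graph its orientation is immaterial.
Parallel edges and loops are allowed, so simple (di)graphs are included. -/
structure MGraph where
  directed : Bool
  n : ℕ
  m : ℕ
  tail : Fin m → Fin n
  head : Fin m → Fin n

namespace MGraph

/-- One can go from `u` to `v` along one edge of `G - F`. -/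
def Step (G : MGraph) (F : Finset (Fin G.m)) (u v : Fin G.n) : Prop :=
  ∃ e, e ∉ F ∧ ((G.tail e = u ∧ G.head e = v) ∨
    (G.directed = false ∧ G.tail e = v ∧ G.head e = u))

/-- `G - F` is connected (strongly connected, if `G` is a digraph). -/
def ConnectedWithout (G : MGraph) (F : Finset (Fin G.m)) : Prop :=
  ∀ u v, Relation.ReflTransGen (G.Step F) u v

/-- `G - F` is `lam`-edge-connected (for `lam ≥ 1`): deleting any `lam - 1` or fewer further edges
leaves it (strongly) connected. -/
def EdgeConnectedWithout (G : MGraph) (lam : ℕ) (F : Finset (Fin G.m)) : Prop :=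
  ∀ S : Finset (Fin G.m), S.card < lam → G.ConnectedWithout (F ∪ S)

/-- `G` is `lam`-edge-connected. -/
def EdgeConnected (G : MGraph) (lam : ℕ) : Prop := G.EdgeConnectedWithout lam ∅

/-- The edge `e` is deletable: `G - e` is `lam`-edge-connected. -/
def Deletable (G : MGraph) (lam : ℕ) (e : Fin G.m) : Prop := G.EdgeConnectedWithout lam {e}

/-- `F` is a deletion set of cardinality `k`. -/
def IsDeletionSet (G : MGraph) (lam k : ℕ) (F : Finset (Fin G.m)) : Prop :=
  F.card = k ∧ G.EdgeConnectedWithout lam F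

/-- The edge set `R` is irrelevant: if there is a deletion set of cardinality `k` at all, then there
is one that is disjoint from `R`. -/
def Irrelevant (G : MGraph) (lam k : ℕ) (R : Finset (Fin G.m)) : Prop :=
  (∃ F, G.IsDeletionSet lam k F) → ∃ F, G.IsDeletionSet lam k F ∧ Disjoint F R

end MGraph

/-! ### The machine model

A random access machine with unit cost, whose memory consists of arrays of natural numbers and whose
arithmetic is addition and truncated subtraction (no multiplication, so that the bit lengths of all
numbers stay bounded by the input length plus the number of steps). Programs are structured. -/

/-- Memory contents: `σ a i` is cell `i` of array `a`. -/
abbrev Store := ℕ → ℕ → ℕ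

/-- Expressions: literals, reading a cell at a computed address, sum, truncated difference. -/
inductive RExpr where
  | lit (c : ℕ)
  | get (a : ℕ) (i : RExpr)
  | add (x y : RExpr)
  | sub (x y : RExpr)

namespace RExpr

def eval (σ : Store) : RExpr → ℕ
  | lit c => c
  | get a i => σ a (i.eval σ)
  | add x y => x.eval σ + y.eval σ
  | sub x y => x.eval σ - y.eval σ

/-- The number of operations performed in evaluating an expression. -/
def cost : RExpr → ℕ
  | lit _ => 1
  | get _ i => i.cost + 1
  | add x y => x.cost + y.cost + 1
  | sub x y => x.cost + y.cost + 1

end RExpr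

/-- Programs. A condition holds when its value is nonzero. -/
inductive Prog where
  | skip
  | set (a : ℕ) (i x : RExpr)
  | seq (p q : Prog)
  | ite (b : RExpr) (p q : Prog)
  | loop (b : RExpr) (p : Prog)

/-- `Run p σ t σ'`: started on memory `σ`, the program `p` halts after `t` steps with memory `σ'`. -/
inductive Run : Prog → Store → ℕ → Store → Prop
  | skip (σ : Store) : Run Prog.skip σ 1 σ
  | set (a : ℕ) (i x : RExpr) (σ : Store) :
      Run (Prog.set a i x) σ (i.cost + x.cost + 1)
        (Function.update σ a (Function.update (σ a) (i.eval σ) (x.eval σ)))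
  | seq {p q : Prog} {σ₁ σ₂ σ₃ : Store} {t₁ t₂ : ℕ} :
      Run p σ₁ t₁ σ₂ → Run q σ₂ t₂ σ₃ → Run (Prog.seq p q) σ₁ (t₁ + t₂) σ₃
  | iteTrue {b : RExpr} {p q : Prog} {σ₁ σ₂ : Store} {t : ℕ} :
      b.eval σ₁ ≠ 0 → Run p σ₁ t σ₂ → Run (Prog.ite b p q) σ₁ (b.cost + 1 + t) σ₂
  | iteFalse {b : RExpr} {p q : Prog} {σ₁ σ₂ : Store} {t : ℕ} :
      b.eval σ₁ = 0 → Run q σ₁ t σ₂ → Run (Prog.ite b p q) σ₁ (b.cost + 1 + t) σ₂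
  | loopTrue {b : RExpr} {p : Prog} {σ₁ σ₂ σ₃ : Store} {t₁ t₂ : ℕ} :
      b.eval σ₁ ≠ 0 → Run p σ₁ t₁ σ₂ → Run (Prog.loop b p) σ₂ t₂ σ₃ →
        Run (Prog.loop b p) σ₁ (b.cost + 1 + t₁ + t₂) σ₃
  | loopFalse {b : RExpr} {p : Prog} {σ : Store} :
      b.eval σ = 0 → Run (Prog.loop b p) σ (b.cost + 1) σ

/-- The model is deterministic: the run of a program on a given memory is unique, if it halts. -/
theorem Run.unique {p : Prog} {σ σ₁ σ₂ : Store} {t₁ t₂ : ℕ}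
    (h₁ : Run p σ t₁ σ₁) (h₂ : Run p σ t₂ σ₂) : t₁ = t₂ ∧ σ₁ = σ₂ := by
  induction h₁ generalizing t₂ σ₂ with
  | skip => cases h₂; exact ⟨rfl, rfl⟩
  | set => cases h₂; exact ⟨rfl, rfl⟩
  | seq _ _ ih₁ ih₂ =>
    cases h₂ with
    | seq k₁ k₂ =>
      obtain ⟨rfl, rfl⟩ := ih₁ k₁
      obtain ⟨rfl, rfl⟩ := ih₂ k₂
      exact ⟨rfl, rfl⟩
  | iteTrue hb _ ih =>
    cases h₂ with
    | iteTrue _ k => obtain ⟨rfl, rfl⟩ := ih k; exact ⟨rfl, rfl⟩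
    | iteFalse hb' _ => exact absurd hb' hb
  | iteFalse hb _ ih =>
    cases h₂ with
    | iteTrue hb' _ => exact absurd hb hb'
    | iteFalse _ k => obtain ⟨rfl, rfl⟩ := ih k; exact ⟨rfl, rfl⟩
  | loopTrue hb _ _ ih₁ ih₂ =>
    cases h₂ with
    | loopTrue _ k₁ k₂ =>
      obtain ⟨rfl, rfl⟩ := ih₁ k₁
      obtain ⟨rfl, rfl⟩ := ih₂ k₂
      exact ⟨rfl, rfl⟩
    | loopFalse hb' => exact absurd hb' hb
  | loopFalse hb =>
    cases h₂ with
    | loopTrue hb' _ _ => exact absurd hb hb'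
    | loopFalse _ => exact ⟨rfl, rfl⟩

/-! ### Input and output -/

/-- The input `(G, lam, k, R)` in memory. Array 0 starts with the direction flag, the number of
vertices, the number of edges, `lam` and `k`; arrays 1 and 2 hold the tails and heads of the edges,
array 3 the indicator function of `R`. All other cells are 0. -/
def inputStore (G : MGraph) (lam k : ℕ) (R : Finset (Fin G.m)) : Store := fun a i =>
  match a with
  | 0 => [if G.directed then 1 else 0, G.n, G.m, lam, k].getD i 0
  | 1 => if h : i < G.m then (G.tail ⟨i, h⟩ : ℕ) else 0
  | 2 => if h : i < G.m then (G.head ⟨i, h⟩ : ℕ) else 0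
  | 3 => if h : i < G.m then (if ⟨i, h⟩ ∈ R then 1 else 0) else 0
  | _ => 0

/-- The size of the input: numbers of vertices and edges, and the bit lengths of `lam` and `k`. -/
def inputSize (G : MGraph) (lam k : ℕ) : ℕ := G.n + G.m + lam.size + k.size

/-- The possible answers, for a graph with `m` edges. -/
inductive Answer (m : ℕ) where
  /-- `F` is a deletion set of the required cardinality. -/
  | deletionSet (F : Finset (Fin m))
  /-- `e` is a deletable edge that may be marked as irrelevant. -/
  | irrelevantEdge (e : Fin m)
  /-- There are few deletable edges. -/
  | fewDeletable

/-- The memory `σ` holds the given answer: cell 0 of array 4 says which kind of answer it is, cell 1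
of array 4 holds the irrelevant edge, and array 5 the indicator function of the deletion set. -/
def Answer.HeldBy {m : ℕ} (σ : Store) : Answer m → Prop
  | deletionSet F => σ 4 0 = 0 ∧ ∀ e : Fin m, e ∈ F ↔ σ 5 e ≠ 0
  | irrelevantEdge e => σ 4 0 = 1 ∧ σ 4 1 = e
  | fewDeletable => σ 4 0 = 2

/-- The answer is correct for a graph or digraph `G` whose edges in `R` have been marked as
irrelevant. -/
def Answer.Correct (G : MGraph) (lam k : ℕ) (R : Finset (Fin G.m)) : Answer G.m → Prop
  | deletionSet F => G.IsDeletionSet lam k F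
  | irrelevantEdge e => e ∉ R ∧ G.Deletable lam e ∧ G.Irrelevant lam k (insert e R)
  | fewDeletable => {e | G.Deletable lam e ∧ e ∉ R}.ncard ≤ 7 * lam * k ^ 3

/-! ### Programs with bounded loops -/

/-! Grow a set `F` greedily: take the edges of `G` in order and add `f` to `F` whenever `G - F - f`
is still `lam`-edge-connected. If `F` reaches size `k`, it is a deletion set. Otherwise every
deletable edge ends up in `F`, or is blocked at some stage by an edge `f` that joins `F`: it could
be deleted from `G - F` but not from `G - F - f` (`Blocked`). At most `k - 1` edges join `F`, so it
suffices to bound the number of edges blocked by one `f`.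

Every blocked edge lies in a tight cut, one with exactly `lam` edges in `G - F - f`, that separates
the ends of `f`. A flow of value `lam` between these ends saturates all tight cuts. Decompose it
into `lam` trails and a circulation; the circulation avoids tight cuts, so each blocked edge lies on
a trail. For a blocked edge `e` let `X e` be the set of vertices that cannot reach the far end of
`e` in the residual graph. Along one trail these sets are nested and have `lam + 1` leaving edges in
`G - F` (one of them is `f`). Moreover a set that separates the ends of `f` and is crossed by `p`
edges of the trail has at least `lam + p` leaving edges, and `p` is odd if `G` is a graph. This is
what `Ladder` records.

Uncrossing with the sets `X e` shows that in a digraph all edges of a ladder can be deleted together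
(`card_le_cut_of_directed`), while in a graph the only obstructions are pairs
(`card_le_cut_of_pairs`). A bad pair `i`, `j` gives a rung, a cut with `lam + 1` edges inside `X j \
X i`. Any ladder edge between `i` and `j` divides the rung into two rungs joined by exactly `(lam +
1) / 2` edges (`IsRung.split`), which is impossible for even `lam`.

Now select edges greedily along each trail. If `k` are selected, they form a deletion set.
Otherwise, in a digraph all blocked edges of the trail are selected, so there are fewer than `k`. In
a graph, any two ladder edges with equally many selected edges up to them span a rung; for even
`lam` at most two ladder edges share this number. For odd `lam`, suppose that a rung from `l` to `t`
contains `2 * k` intermediate edges not in `R` and no end of an edge of `F`. A deletion set `K` of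
size `k` containing `l` leaves two consecutive pieces of the rung untouched, and `l` can be
exchanged for the edge joining them (`exists_exchange`); so `l` may be marked irrelevant. If no such
window exists, a trail carries at most `(2 * k + 1) * (3 * (k - 1))` blocked edges outside `R`
(`card_le_of_no_window`). Summing over the trails and over `F` gives the three bounds.

Every step is carried out by a program whose loops all have length `n + m + 1`, so the running time
is polynomial; connectivity is tested by computing flows between all pairs of vertices. -/

/-- Writing one memory cell. -/
def Store.upd (σ : Store) (a i v : ℕ) : Store := Function.update σ a (Function.update (σ a) i v)

theorem Store.upd_ne {σ : Store} {a b : ℕ} (i v : ℕ) (h : b ≠ a) : σ.upd a i v b = σ b :=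
  Function.update_of_ne h _ _

theorem Store.upd_self (σ : Store) (a i v : ℕ) : σ.upd a i v a = Function.update (σ a) i v :=
  Function.update_self _ _ _

/-- The number of iterations of every loop: one more than the numbers of vertices and edges. -/
def Store.bound (σ : Store) : ℕ := σ 0 1 + σ 0 2 + 1

/-- Programs whose only loops are `forN c p`, which runs `p` for `Store.bound` many values of the
counter in cell 0 of array `c`. -/
inductive BProg where
  | skip
  | set (a : ℕ) (i x : RExpr)
  | seq (p q : BProg)
  | ite (b : RExpr) (p q : BProg)
  | forN (c : ℕ) (p : BProg)

namespace BProg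

/-- The memory after running a program. -/
def ex : BProg → Store → Store
  | skip, σ => σ
  | set a i x, σ => σ.upd a (i.eval σ) (x.eval σ)
  | seq p q, σ => ex q (ex p σ)
  | ite b p q, σ => if b.eval σ ≠ 0 then ex p σ else ex q σ
  | forN c p, σ => (fun τ => (ex p τ).upd c 0 (τ c 0 + 1))^[σ.bound] (σ.upd c 0 0)

/-- The arrays that a program writes to. -/
def writes : BProg → List ℕ
  | skip => []
  | set a _ _ => [a]
  | seq p q => writes p ++ writes q
  | ite _ p q => writes p ++ writes q
  | forN c p => c :: writes p

/-- Array 0 is never written to, and loop counters are not written to by the body of the loop. -/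
def wf : BProg → Bool
  | skip => true
  | set a _ _ => a != 0
  | seq p q => wf p && wf q
  | ite _ p q => wf p && wf q
  | forN c p => c != 0 && wf p && !(writes p).contains c

/-- Translation to programs of the random access machine. -/
def compile : BProg → Prog
  | skip => Prog.skip
  | set a i x => Prog.set a i x
  | seq p q => Prog.seq (compile p) (compile q)
  | ite b p q => Prog.ite b (compile p) (compile q)
  | forN c p => Prog.seq (Prog.set c (.lit 0) (.lit 0))
      (Prog.loop (.sub (.add (.add (.get 0 (.lit 1)) (.get 0 (.lit 2))) (.lit 1)) (.get c (.lit 0)))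
        (Prog.seq (compile p) (Prog.set c (.lit 0) (.add (.get c (.lit 0)) (.lit 1)))))

/-- The written arrays form a syntactic list, so `decide` shows that a program preserves whatever it
does not assign. This frame rule lets each specification speak only of the arrays that matter. -/
theorem ex_frame {p : BProg} {σ : Store} {a : ℕ} (h : a ∉ p.writes) : p.ex σ a = σ a := by
  induction p generalizing σ with
  | skip => rfl
  | set b i x => exact Store.upd_ne _ _ (by simpa [writes] using h)
  | seq p q ihp ihq =>
    simp only [writes, List.mem_append, not_or] at h
    simp only [ex]
    rw [ihq h.2, ihp h.1]
  | ite b p q ihp ihq =>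
    simp only [writes, List.mem_append, not_or] at h
    simp only [ex]
    split_ifs
    · exact ihp h.1
    · exact ihq h.2
  | forN c p ih =>
    simp only [writes, List.mem_cons, not_or] at h
    simp only [ex]
    generalize σ.bound = N
    have hb : (σ.upd c 0 0) a = σ a := Store.upd_ne _ _ h.1
    rw [← hb]
    generalize σ.upd c 0 0 = τ
    induction N generalizing τ with
    | zero => rfl
    | succ N ihN =>
      rw [Function.iterate_succ_apply, ihN, Store.upd_ne _ _ h.1, ih h.2]

theorem zero_notMem_writes {p : BProg} (h : p.wf = true) : 0 ∉ p.writes := by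
  induction p with
  | skip => simp [writes]
  | set a i x =>
    have h' : a ≠ 0 := by simpa [wf] using h
    simpa [writes] using h'.symm
  | seq p q ihp ihq =>
    simp only [wf, Bool.and_eq_true] at h
    simp [writes, ihp h.1, ihq h.2]
  | ite b p q ihp ihq =>
    simp only [wf, Bool.and_eq_true] at h
    simp [writes, ihp h.1, ihq h.2]
  | forN c p ih =>
    simp only [wf, Bool.and_eq_true, bne_iff_ne] at h
    simp [writes, ih h.1.2, h.1.1.symm]

theorem bound_congr {σ τ : Store} (h : τ 0 = σ 0) : τ.bound = σ.bound := by
  simp [Store.bound, h]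

theorem bound_ex {p : BProg} (h : p.wf = true) (σ : Store) : (p.ex σ).bound = σ.bound :=
  bound_congr (ex_frame (zero_notMem_writes h))

theorem notMem_of_wf_forN {c : ℕ} {p : BProg} (h : (forN c p).wf = true) :
    c ≠ 0 ∧ p.wf = true ∧ c ∉ p.writes := by
  simpa [wf, and_assoc] using h

/-- The loop condition evaluates to `bound` minus the counter. The body changes neither array 0 nor
the counter, so exactly `j` iterations remain. The constant 20 covers the test and the increment. -/
theorem run_loop {c : ℕ} {p : BProg} (h : (forN c p).wf = true) {A d : ℕ}
    (hp : ∀ σ, ∃ t, Run p.compile σ t (p.ex σ) ∧ t ≤ A * (σ.bound + 1) ^ d) (j : ℕ) (τ : Store)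
    (hj : τ c 0 + j = τ.bound) :
    ∃ t, Run (Prog.loop (.sub (.add (.add (.get 0 (.lit 1)) (.get 0 (.lit 2))) (.lit 1))
          (.get c (.lit 0)))
        (Prog.seq p.compile (Prog.set c (.lit 0) (.add (.get c (.lit 0)) (.lit 1))))) τ t
        ((fun τ => (p.ex τ).upd c 0 (τ c 0 + 1))^[j] τ) ∧
      t ≤ j * (A * (τ.bound + 1) ^ d + 20) + 20 := by
  obtain ⟨hc, hwf, hcw⟩ := notMem_of_wf_forN h
  induction j generalizing τ with
  | zero =>
    refine ⟨_, Run.loopFalse ?_, ?_⟩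
    · simp only [RExpr.eval]
      change τ.bound - _ = 0
      omega
    · simp [RExpr.cost]
  | succ j ih =>
    obtain ⟨t₁, hr₁, ht₁⟩ := hp τ
    have hcell : p.ex τ c 0 = τ c 0 := by rw [ex_frame hcw]
    have hb : ((p.ex τ).upd c 0 (τ c 0 + 1)).bound = τ.bound := by
      rw [← bound_ex hwf τ]
      exact bound_congr (Store.upd_ne _ _ hc.symm)
    obtain ⟨t₂, hr₂, ht₂⟩ := ih ((p.ex τ).upd c 0 (τ c 0 + 1)) (by
      rw [hb, Store.upd_self, Function.update_self]; omega)
    have hset := Run.set c (.lit 0) (.add (.get c (.lit 0)) (.lit 1)) (p.ex τ)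
    simp only [RExpr.eval, hcell, RExpr.cost] at hset
    refine ⟨_, Run.loopTrue ?_ (Run.seq hr₁ hset) hr₂, ?_⟩
    · simp only [RExpr.eval]
      change τ.bound - _ ≠ 0
      omega
    · simp only [RExpr.cost]
      rw [hb] at ht₂
      rw [add_one_mul]
      omega

/-- Programs with bounded loops run in polynomial time. -/
theorem run_compile {p : BProg} (h : p.wf = true) :
    ∃ A d, ∀ σ, ∃ t, Run p.compile σ t (p.ex σ) ∧ t ≤ A * (σ.bound + 1) ^ d := by
  induction p with
  | skip => exact ⟨1, 0, fun σ => ⟨1, Run.skip σ, by simp⟩⟩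
  | set a i x => exact ⟨i.cost + x.cost + 1, 0, fun σ => ⟨_, Run.set a i x σ, by simp⟩⟩
  | seq p q ihp ihq =>
    simp only [wf, Bool.and_eq_true] at h
    obtain ⟨A, d, hp⟩ := ihp h.1
    obtain ⟨B, e, hq⟩ := ihq h.2
    refine ⟨A + B, max d e, fun σ => ?_⟩
    obtain ⟨t₁, hr₁, ht₁⟩ := hp σ
    obtain ⟨t₂, hr₂, ht₂⟩ := hq (p.ex σ)
    rw [bound_ex h.1] at ht₂
    refine ⟨_, Run.seq hr₁ hr₂, ?_⟩
    have h1 : (σ.bound + 1) ^ d ≤ (σ.bound + 1) ^ max d e :=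
      Nat.pow_le_pow_right (by omega) (le_max_left _ _)
    have h2 : (σ.bound + 1) ^ e ≤ (σ.bound + 1) ^ max d e :=
      Nat.pow_le_pow_right (by omega) (le_max_right _ _)
    rw [add_mul]
    exact add_le_add (ht₁.trans (Nat.mul_le_mul_left _ h1)) (ht₂.trans (Nat.mul_le_mul_left _ h2))
  | ite b p q ihp ihq =>
    simp only [wf, Bool.and_eq_true] at h
    obtain ⟨A, d, hp⟩ := ihp h.1
    obtain ⟨B, e, hq⟩ := ihq h.2
    refine ⟨b.cost + 1 + A + B, max d e, fun σ => ?_⟩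
    have h1 : (σ.bound + 1) ^ d ≤ (σ.bound + 1) ^ max d e :=
      Nat.pow_le_pow_right (by omega) (le_max_left _ _)
    have h2 : (σ.bound + 1) ^ e ≤ (σ.bound + 1) ^ max d e :=
      Nat.pow_le_pow_right (by omega) (le_max_right _ _)
    have h3 : 1 ≤ (σ.bound + 1) ^ max d e := Nat.one_le_pow _ _ (by omega)
    have h4 := Nat.mul_le_mul_left (b.cost + 1) h3
    have h5 := Nat.mul_le_mul_left A h1
    have h6 := Nat.mul_le_mul_left B h2
    by_cases hb : b.eval σ ≠ 0
    · obtain ⟨t, hr, ht⟩ := hp σ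
      refine ⟨b.cost + 1 + t, ?_, ?_⟩
      · simp only [ex, if_pos hb]
        exact Run.iteTrue hb hr
      · rw [add_mul, add_mul]
        omega
    · obtain ⟨t, hr, ht⟩ := hq σ
      refine ⟨b.cost + 1 + t, ?_, ?_⟩
      · simp only [ex, if_neg hb]
        exact Run.iteFalse (not_not.mp hb) hr
      · rw [add_mul, add_mul]
        omega
  | forN c p ih =>
    obtain ⟨hc, hwf, hcw⟩ := notMem_of_wf_forN h
    obtain ⟨A, d, hp⟩ := ih hwf
    -- A loop raises the degree by one; 50 absorbs the initialisation, the last test and the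
    -- overhead of each iteration.
    refine ⟨A + 50, d + 1, fun σ => ?_⟩
    have hb : (σ.upd c 0 0).bound = σ.bound := bound_congr (Store.upd_ne _ _ hc.symm)
    obtain ⟨t, hr, ht⟩ := run_loop h hp σ.bound (σ.upd c 0 0) (by
      rw [hb, Store.upd_self, Function.update_self]; omega)
    refine ⟨_, Run.seq (Run.set c (.lit 0) (.lit 0) σ) hr, ?_⟩
    rw [hb] at ht
    simp only [RExpr.cost]
    have h3 : 1 ≤ (σ.bound + 1) ^ d := Nat.one_le_pow _ _ (by omega)
    generalize σ.bound = N at *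
    rw [pow_succ]
    generalize (N + 1) ^ d = Q at *
    nlinarith [Nat.mul_le_mul_left N h3]

/-- Induction over the iterations of a loop. -/
theorem forN_rule {c : ℕ} {p : BProg} {σ : Store} (h : (forN c p).wf = true)
    (I : ℕ → Store → Prop) (hI : ∀ i τ v, I i τ → I i (τ.upd c 0 v)) (h0 : I 0 σ)
    (hs : ∀ i τ, i < σ.bound → τ c 0 = i → (∀ a, a ∉ (forN c p).writes → τ a = σ a) → I i τ →
      I (i + 1) (p.ex τ)) :
    I σ.bound ((forN c p).ex σ) := by
  obtain ⟨hc, hwf, hcw⟩ := notMem_of_wf_forN h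
  simp only [ex]
  have key : ∀ j, j ≤ σ.bound →
      let τ := (fun τ => (p.ex τ).upd c 0 (τ c 0 + 1))^[j] (σ.upd c 0 0)
      I j τ ∧ τ c 0 = j ∧ ∀ a, a ∉ (forN c p).writes → τ a = σ a := by
    intro j
    induction j with
    | zero =>
      intro _
      refine ⟨hI _ _ _ h0, by simp [Store.upd_self], fun a ha => Store.upd_ne _ _ ?_⟩
      rintro rfl
      simp [writes] at ha
    | succ j ih =>
      intro hj
      obtain ⟨h1, h2, h3⟩ := ih (by omega)
      simp only [Function.iterate_succ_apply']
      refine ⟨hI _ _ _ (hs _ _ (by omega) h2 h3 h1), by simp [Store.upd_self, h2], fun a ha => ?_⟩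
      simp only [writes, List.mem_cons, not_or] at ha
      rw [Store.upd_ne _ _ ha.1, ex_frame ha.2]
      exact h3 a (by simp [writes, ha])
  exact (key _ le_rfl).1

/-- The loop over all numbers below the limit in cell `j` of array 0. -/
def forLt (c j : ℕ) (p : BProg) : BProg :=
  forN c (ite (.sub (.get 0 (.lit j)) (.get c (.lit 0))) p skip)

theorem wf_forLt {c j : ℕ} {p : BProg} : (forLt c j p).wf = (forN c p).wf := by
  simp [forLt, wf, writes]

theorem writes_forLt {c j : ℕ} {p : BProg} : (forLt c j p).writes = (forN c p).writes := by
  simp [forLt, writes]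

theorem forLt_rule {c j : ℕ} {p : BProg} {σ : Store} (h : (forN c p).wf = true)
    (hl : σ 0 j ≤ σ.bound)
    (I : ℕ → Store → Prop) (hI : ∀ i τ v, I i τ → I i (τ.upd c 0 v)) (h0 : I 0 σ)
    (hs : ∀ i τ, i < σ 0 j → τ c 0 = i → (∀ a, a ∉ (forN c p).writes → τ a = σ a) → I i τ →
      I (i + 1) (p.ex τ)) :
    I (σ 0 j) ((forLt c j p).ex σ) := by
  -- Iterations beyond the limit do nothing, so the invariant is stated at `min i (σ 0 j)`, which
  -- stops growing there.
  have := forN_rule (p := ite (.sub (.get 0 (.lit j)) (.get c (.lit 0))) p skip) (σ := σ)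
    (by rw [← h]; exact wf_forLt) (fun i τ => I (min i (σ 0 j)) τ) (fun i τ v => hI _ _ _)
    (by simpa using h0) (by
      intro i τ hi hc hfr hIτ
      have hz : τ 0 = σ 0 := hfr 0 (by
        rw [show (forN c (ite (.sub (.get 0 (.lit j)) (.get c (.lit 0))) p skip)).writes =
          (forN c p).writes from writes_forLt]
        exact zero_notMem_writes h)
      simp only [ex, RExpr.eval, hz, hc]
      by_cases hij : i < σ 0 j
      · rw [if_pos (by omega), min_eq_left (by omega)]
        rw [min_eq_left (by omega)] at hIτ
        exact hs i τ hij hc (fun a ha => hfr a (by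
          rw [show (forN c (ite (.sub (.get 0 (.lit j)) (.get c (.lit 0))) p skip)).writes =
            (forN c p).writes from writes_forLt]
          exact ha)) hIτ
      · rw [if_neg (by omega), min_eq_right (by omega)]
        rwa [min_eq_right (by omega)] at hIτ)
  rwa [min_eq_right hl] at this

end BProg

/-! ### Cuts -/

namespace MGraph

variable {G : MGraph}

/-- The edge `e` leaves the vertex set `S`. -/
def Crosses (G : MGraph) (S : Set (Fin G.n)) (e : Fin G.m) : Prop :=
  (G.tail e ∈ S ∧ G.head e ∉ S) ∨ (G.directed = false ∧ G.tail e ∉ S ∧ G.head e ∈ S)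

open Classical in
/-- The number of edges of `G - F` that leave `S`. -/
noncomputable def cut (G : MGraph) (F : Finset (Fin G.m)) (S : Set (Fin G.n)) : ℕ :=
  (Finset.univ.filter fun e => e ∉ F ∧ G.Crosses S e).card

open Classical in
/-- The number of edges of `G - F` between `A` and `B`, in either direction. -/
noncomputable def between (G : MGraph) (F : Finset (Fin G.m)) (A B : Set (Fin G.n)) : ℕ :=
  (Finset.univ.filter fun e => e ∉ F ∧
    ((G.tail e ∈ A ∧ G.head e ∈ B) ∨ (G.tail e ∈ B ∧ G.head e ∈ A))).card

/-- A comparison edge by edge. Only edges leaving the set are counted, so this covers digraphs as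
well. -/
theorem cut_submod (F : Finset (Fin G.m)) (S T : Set (Fin G.n)) :
    G.cut F (S ∩ T) + G.cut F (S ∪ T) ≤ G.cut F S + G.cut F T := by
  classical
  simp only [cut, Finset.card_filter, ← Finset.sum_add_distrib]
  refine Finset.sum_le_sum fun e _ => ?_
  by_cases h0 : e ∈ F
  · simp [h0]
  by_cases h1 : G.tail e ∈ S <;> by_cases h2 : G.tail e ∈ T <;> by_cases h3 : G.head e ∈ S <;>
    by_cases h4 : G.head e ∈ T <;> by_cases h5 : G.directed = false <;>
    simp [Crosses, h0, h1, h2, h3, h4, h5]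

theorem cut_compl (hG : G.directed = false) (F : Finset (Fin G.m)) (S : Set (Fin G.n)) :
    G.cut F Sᶜ = G.cut F S := by
  classical
  unfold cut
  congr 1
  ext e
  simp only [Finset.mem_filter, Finset.mem_univ, true_and, Crosses, hG, Set.mem_compl_iff, not_not]
  tauto

theorem crosses_compl (hG : G.directed = false) (S : Set (Fin G.n)) (e : Fin G.m) :
    G.Crosses Sᶜ e ↔ G.Crosses S e := by
  simp only [Crosses, hG, Set.mem_compl_iff, not_not]
  tauto

/-- The exact defect of submodularity: an edge between `S \ T` and `T \ S` lies in both cuts on the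
left and in neither cut on the right. The factor 2 is where the parity of `lam` enters. -/
theorem cut_add_cut_eq (hG : G.directed = false) (F : Finset (Fin G.m)) (S T : Set (Fin G.n)) :
    G.cut F S + G.cut F T =
      G.cut F (S ∩ T) + G.cut F (S ∪ T) + 2 * G.between F (S \ T) (T \ S) := by
  classical
  simp only [cut, between, Finset.card_filter, ← Finset.sum_add_distrib, Finset.mul_sum]
  refine Finset.sum_congr rfl fun e _ => ?_
  by_cases h0 : e ∈ F
  · simp [h0]
  by_cases h1 : G.tail e ∈ S <;> by_cases h2 : G.tail e ∈ T <;> by_cases h3 : G.head e ∈ S <;>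
    by_cases h4 : G.head e ∈ T <;> simp [Crosses, h0, h1, h2, h3, h4, hG]

/-- Morally the preceding identity for `S` and `Tᶜ`, because complementary sets have the same cut in
a graph. -/
theorem cut_add_cut_eq_sdiff (hG : G.directed = false) (F : Finset (Fin G.m))
    (S T : Set (Fin G.n)) :
    G.cut F S + G.cut F T =
      G.cut F (S \ T) + G.cut F (T \ S) + 2 * G.between F (S ∩ T) (S ∪ T)ᶜ := by
  classical
  simp only [cut, between, Finset.card_filter, ← Finset.sum_add_distrib, Finset.mul_sum]
  refine Finset.sum_congr rfl fun e _ => ?_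
  by_cases h0 : e ∈ F
  · simp [h0]
  by_cases h1 : G.tail e ∈ S <;> by_cases h2 : G.tail e ∈ T <;> by_cases h3 : G.head e ∈ S <;>
    by_cases h4 : G.head e ∈ T <;> simp [Crosses, h0, h1, h2, h3, h4, hG]

theorem cut_anti {F F' : Finset (Fin G.m)} (h : F ⊆ F') (S : Set (Fin G.n)) :
    G.cut F' S ≤ G.cut F S := by
  classical
  refine Finset.card_le_card fun e he => ?_
  simp only [Finset.mem_filter, Finset.mem_univ, true_and] at he ⊢
  exact ⟨fun h' => he.1 (h h'), he.2⟩

open Classical in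
theorem cut_le_cut_union (F D : Finset (Fin G.m)) (S : Set (Fin G.n)) :
    G.cut F S ≤ G.cut (F ∪ D) S + (D.filter fun e => G.Crosses S e).card := by
  refine le_trans (Finset.card_le_card ?_) (Finset.card_union_le _ _)
  intro e he
  simp only [Finset.mem_filter, Finset.mem_univ, true_and, Finset.mem_union, not_or] at he ⊢
  tauto

open Classical in
theorem cut_union_eq {F D : Finset (Fin G.m)} (h : Disjoint F D) (S : Set (Fin G.n)) :
    G.cut F S = G.cut (F ∪ D) S + (D.filter fun e => G.Crosses S e).card := by
  unfold cut
  rw [← Finset.card_union_of_disjoint]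
  · congr 1
    ext e
    have : e ∈ F → e ∉ D := fun he => Finset.disjoint_left.mp h he
    simp only [Finset.mem_filter, Finset.mem_univ, true_and, Finset.mem_union, not_or]
    tauto
  · rw [Finset.disjoint_left]
    intro e
    simp only [Finset.mem_filter, Finset.mem_univ, true_and, Finset.mem_union, not_or]
    tauto

theorem exists_mem_notMem_of_reach {α : Type*} {r : α → α → Prop} {u v : α}
    (h : Relation.ReflTransGen r u v) {S : Set α} (hu : u ∈ S) (hv : v ∉ S) :
    ∃ x y, x ∈ S ∧ y ∉ S ∧ r x y := by
  induction h with
  | refl => exact absurd hu hv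
  | @tail y z _ hyz ih =>
    by_cases hy : y ∈ S
    · exact ⟨y, z, hy, hv, hyz⟩
    · exact ih hy

/-- In one direction delete a cut that is too small; in the other, take the set reachable from `u`
after a deletion, which only deleted edges can leave. From here on connectivity is a statement about
cuts. -/
theorem edgeConnectedWithout_iff {lam : ℕ} {F : Finset (Fin G.m)} :
    G.EdgeConnectedWithout lam F ↔
      ∀ (S : Set (Fin G.n)) (u v), u ∈ S → v ∉ S → lam ≤ G.cut F S := by
  classical
  constructor
  · intro h S u v hu hv
    by_contra hlt
    obtain ⟨x, y, hx, hy, e, he, hxy⟩ := exists_mem_notMem_of_reach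
      (h (Finset.univ.filter fun e => e ∉ F ∧ G.Crosses S e) (not_le.mp hlt) u v) hu hv
    refine he ?_
    simp only [Finset.mem_union, Finset.mem_filter, Finset.mem_univ, true_and]
    by_cases heF : e ∈ F
    · exact Or.inl heF
    · refine Or.inr ⟨heF, ?_⟩
      rcases hxy with ⟨rfl, rfl⟩ | ⟨hd, rfl, rfl⟩
      · exact Or.inl ⟨hx, hy⟩
      · exact Or.inr ⟨hd, hy, hx⟩
  · intro h D hD u v
    by_contra hv
    have := h {w | Relation.ReflTransGen (G.Step (F ∪ D)) u w} u v Relation.ReflTransGen.refl hv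
    have h2 := cut_le_cut_union F D {w | Relation.ReflTransGen (G.Step (F ∪ D)) u w}
    have h3 : G.cut (F ∪ D) {w | Relation.ReflTransGen (G.Step (F ∪ D)) u w} = 0 := by
      unfold cut
      rw [Finset.card_eq_zero, Finset.filter_eq_empty_iff]
      rintro e - ⟨he, hc⟩
      rcases hc with ⟨h1, h2⟩ | ⟨hd, h1, h2⟩
      · exact h2 (Relation.ReflTransGen.tail h1 ⟨e, he, Or.inl ⟨rfl, rfl⟩⟩)
      · exact h1 (Relation.ReflTransGen.tail h2 ⟨e, he, Or.inr ⟨hd, rfl, rfl⟩⟩)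
    have h4 := Finset.card_filter_le D
      (fun e => G.Crosses {w | Relation.ReflTransGen (G.Step (F ∪ D)) u w} e)
    omega

theorem EdgeConnectedWithout.anti {lam : ℕ} {F F' : Finset (Fin G.m)} (h : F ⊆ F')
    (hF : G.EdgeConnectedWithout lam F') : G.EdgeConnectedWithout lam F := by
  rw [edgeConnectedWithout_iff] at hF ⊢
  exact fun S u v hu hv => (hF S u v hu hv).trans (cut_anti h S)

theorem crosses_exists {S : Set (Fin G.n)} {e : Fin G.m} (h : G.Crosses S e) :
    ∃ u v, u ∈ S ∧ v ∉ S := by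
  rcases h with ⟨h1, h2⟩ | ⟨-, h1, h2⟩
  · exact ⟨_, _, h1, h2⟩
  · exact ⟨_, _, h2, h1⟩

/-- An edge that can be deleted lies only in cuts with more than `lam` edges. -/
theorem EdgeConnectedWithout.lt_cut {lam : ℕ} {F : Finset (Fin G.m)} {e : Fin G.m}
    (h : G.EdgeConnectedWithout lam (insert e F)) (he : e ∉ F) {S : Set (Fin G.n)}
    (hS : G.Crosses S e) : lam + 1 ≤ G.cut F S := by
  classical
  obtain ⟨u, v, hu, hv⟩ := crosses_exists hS
  have h1 := edgeConnectedWithout_iff.mp h S u v hu hv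
  have h2 := cut_union_eq (F := F) (D := {e}) (by simpa using he) S
  rw [Finset.filter_singleton, if_pos hS, Finset.card_singleton, Finset.union_comm,
    ← Finset.insert_eq] at h2
  omega

end MGraph

/-! ### Chains of tight cuts -/

namespace MGraph

variable {G : MGraph}

open Classical in
/-- A set `Z` of edges of `G - F`, linearly ordered by `pos`, together with an increasing family of
cuts `X e` with `lam + 1` edges that separate `a` from `b`, such that `e ∈ Z` leads from `X e` to its
complement and the other edges of `Z` do not lie in this cut. -/
structure Ladder (G : MGraph) (lam : ℕ) (F : Finset (Fin G.m)) where
  Z : Finset (Fin G.m)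
  pos : Fin G.m → ℕ
  X : Fin G.m → Set (Fin G.n)
  u : Fin G.m → Fin G.n
  v : Fin G.m → Fin G.n
  a : Fin G.n
  b : Fin G.n
  injOn : Set.InjOn pos Z
  cut_X : ∀ e ∈ Z, G.cut F (X e) = lam + 1
  a_mem : ∀ e ∈ Z, a ∈ X e
  b_notMem : ∀ e ∈ Z, b ∉ X e
  u_mem : ∀ e ∈ Z, u e ∈ X e
  v_notMem : ∀ e ∈ Z, v e ∉ X e
  mono : ∀ e ∈ Z, ∀ e' ∈ Z, pos e < pos e' → X e ⊆ X e'
  u_notMem : ∀ e ∈ Z, ∀ e' ∈ Z, pos e < pos e' → u e' ∉ X e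
  v_mem : ∀ e ∈ Z, ∀ e' ∈ Z, pos e < pos e' → v e ∈ X e'
  crosses_iff : ∀ e ∈ Z, ∀ Y, G.Crosses Y e ↔
    (u e ∈ Y ∧ v e ∉ Y) ∨ (G.directed = false ∧ u e ∉ Y ∧ v e ∈ Y)
  lt_cut : ∀ e ∈ Z, ∀ Y, G.Crosses Y e → lam + 1 ≤ G.cut F Y
  -- The number `p` will count all edges of the trail in the cut, not only those in `Z`; its parity
  -- would be lost on restriction to `Z`.
  separating : ∀ Y, a ∈ Y → b ∉ Y → ∃ p, (Z.filter fun e => G.Crosses Y e).card ≤ p ∧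
    lam + p ≤ G.cut F Y ∧ (G.directed = false → Odd p)

namespace Ladder

variable {lam : ℕ} {F : Finset (Fin G.m)} (L : G.Ladder lam F)

theorem v_notMem_of_le {i e : Fin G.m} (hi : i ∈ L.Z) (he : e ∈ L.Z) (h : L.pos i ≤ L.pos e) :
    L.v e ∉ L.X i := by
  rcases h.eq_or_lt with h | h
  · rw [← L.injOn hi he h]
    exact L.v_notMem i hi
  · exact fun h' => L.v_notMem e he (L.mono i hi e he h h')

theorem u_mem_of_le {e j : Fin G.m} (he : e ∈ L.Z) (hj : j ∈ L.Z) (h : L.pos e ≤ L.pos j) :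
    L.u e ∈ L.X j := by
  rcases h.eq_or_lt with h | h
  · rw [L.injOn he hj h]
    exact L.u_mem j hj
  · exact L.mono e he j hj h (L.u_mem e he)

theorem card_le_of_separating {Y : Set (Fin G.n)} (ha : L.a ∈ Y) (hb : L.b ∉ Y)
    {C : Finset (Fin G.m)} (hC : ∀ e ∈ C, e ∈ L.Z ∧ G.Crosses Y e) :
    lam + C.card ≤ G.cut F Y := by
  classical
  obtain ⟨p, hp, hcut, -⟩ := L.separating Y ha hb
  have : C.card ≤ (L.Z.filter fun e => G.Crosses Y e).card :=
    Finset.card_le_card fun e he => Finset.mem_filter.mpr (hC e he)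
  omega

/-- Two edges of the ladder force `p ≥ 2`, and as `p` is odd it is at least 3. -/
theorem three_le_of_separating (hG : G.directed = false) {Y : Set (Fin G.n)} (ha : L.a ∈ Y)
    (hb : L.b ∉ Y) {i j : Fin G.m} (hi : i ∈ L.Z) (hj : j ∈ L.Z) (hij : i ≠ j)
    (hYi : G.Crosses Y i) (hYj : G.Crosses Y j) : lam + 3 ≤ G.cut F Y := by
  classical
  obtain ⟨p, hp, hcut, hodd⟩ := L.separating Y ha hb
  have : ({i, j} : Finset (Fin G.m)).card ≤ (L.Z.filter fun e => G.Crosses Y e).card := by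
    refine Finset.card_le_card fun e he => Finset.mem_filter.mpr ?_
    simp only [Finset.mem_insert, Finset.mem_singleton] at he
    rcases he with rfl | rfl
    · exact ⟨hi, hYi⟩
    · exact ⟨hj, hYj⟩
  rw [Finset.card_pair hij] at this
  obtain ⟨q, rfl⟩ := hodd hG
  omega

/-- Uncrossing: `i` leaves `Y ∩ X i`, so this cut is at least as large as that of `X i`, and
submodularity passes the gain on to the union. The next lemma is the dual statement. -/
theorem cut_union_le {i : Fin G.m} (hi : i ∈ L.Z) {Y : Set (Fin G.n)} (hu : L.u i ∈ Y)
    (hv : L.v i ∉ Y) : G.cut F (Y ∪ L.X i) ≤ G.cut F Y := by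
  have h1 := cut_submod F Y (L.X i)
  have h2 := L.lt_cut i hi (Y ∩ L.X i) ((L.crosses_iff i hi _).mpr
    (Or.inl ⟨⟨hu, L.u_mem i hi⟩, fun h => hv h.1⟩))
  have h3 := L.cut_X i hi
  omega

theorem cut_inter_le {j : Fin G.m} (hj : j ∈ L.Z) {Y : Set (Fin G.n)} (hu : L.u j ∈ Y)
    (hv : L.v j ∉ Y) : G.cut F (Y ∩ L.X j) ≤ G.cut F Y := by
  have h1 := cut_submod F Y (L.X j)
  have h2 := L.lt_cut j hj (Y ∪ L.X j) ((L.crosses_iff j hj _).mpr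
    (Or.inl ⟨Or.inl hu, fun h => h.elim hv (L.v_notMem j hj)⟩))
  have h3 := L.cut_X j hj
  omega

/-- The same uncrossing when `j` enters `Y`: now `j` also enters `Y \ X j`, and the identity for
differences replaces submodularity. -/
theorem cut_sdiff_le (hG : G.directed = false) {j : Fin G.m} (hj : j ∈ L.Z) {Y : Set (Fin G.n)}
    (hu : L.u j ∉ Y) (hv : L.v j ∈ Y) : G.cut F (L.X j \ Y) ≤ G.cut F Y := by
  have h1 := cut_add_cut_eq_sdiff hG F Y (L.X j)
  have h2 := L.lt_cut j hj (Y \ L.X j) ((L.crosses_iff j hj _).mpr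
    (Or.inr ⟨hG, fun h => hu h.1, hv, L.v_notMem j hj⟩))
  have h3 := L.cut_X j hj
  omega

/-- If the first and last edges both lead out of `Y`, then `Y` can be replaced by `(Y ∪ X i) ∩ X j`
without enlarging the cut. The new set separates `a` from `b` and is still crossed by all edges of
`C`, so the bound for separating sets applies. -/
theorem card_le_of_ends {i j : Fin G.m} (hi : i ∈ L.Z) (hj : j ∈ L.Z)
    (hij : L.pos i < L.pos j) {Y : Set (Fin G.n)} (hui : L.u i ∈ Y) (hvi : L.v i ∉ Y)
    (huj : L.u j ∈ Y) (hvj : L.v j ∉ Y) {C : Finset (Fin G.m)}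
    (hC : ∀ e ∈ C, e ∈ L.Z ∧ G.Crosses Y e ∧ L.pos i ≤ L.pos e ∧ L.pos e ≤ L.pos j) :
    lam + C.card ≤ G.cut F Y := by
  have hvji : L.v j ∉ L.X i := L.v_notMem_of_le hi hj hij.le
  have h1 := L.cut_union_le hi hui hvi
  have h2 := L.cut_inter_le hj (Y := Y ∪ L.X i) (Or.inl huj) (fun h => h.elim hvj hvji)
  have h3 := L.card_le_of_separating (Y := (Y ∪ L.X i) ∩ L.X j) (C := C)
    ⟨Or.inr (L.a_mem i hi), L.a_mem j hj⟩ (fun h => L.b_notMem j hj h.2) (by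
      intro e he
      obtain ⟨heZ, hYe, hie, hej⟩ := hC e he
      refine ⟨heZ, ?_⟩
      rcases hej.eq_or_lt with h | hej'
      · rw [L.injOn heZ hj h]
        exact (L.crosses_iff j hj _).mpr
          (Or.inl ⟨⟨Or.inl huj, L.u_mem j hj⟩, fun h => L.v_notMem j hj h.2⟩)
      · have hvj' : L.v e ∈ L.X j := L.v_mem e heZ j hj hej'
        have huj' : L.u e ∈ L.X j := L.u_mem_of_le heZ hj hej
        have hvi' : L.v e ∉ L.X i := L.v_notMem_of_le hi heZ hie
        rcases hie.eq_or_lt with h | hie'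
        · obtain rfl : i = e := L.injOn hi heZ h
          exact (L.crosses_iff i hi _).mpr
            (Or.inl ⟨⟨Or.inl hui, huj'⟩, fun h => h.1.elim hvi hvi'⟩)
        · have hui' : L.u e ∉ L.X i := L.u_notMem i hi e heZ hie'
          rw [L.crosses_iff e heZ] at hYe ⊢
          simp only [Set.mem_inter_iff, Set.mem_union, hvj', huj', hvi', hui', or_false, and_true]
          exact hYe)
  omega

/-- In a digraph, all edges of a ladder can be deleted together. -/
theorem card_le_cut_of_directed (hG : G.directed = true) {C : Finset (Fin G.m)}
    (hne : C.Nonempty) {Y : Set (Fin G.n)} (hC : ∀ e ∈ C, e ∈ L.Z ∧ G.Crosses Y e) :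
    lam + C.card ≤ G.cut F Y := by
  obtain ⟨i, hi, himin⟩ := C.exists_min_image L.pos hne
  obtain ⟨j, hj, hjmax⟩ := C.exists_max_image L.pos hne
  have huv : ∀ e ∈ C, L.u e ∈ Y ∧ L.v e ∉ Y := fun e he => by
    simpa [hG] using (L.crosses_iff e (hC e he).1 Y).mp (hC e he).2
  rcases (himin j hj).eq_or_lt with h | h
  · have hone : C.card ≤ 1 := Finset.card_le_one.mpr fun x hx y hy => by
      have h1 := himin x hx
      have h2 := hjmax x hx
      have h3 := himin y hy
      have h4 := hjmax y hy
      exact L.injOn (hC x hx).1 (hC y hy).1 (by omega)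
    have := L.lt_cut i (hC i hi).1 Y (hC i hi).2
    omega
  · exact L.card_le_of_ends (hC i hi).1 (hC j hj).1 h (huv i hi).1 (huv i hi).2 (huv j hj).1
      (huv j hj).2 fun e he => ⟨(hC e he).1, (hC e he).2, himin e he, hjmax e he⟩

/-- In a graph, a set of edges of a ladder can be deleted if this is true of all pairs. -/
theorem card_le_cut_of_pairs (hG : G.directed = false) {C : Finset (Fin G.m)} (hCZ : C ⊆ L.Z)
    (hpair : ∀ x ∈ C, ∀ y ∈ C, x ≠ y → ∀ Y, G.Crosses Y x → G.Crosses Y y → lam + 2 ≤ G.cut F Y)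
    (hne : C.Nonempty) {Y : Set (Fin G.n)} (hC : ∀ e ∈ C, G.Crosses Y e) :
    lam + C.card ≤ G.cut F Y := by
  classical
  -- Induction on the size of `C`, for all `Y` at once; the hypothesis on pairs settles sizes up to
  -- 2.
  induction hr : C.card using Nat.strong_induction_on generalizing C Y with
  | _ r ih =>
  obtain ⟨i, hi, himin⟩ := C.exists_min_image L.pos hne
  obtain ⟨j, hj, hjmax⟩ := C.exists_max_image L.pos hne
  have hiZ := hCZ hi
  have hjZ := hCZ hj
  have hr0 : 0 < r := hr ▸ hne.card_pos
  rcases Nat.lt_or_ge r 3 with hr3 | hr3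
  · by_cases h1 : r = 1
    · have := L.lt_cut i hiZ Y (hC i hi)
      omega
    · obtain ⟨x, y, hxy, rfl⟩ := Finset.card_eq_two.mp (show C.card = 2 by omega)
      have := hpair x (by simp) y (by simp) hxy Y (hC x (by simp)) (hC y (by simp))
      omega
  -- we may assume that `i` leads out of `Y`
  wlog hui : L.u i ∈ Y generalizing Y
  · have := this (Y := Yᶜ) (fun e he => (crosses_compl hG Y e).mpr (hC e he)) hui
    rwa [cut_compl hG] at this
  have hvi : L.v i ∉ Y := by
    rcases (L.crosses_iff i hiZ Y).mp (hC i hi) with h | h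
    · exact h.2
    · exact absurd hui h.2.1
  have hlt : ∀ e ∈ C, e ≠ i → L.pos i < L.pos e := fun e he hei =>
    lt_of_le_of_ne (himin e he) fun h => hei (L.injOn (hCZ he) hiZ h.symm)
  obtain ⟨l, hl, hlmin⟩ := (C.erase i).exists_min_image L.pos
    (Finset.card_pos.mp (by rw [Finset.card_erase_of_mem hi]; omega))
  have hlC := Finset.mem_of_mem_erase hl
  have hlZ := hCZ hlC
  have hil := hlt l hlC (Finset.ne_of_mem_erase hl)
  have hlj : L.pos l < L.pos j := by
    by_contra hcon
    have : (C.erase i).card ≤ 1 := Finset.card_le_one.mpr fun x hx y hy => by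
      have h1 := hlmin x hx
      have h2 := hjmax x (Finset.mem_of_mem_erase hx)
      have h3 := hlmin y hy
      have h4 := hjmax y (Finset.mem_of_mem_erase hy)
      exact L.injOn (hCZ (Finset.mem_of_mem_erase hx)) (hCZ (Finset.mem_of_mem_erase hy)) (by omega)
    rw [Finset.card_erase_of_mem hi] at this
    omega
  have hij := hil.trans hlj
  rcases (L.crosses_iff j hjZ Y).mp (hC j hj) with ⟨huj, hvj⟩ | ⟨-, huj, hvj⟩
  · rw [← hr]
    exact L.card_le_of_ends hiZ hjZ hij hui hvi huj hvj
      fun e he => ⟨hCZ he, hC e he, himin e he, hjmax e he⟩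
  -- Now `i` leads out of `Y` and `j` leads into it. The set `Y'` below has no larger cut and lies
  -- in `X j \ X i`. The edges of `C` strictly between `i` and `j` have both ends in `X j \ X i`,
  -- where `Y'` is the complement of `Y`; so all of `C` still crosses.
  have h1 := L.cut_union_le hiZ hui hvi
  have h2 := L.cut_sdiff_le hG hjZ (Y := Y ∪ L.X i)
    (fun h => h.elim huj (L.u_notMem i hiZ j hjZ hij)) (Or.inl hvj)
  set Y' := L.X j \ (Y ∪ L.X i) with hY'
  have hmem : ∀ e ∈ C, e ≠ i → e ≠ j → (L.u e ∈ Y' ↔ L.u e ∉ Y) ∧ (L.v e ∈ Y' ↔ L.v e ∉ Y) := by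
    intro e he hei hej
    have hej' : L.pos e < L.pos j :=
      lt_of_le_of_ne (hjmax e he) fun h => hej (L.injOn (hCZ he) hjZ h)
    have a1 := L.v_mem e (hCZ he) j hjZ hej'
    have a2 := L.u_mem_of_le (hCZ he) hjZ hej'.le
    have a3 := L.v_notMem_of_le hiZ (hCZ he) (hlt e he hei).le
    have a4 := L.u_notMem i hiZ e (hCZ he) (hlt e he hei)
    simp [hY', a1, a2, a3, a4]
  have hui' : L.u i ∉ Y' := fun h => h.2 (Or.inl hui)
  have hvi' : L.v i ∈ Y' := ⟨L.v_mem i hiZ j hjZ hij, fun h => h.elim hvi (L.v_notMem i hiZ)⟩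
  have huj' : L.u j ∈ Y' :=
    ⟨L.u_mem j hjZ, fun h => h.elim huj (L.u_notMem i hiZ j hjZ hij)⟩
  have hvj' : L.v j ∉ Y' := fun h => L.v_notMem j hjZ h.1
  have hY'C : ∀ e ∈ C, G.Crosses Y' e := by
    intro e he
    by_cases hei : e = i
    · rw [hei]
      exact (L.crosses_iff i hiZ _).mpr (Or.inr ⟨hG, hui', hvi'⟩)
    by_cases hej : e = j
    · rw [hej]
      exact (L.crosses_iff j hjZ _).mpr (Or.inl ⟨huj', hvj'⟩)
    have := (L.crosses_iff e (hCZ he) _).mp (hC e he)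
    rw [L.crosses_iff e (hCZ he), (hmem e he hei hej).1, (hmem e he hei hej).2]
    tauto
  have hout : ∀ e ∈ C.erase i, e ≠ l → L.u e ∉ L.X l ∧ L.v e ∉ L.X l := by
    intro e he hel
    have heZ := hCZ (Finset.mem_of_mem_erase he)
    have : L.pos l < L.pos e := lt_of_le_of_ne (hlmin e he) fun h => hel (L.injOn heZ hlZ h.symm)
    exact ⟨L.u_notMem l hlZ e heZ this, L.v_notMem_of_le hlZ heZ this.le⟩
  have hcard : (C.erase i).card = r - 1 := by rw [Finset.card_erase_of_mem hi, hr]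
  have hXl := L.cut_X l hlZ
  have hvil : L.v i ∈ L.X l := L.v_mem i hiZ l hlZ hil
  rcases (L.crosses_iff l hlZ _).mp (hY'C l hlC) with ⟨hul, hvl⟩ | ⟨-, hul, hvl⟩
  -- The second edge `l` leads out of `Y'`. The intersection with `X l` is crossed by the pair `i`,
  -- `l` and has at least `lam + 2` edges; the union separates `a` from `b` and has at least `lam +
  -- r - 1`. Submodularity with the `lam + 1` edges of `X l` gives the claim.
  · have b1 := hpair i hi l hlC (Finset.ne_of_mem_erase hl).symm (L.X l ∩ Y')
      ((L.crosses_iff i hiZ _).mpr (Or.inr ⟨hG, fun h => hui' h.2, hvil, hvi'⟩))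
      ((L.crosses_iff l hlZ _).mpr (Or.inl ⟨⟨L.u_mem l hlZ, hul⟩, fun h => hvl h.2⟩))
    have b2 := L.card_le_of_separating (Y := L.X l ∪ Y') (C := C.erase i) (Or.inl (L.a_mem l hlZ))
      (fun h => h.elim (L.b_notMem l hlZ) fun h => L.b_notMem j hjZ h.1) (by
        intro e he
        have heZ := hCZ (Finset.mem_of_mem_erase he)
        refine ⟨heZ, ?_⟩
        by_cases hel : e = l
        · rw [hel]
          exact (L.crosses_iff l hlZ _).mpr
            (Or.inl ⟨Or.inr hul, fun h => h.elim (L.v_notMem l hlZ) hvl⟩)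
        · have := (L.crosses_iff e heZ _).mp (hY'C e (Finset.mem_of_mem_erase he))
          rw [L.crosses_iff e heZ]
          simpa [(hout e he hel).1, (hout e he hel).2] using this)
    have b3 := cut_submod F (L.X l) Y'
    omega
  -- The second edge leads into `Y'`. Here `X l \ Y'` separates `a` from `b`, and `Y' \ X l` is
  -- crossed by all of `C` except `i`, so that induction applies.
  · have b1 := L.three_le_of_separating hG (Y := L.X l \ Y')
      ⟨L.a_mem l hlZ, fun h => h.2 (Or.inr (L.a_mem i hiZ))⟩ (fun h => L.b_notMem l hlZ h.1)
      hiZ hlZ (Finset.ne_of_mem_erase hl).symm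
      ((L.crosses_iff i hiZ _).mpr
        (Or.inl ⟨⟨L.u_mem_of_le hiZ hlZ hil.le, hui'⟩, fun h => h.2 hvi'⟩))
      ((L.crosses_iff l hlZ _).mpr
        (Or.inl ⟨⟨L.u_mem l hlZ, hul⟩, fun h => L.v_notMem l hlZ h.1⟩))
    have b2 := ih (r - 1) (by omega) (C := C.erase i) (Y := Y' \ L.X l)
      (fun e he => hCZ (Finset.mem_of_mem_erase he))
      (fun x hx y hy => hpair x (Finset.mem_of_mem_erase hx) y (Finset.mem_of_mem_erase hy))
      ⟨l, hl⟩ (by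
        intro e he
        have heZ := hCZ (Finset.mem_of_mem_erase he)
        by_cases hel : e = l
        · rw [hel]
          exact (L.crosses_iff l hlZ _).mpr
            (Or.inr ⟨hG, fun h => hul h.1, hvl, L.v_notMem l hlZ⟩)
        · have := (L.crosses_iff e heZ _).mp (hY'C e (Finset.mem_of_mem_erase he))
          rw [L.crosses_iff e heZ]
          simpa [(hout e he hel).1, (hout e he hel).2] using this) hcard
    have b3 := cut_add_cut_eq_sdiff hG F (L.X l) Y'
    omega

/-! ### Rungs: the obstructions to deleting two ladder edges together. -/

/-- A cut with `lam + 1` edges through `i` and `j`, in normal position. -/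
structure IsRung (i j : Fin G.m) (Y : Set (Fin G.n)) : Prop where
  subset : Y ⊆ L.X j
  notMem : ∀ x ∈ L.X i, x ∉ Y
  v_mem : L.v i ∈ Y
  u_mem : L.u j ∈ Y
  cut_eq : G.cut F Y = lam + 1

/-- After complementing, `i` leads out of `Y`. If `j` did so too, `card_le_of_ends` would give `lam
+ 2` edges. So `j` leads in, and `X j \ (Y ∪ X i)` is in normal position; its cut cannot drop below
`lam + 1` because `j` crosses it. -/
theorem exists_isRung (hG : G.directed = false) {i j : Fin G.m} (hi : i ∈ L.Z) (hj : j ∈ L.Z)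
    (hij : L.pos i < L.pos j) {Y : Set (Fin G.n)} (hYi : G.Crosses Y i) (hYj : G.Crosses Y j)
    (hY : G.cut F Y ≤ lam + 1) : ∃ Y', L.IsRung i j Y' := by
  classical
  wlog hui : L.u i ∈ Y generalizing Y
  · exact this (Y := Yᶜ) ((crosses_compl hG Y i).mpr hYi) ((crosses_compl hG Y j).mpr hYj)
      (by rwa [cut_compl hG]) hui
  have hvi : L.v i ∉ Y := by
    rcases (L.crosses_iff i hi Y).mp hYi with h | h
    · exact h.2
    · exact absurd hui h.2.1
  have hne : i ≠ j := fun h => by rw [h] at hij; exact lt_irrefl _ hij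
  rcases (L.crosses_iff j hj Y).mp hYj with ⟨huj, hvj⟩ | ⟨-, huj, hvj⟩
  · have := L.card_le_of_ends hi hj hij hui hvi huj hvj (C := {i, j}) (by
      intro e he
      simp only [Finset.mem_insert, Finset.mem_singleton] at he
      rcases he with rfl | rfl
      · exact ⟨hi, hYi, le_rfl, hij.le⟩
      · exact ⟨hj, hYj, hij.le, le_rfl⟩)
    rw [Finset.card_pair hne] at this
    omega
  have h1 := L.cut_union_le hi hui hvi
  have h2 := L.cut_sdiff_le hG hj (Y := Y ∪ L.X i)
    (fun h => h.elim huj (L.u_notMem i hi j hj hij)) (Or.inl hvj)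
  have huj' : L.u j ∈ L.X j \ (Y ∪ L.X i) :=
    ⟨L.u_mem j hj, fun h => h.elim huj (L.u_notMem i hi j hj hij)⟩
  refine ⟨L.X j \ (Y ∪ L.X i), Set.sdiff_subset, fun x hx h => h.2 (Or.inr hx),
    ⟨L.v_mem i hi j hj hij, fun h => h.elim hvi (L.v_notMem i hi)⟩, huj', ?_⟩
  have h3 := L.lt_cut j hj (L.X j \ (Y ∪ L.X i))
    ((L.crosses_iff j hj _).mpr (Or.inl ⟨huj', fun h => L.v_notMem j hj h.1⟩))
  omega

theorem IsRung.crosses_left {L : G.Ladder lam F} (hG : G.directed = false) {i j : Fin G.m}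
    (hi : i ∈ L.Z) {Y : Set (Fin G.n)} (h : L.IsRung i j Y) : G.Crosses Y i :=
  (L.crosses_iff i hi _).mpr (Or.inr ⟨hG, h.notMem _ (L.u_mem i hi), h.v_mem⟩)

theorem IsRung.crosses_right {L : G.Ladder lam F} {i j : Fin G.m}
    (hj : j ∈ L.Z) {Y : Set (Fin G.n)} (h : L.IsRung i j Y) : G.Crosses Y j :=
  (L.crosses_iff j hj _).mpr (Or.inl ⟨h.u_mem, fun h' => L.v_notMem j hj (h.subset h')⟩)

theorem cut_empty (F : Finset (Fin G.m)) : G.cut F ∅ = 0 := by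
  classical
  simp [cut, Crosses]

/-- An intermediate edge divides a rung into two rungs. -/
theorem IsRung.split {L : G.Ladder lam F} (hG : G.directed = false) {i l j : Fin G.m}
    (hi : i ∈ L.Z) (hl : l ∈ L.Z) (hj : j ∈ L.Z) (hil : L.pos i < L.pos l)
    (hlj : L.pos l < L.pos j) {Y : Set (Fin G.n)} (h : L.IsRung i j Y) :
    L.IsRung i l (Y ∩ L.X l) ∧ L.IsRung l j (Y \ L.X l) ∧
      2 * G.between F (Y ∩ L.X l) (Y \ L.X l) = lam + 1 ∧
      G.between F (Y ∩ L.X l) (Y ∪ L.X l)ᶜ = 0 := by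
  have hui : L.u i ∉ Y := h.notMem _ (L.u_mem i hi)
  have hvj : L.v j ∉ Y := fun h' => L.v_notMem j hj (h.subset h')
  have hvil : L.v i ∈ L.X l := L.v_mem i hi l hl hil
  have huil : L.u i ∈ L.X l := L.u_mem_of_le hi hl hil.le
  have hujl : L.u j ∉ L.X l := L.u_notMem l hl j hj hlj
  have hvjl : L.v j ∉ L.X l := L.v_notMem_of_le hl hj hlj.le
  have hil' : i ≠ l := fun h => by rw [h] at hil; exact lt_irrefl _ hil
  have hlj' : l ≠ j := fun h => by rw [h] at hlj; exact lt_irrefl _ hlj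
  have hXl := L.cut_X l hl
  have hY := h.cut_eq
  -- All four sets obtained by uncrossing `Y` and `X l` are crossed by `i` or `j`, hence have at
  -- least `lam + 1` leaving edges. Both uncrossing identities are therefore equalities without
  -- defect.
  have c1 := L.lt_cut i hi (Y ∩ L.X l)
    ((L.crosses_iff i hi _).mpr (Or.inr ⟨hG, fun h => hui h.1, h.v_mem, hvil⟩))
  have hju : G.Crosses (Y ∪ L.X l) j := (L.crosses_iff j hj _).mpr
    (Or.inl ⟨Or.inl h.u_mem, fun h => h.elim hvj hvjl⟩)
  have c2 := L.lt_cut j hj (Y ∪ L.X l) hju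
  have hix : G.Crosses (L.X l \ Y) i := (L.crosses_iff i hi _).mpr
    (Or.inl ⟨⟨huil, hui⟩, fun h' => h'.2 h.v_mem⟩)
  have c3 := L.lt_cut i hi (L.X l \ Y) hix
  have c4 := L.lt_cut j hj (Y \ L.X l)
    ((L.crosses_iff j hj _).mpr (Or.inl ⟨⟨h.u_mem, hujl⟩, fun h => hvj h.1⟩))
  have e1 := cut_add_cut_eq hG F Y (L.X l)
  have e2 := cut_add_cut_eq_sdiff hG F Y (L.X l)
  have hb : L.b ∉ Y ∪ L.X l := fun h' =>
    h'.elim (fun h'' => L.b_notMem j hj (h.subset h'')) (L.b_notMem l hl)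
  -- These two cuts have only `lam + 1` edges, separate `a` from `b`, and already contain `j` or
  -- `i`; by parity `l` cannot be in them. This puts both ends of `l` into `Y`.
  have hnl : ¬ G.Crosses (Y ∪ L.X l) l := fun hcr => by
    have := L.three_le_of_separating hG (Or.inr (L.a_mem l hl)) hb hl hj hlj' hcr hju
    omega
  have hnl' : ¬ G.Crosses (L.X l \ Y) l := fun hcr => by
    have := L.three_le_of_separating hG (Y := L.X l \ Y)
      ⟨L.a_mem l hl, h.notMem _ (L.a_mem i hi)⟩ (fun h => L.b_notMem l hl h.1) hi hl hil' hix hcr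
    omega
  have hvl : L.v l ∈ Y := by
    by_contra hv
    exact hnl ((L.crosses_iff l hl _).mpr
      (Or.inl ⟨Or.inr (L.u_mem l hl), fun h => h.elim hv (L.v_notMem l hl)⟩))
  have hul : L.u l ∈ Y := by
    by_contra hu
    exact hnl' ((L.crosses_iff l hl _).mpr
      (Or.inl ⟨⟨L.u_mem l hl, hu⟩, fun h => L.v_notMem l hl h.1⟩))
  refine ⟨⟨Set.inter_subset_right, fun x hx h' => h.notMem x hx h'.1, ⟨h.v_mem, hvil⟩,
    ⟨hul, L.u_mem l hl⟩, by omega⟩, ⟨fun x hx => h.subset hx.1, fun x hx h' => h'.2 hx,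
    ⟨hvl, L.v_notMem l hl⟩, ⟨h.u_mem, hujl⟩, by omega⟩, ?_, by omega⟩
  -- The two halves and their union all have `lam + 1` leaving edges, so the edges joining the
  -- halves number half of that.
  have e3 := cut_add_cut_eq hG F (Y ∩ L.X l) (Y \ L.X l)
  rw [show Y ∩ L.X l ∩ (Y \ L.X l) = ∅ by ext; simp +contextual,
    show Y ∩ L.X l ∪ Y \ L.X l = Y by ext; simp,
    show (Y ∩ L.X l) \ (Y \ L.X l) = Y ∩ L.X l by ext; simp; tauto,
    show (Y \ L.X l) \ (Y ∩ L.X l) = Y \ L.X l by ext; simp; tauto, cut_empty] at e3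
  omega

end Ladder

end MGraph

/-! ### Exchanging an edge of a deletion set -/

namespace MGraph

variable {G : MGraph}

theorem crosses_iff_of_undirected (hG : G.directed = false) {S : Set (Fin G.n)} {e : Fin G.m} :
    G.Crosses S e ↔ ¬ (G.tail e ∈ S ↔ G.head e ∈ S) := by
  simp only [Crosses, hG, true_and]
  tauto

theorem cut_eq_of_untouched {F : Finset (Fin G.m)} {S : Set (Fin G.n)}
    (h : ∀ e ∈ F, G.tail e ∉ S ∧ G.head e ∉ S) : G.cut F S = G.cut ∅ S := by
  classical
  unfold cut
  congr 1
  ext e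
  simp only [Finset.mem_filter, Finset.mem_univ, true_and, Finset.notMem_empty, not_false_eq_true,
    and_iff_right_iff_imp]
  intro hc he
  rcases hc with hc | hc
  · exact (h e he).1 hc.1
  · exact (h e he).2 hc.2.2

theorem between_eq_of_untouched {F : Finset (Fin G.m)} {A : Set (Fin G.n)}
    (h : ∀ e ∈ F, G.tail e ∉ A ∧ G.head e ∉ A) (B : Set (Fin G.n)) :
    G.between F A B = G.between ∅ A B := by
  classical
  unfold between
  congr 1
  ext e
  simp only [Finset.mem_filter, Finset.mem_univ, true_and, Finset.notMem_empty, not_false_eq_true,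
    and_iff_right_iff_imp]
  intro hc he
  rcases hc with hc | hc
  · exact (h e he).1 hc.1
  · exact (h e he).2 hc.2

theorem between_mono_right {F : Finset (Fin G.m)} (A : Set (Fin G.n)) {B B' : Set (Fin G.n)}
    (h : B ⊆ B') : G.between F A B ≤ G.between F A B' := by
  classical
  refine Finset.card_le_card fun e he => ?_
  simp only [Finset.mem_filter, Finset.mem_univ, true_and] at he ⊢
  exact ⟨he.1, he.2.imp (fun ha => ⟨ha.1, h ha.2⟩) fun hb => ⟨h hb.1, hb.2⟩⟩

/-- Three disjoint kinds of edges that leave `T`. -/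
theorem between_add_between_lt_cut (hG : G.directed = false) {K : Finset (Fin G.m)}
    {T A' B C : Set (Fin G.n)} {l : Fin G.m} (hl : l ∈ K) (hlT : G.Crosses T l)
    (hlB : G.tail l ∉ B ∧ G.head l ∉ B) (hBT : ∀ x ∈ B, x ∉ T) (hCT : ∀ x ∈ C, x ∉ T)
    (hA' : A' ⊆ T)
    (hdisj : ∀ e, (G.tail e ∈ A' ∧ G.head e ∈ C) ∨ (G.tail e ∈ C ∧ G.head e ∈ A') →
      G.tail e ∉ B ∧ G.head e ∉ B) :
    G.between K A' C + G.between ∅ T B + 1 ≤ G.cut ∅ T := by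
  classical
  simp only [between, cut]
  rw [← Finset.card_union_of_disjoint, ← Finset.card_insert_of_notMem (a := l)]
  · refine Finset.card_le_card fun e he => ?_
    rw [Finset.mem_insert] at he
    rcases he with rfl | he
    · simpa using hlT
    · simp only [Finset.mem_union, Finset.mem_filter, Finset.mem_univ, true_and,
        Finset.notMem_empty, not_false_eq_true, crosses_iff_of_undirected hG] at he ⊢
      rcases he with ⟨-, ⟨h1, h2⟩ | ⟨h1, h2⟩⟩ | ⟨h1, h2⟩ | ⟨h1, h2⟩
      · have := hA' h1
        have := hCT _ h2
        tauto
      · have := hA' h2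
        have := hCT _ h1
        tauto
      · have := hBT _ h2
        tauto
      · have := hBT _ h1
        tauto
  · simp only [Finset.mem_union, Finset.mem_filter, Finset.mem_univ, true_and,
      Finset.notMem_empty, not_false_eq_true, not_or]
    tauto
  · rw [Finset.disjoint_left]
    intro e he he'
    simp only [Finset.mem_filter, Finset.mem_univ, true_and,
      Finset.notMem_empty, not_false_eq_true] at he he'
    have := hdisj e he.2
    tauto

/-- Replacing `l` by `h` in the deletion set `K`, where `h` joins two sets `A` and `B` that `K` does
not touch and `A` belongs to a set `T` whose boundary contains `l`. -/
theorem edgeConnectedWithout_exchange (hG : G.directed = false) {lam : ℕ} {K : Finset (Fin G.m)}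
    (hK : G.EdgeConnectedWithout lam K) {l h : Fin G.m} (hl : l ∈ K) (hh : h ∉ K)
    {A B T : Set (Fin G.n)} (hAT : A ⊆ T) (hBT : ∀ x ∈ B, x ∉ T)
    (hcA : G.cut ∅ A = lam + 1) (hcB : G.cut ∅ B = lam + 1) (hcT : G.cut ∅ T = lam + 1)
    (hTB : 2 * G.between ∅ T B = lam + 1) (hTB' : G.between ∅ (T \ A) B = 0)
    (hhAB : (G.tail h ∈ A ∧ G.head h ∈ B) ∨ (G.tail h ∈ B ∧ G.head h ∈ A))
    (hdel : ∀ S, G.Crosses S h → lam + 1 ≤ G.cut ∅ S) (hlT : G.Crosses T l)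
    (hKA : ∀ e ∈ K, G.tail e ∉ A ∧ G.head e ∉ A) (hKB : ∀ e ∈ K, G.tail e ∉ B ∧ G.head e ∉ B) :
    G.EdgeConnectedWithout lam (insert h (K.erase l)) := by
  classical
  have hconn := edgeConnectedWithout_iff.mp hK
  rw [edgeConnectedWithout_iff]
  intro S u v hu hv
  by_contra hlt
  have hT1 : G.cut K T ≤ lam := by
    have h1 := cut_union_eq (F := ∅) (D := K) (by simp) T
    have h2 : 0 < (K.filter fun e => G.Crosses T e).card :=
      Finset.card_pos.mpr ⟨l, Finset.mem_filter.mpr ⟨hl, hlT⟩⟩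
    rw [Finset.empty_union] at h1
    omega
  -- A cut violated after the exchange was fine for `K`: it must lose `h` and must not regain `l`,
  -- and it has at most `lam` edges in `G - K`.
  have hS : G.Crosses S h ∧ ¬ G.Crosses S l ∧ G.cut K S ≤ lam := by
    have h0 := hconn S u v hu hv
    have h1 := cut_union_eq (F := K.erase l) (D := {l}) (by simp) S
    have h2 := cut_union_eq (F := K.erase l) (D := {h}) (by simp [hh]) S
    rw [show K.erase l ∪ {l} = K by ext x; by_cases hx : x = l <;> simp [hx, hl],
      Finset.filter_singleton] at h1
    rw [show K.erase l ∪ {h} = insert h (K.erase l) by ext; simp,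
      Finset.filter_singleton] at h2
    by_cases c1 : G.Crosses S h
    · rw [if_pos c1] at h2
      by_cases c2 : G.Crosses S l
      · rw [if_pos c2] at h1
        simp only [Finset.card_singleton] at h1 h2
        omega
      · rw [if_neg c2] at h1
        simp only [Finset.card_singleton, Finset.card_empty] at h1 h2
        exact ⟨c1, c2, by omega⟩
    · rw [if_neg c1] at h2
      simp only [Finset.card_empty] at h2
      omega
  obtain ⟨hSh, hSl, hSc⟩ := hS
  obtain ⟨p, q, hpA, hqB, hpq⟩ : ∃ p q, p ∈ A ∧ q ∈ B ∧
      ∀ S, G.Crosses S h ↔ ¬ (p ∈ S ↔ q ∈ S) := by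
    rcases hhAB with ⟨h1, h2⟩ | ⟨h1, h2⟩
    · exact ⟨_, _, h1, h2, fun S => crosses_iff_of_undirected hG⟩
    · exact ⟨_, _, h2, h1, fun S => by rw [crosses_iff_of_undirected hG]; tauto⟩
  clear hlt hu hv
  wlog hpS : p ∈ S generalizing S
  · exact this Sᶜ (by rwa [crosses_compl hG]) (by rwa [crosses_compl hG]) (by rwa [cut_compl hG]) hpS
  have hqS : q ∉ S := by
    have := (hpq S).mp hSh
    tauto
  have hpB : p ∉ B := fun h => hBT p h (hAT hpA)
  have hqA : q ∉ A := fun h => hBT q hqB (hAT h)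
  have cK : ∀ S : Set (Fin G.n), (S ⊆ A ∨ S ⊆ B) → G.cut K S = G.cut ∅ S := by
    rintro S (hS | hS)
    · exact cut_eq_of_untouched fun e he =>
        ⟨fun h => (hKA e he).1 (hS h), fun h => (hKA e he).2 (hS h)⟩
    · exact cut_eq_of_untouched fun e he =>
        ⟨fun h => (hKB e he).1 (hS h), fun h => (hKB e he).2 (hS h)⟩
  -- As `K` does not touch `A`, the part `S ∩ A`, crossed by `h`, still has `lam + 1` edges.
  -- Uncrossing allows `A` to be added to `S`; in the same way `B` can be removed.
  have s1 : G.cut K (S ∪ A) ≤ lam := by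
    have h1 := cut_submod K S A
    have h2 := hdel (S ∩ A) ((hpq _).mpr (by simp [hpS, hpA, hqS]))
    rw [← cK (S ∩ A) (Or.inl Set.inter_subset_right)] at h2
    have h3 := cK A (Or.inl subset_rfl)
    omega
  have s2 : G.cut K ((S ∪ A) \ B) ≤ lam := by
    have h1 := cut_add_cut_eq_sdiff hG K (S ∪ A) B
    have h2 := hdel (B \ (S ∪ A)) ((hpq _).mpr (by simp [hqS, hqB, hpB, hqA]))
    rw [← cK (B \ (S ∪ A)) (Or.inr Set.sdiff_subset)] at h2
    have h3 := cK B (Or.inr subset_rfl)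
    omega
  have hS2l : ¬ G.Crosses ((S ∪ A) \ B) l := by
    rw [crosses_iff_of_undirected hG] at hSl ⊢
    simpa [(hKA l hl).1, (hKA l hl).2, (hKB l hl).1, (hKB l hl).2] using hSl
  have hA2 : A ⊆ (S ∪ A) \ B := fun x hx => ⟨Or.inr hx, fun h => hBT x h (hAT hx)⟩
  have hB2 : ∀ x ∈ B, x ∉ (S ∪ A) \ B := fun x hx h => h.2 hx
  generalize (S ∪ A) \ B = S' at s2 hS2l hA2 hB2
  have hT0 : lam ≤ G.cut K T := hconn T p q (hAT hpA) (hBT q hqB)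
  obtain ⟨x, y, hxT, hyT, hxy⟩ : ∃ x y, x ∉ T ∧ y ∈ T ∧ (x ∈ S' ↔ y ∈ S') := by
    rw [crosses_iff_of_undirected hG, not_not] at hS2l
    rcases hlT with ⟨h1, h2⟩ | ⟨-, h1, h2⟩
    · exact ⟨_, _, h2, h1, hS2l.symm⟩
    · exact ⟨_, _, h1, h2, hS2l⟩
  have hsub := cut_submod K S' T
  -- Both ends of `l` are on the same side of `S'`. If inside, uncrossing forces at least `lam / 2`
  -- edges from `T` to `S' \ T` in `G - K`. Together with `l` and the `(lam + 1) / 2` edges from `T`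
  -- to `B`, these exceed the `lam + 1` edges of `T`.
  by_cases hx : x ∈ S'
  · have h1 := hconn (S' ∩ T) p q ⟨hA2 hpA, hAT hpA⟩ fun h => hBT q hqB h.2
    have h2 := hconn (S' \ T) x p ⟨hx, hxT⟩ fun h => h.2 (hAT hpA)
    have h3 := cut_add_cut_eq hG K T (S' \ T)
    rw [show T ∩ (S' \ T) = ∅ by ext; simp +contextual, Ladder.cut_empty,
      show T ∪ S' \ T = S' ∪ T by ext; simp; tauto,
      show T \ (S' \ T) = T by ext; simp +contextual,
      show (S' \ T) \ T = S' \ T by ext; simp +contextual] at h3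
    have h4 := between_add_between_lt_cut hG (A' := T) (C := S' \ T) hl hlT (hKB l hl) hBT
      (fun x hx => hx.2) subset_rfl (by
        rintro e (⟨h1, h2⟩ | ⟨h1, h2⟩)
        · exact ⟨fun h => hBT _ h h1, fun h => hB2 _ h h2.1⟩
        · exact ⟨fun h => hB2 _ h h1.1, fun h => hBT _ h h2⟩)
    omega
  -- If the ends are outside, at least `lam / 2` edges go from `T \ S'` out of `T`. None of them
  -- ends in `B`, since `T \ A` sends no edges to `B`; the same count is exceeded.
  · have hy : y ∉ S' := fun h => hx (hxy.mpr h)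
    have h1 := hconn (S' ∪ T) p q (Or.inl (hA2 hpA)) fun h => h.elim (hB2 q hqB) (hBT q hqB)
    have h2 := hconn (T \ S') y p ⟨hyT, hy⟩ fun h => h.2 (hA2 hpA)
    have h3 := cut_add_cut_eq_sdiff hG K T (T \ S')
    rw [show T \ (T \ S') = S' ∩ T by ext; simp +contextual; tauto,
      show (T \ S') \ T = ∅ by ext; simp +contextual, Ladder.cut_empty,
      show T ∩ (T \ S') = T \ S' by ext; simp +contextual,
      show T ∪ T \ S' = T by ext; simp +contextual] at h3
    have h5 : ∀ e, ¬ ((G.tail e ∈ T \ A ∧ G.head e ∈ B) ∨ (G.tail e ∈ B ∧ G.head e ∈ T \ A)) := by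
      intro e he
      have : e ∈ (∅ : Finset (Fin G.m)) := by
        rw [← Finset.card_eq_zero.mp hTB']
        simpa using he
      simp at this
    have h4 := between_add_between_lt_cut hG (A' := T \ S') (C := Tᶜ) hl hlT (hKB l hl) hBT
      (fun x hx => hx) Set.sdiff_subset (by
        rintro e (⟨h1, h2⟩ | ⟨h1, h2⟩)
        · exact ⟨fun h => hBT _ h h1.1,
            fun h => h5 e (Or.inl ⟨⟨h1.1, fun h' => h1.2 (hA2 h')⟩, h⟩)⟩
        · exact ⟨fun h => h5 e (Or.inr ⟨h, ⟨h2.1, fun h' => h2.2 (hA2 h')⟩⟩),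
            fun h => hBT _ h h2.1⟩)
    omega

theorem exists_strictMono_enumeration {α : Type*} (W : Finset α) (pos : α → ℕ)
    (hpos : Set.InjOn pos W) {w : ℕ} (hw : W.card = w) : ∃ y : Fin w → α, (∀ s, y s ∈ W) ∧ StrictMono (pos ∘ y) := by
  classical
  have hc : (W.image pos).card = w := (Finset.card_image_of_injOn hpos).trans hw
  have hmem : ∀ s, ∃ x ∈ W, pos x = (W.image pos).orderEmbOfFin hc s := fun s => by
    exact Finset.mem_image.mp ((W.image pos).orderEmbOfFin_mem hc s)
  choose y hy hy' using hmem
  refine ⟨y, hy, fun s t hst => ?_⟩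
  simp only [Function.comp, hy']
  exact ((W.image pos).orderEmbOfFin hc).strictMono hst

/-- If `l` belongs to a deletion set `K` of size `k` and a rung from `l` to `t`, untouched by `F`,
has at least `2 * k` intermediate edges, then one of these can replace `l`. -/
theorem Ladder.exists_exchange {lam k : ℕ} {F : Finset (Fin G.m)} (L : G.Ladder lam F)
    (hG : G.directed = false)
    (hdel : ∀ z ∈ L.Z, ∀ S, G.Crosses S z → lam + 1 ≤ G.cut ∅ S) {l t : Fin G.m} (hl : l ∈ L.Z)
    (ht : t ∈ L.Z) {Y : Set (Fin G.n)} (hY : L.IsRung l t Y)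
    (hF : ∀ e ∈ F, G.tail e ∉ L.X t \ L.X l ∧ G.head e ∉ L.X t \ L.X l)
    {W : Finset (Fin G.m)} (hWZ : W ⊆ L.Z) (hW : ∀ h ∈ W, L.pos l < L.pos h ∧ L.pos h < L.pos t)
    (hcard : 2 * k ≤ W.card) {K : Finset (Fin G.m)} (hKk : K.card = k)
    (hK : G.EdgeConnectedWithout lam K) (hlK : l ∈ K) :
    ∃ h ∈ W, h ∉ K ∧ G.EdgeConnectedWithout lam (insert h (K.erase l)) := by
  classical
  obtain ⟨w, hw⟩ : ∃ w, W.card = w := ⟨_, rfl⟩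
  obtain ⟨y, hyW, hymono⟩ := exists_strictMono_enumeration W L.pos
    (L.injOn.mono (Finset.coe_subset.mpr hWZ)) hw
  have : Nonempty (Fin G.m) := ⟨l⟩
  have hk : 0 < k := hKk ▸ Finset.card_pos.mpr ⟨l, hlK⟩
  have hconn := edgeConnectedWithout_iff.mp hK
  -- the edges in order, followed by `t`
  set z : ℕ → Fin G.m := fun s => if h : s < w then y ⟨s, h⟩ else t with hz
  have hzlt : ∀ s, s < w → z s ∈ W := fun s hs => by simp only [hz, dif_pos hs]; exact hyW _
  have hzt : z w = t := by simp [hz]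
  have hzZ : ∀ s, s ≤ w → z s ∈ L.Z := fun s hs => by
    rcases hs.lt_or_eq with h | h
    · exact hWZ (hzlt s h)
    · rw [h, hzt]; exact ht
  have hzmono : ∀ s s', s < s' → s' ≤ w → L.pos (z s) < L.pos (z s') := fun s s' hss hs' => by
    rcases hs'.lt_or_eq with h | h
    · simp only [hz, dif_pos h, dif_pos (hss.trans h)]
      exact hymono (Fin.mk_lt_mk.mpr hss)
    · rw [h, hzt]
      exact (hW _ (hzlt s (by omega))).2
  have hlz : ∀ s, s ≤ w → L.pos l < L.pos (z s) := fun s hs => by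
    rcases hs.lt_or_eq with h | h
    · exact (hW _ (hzlt s h)).1
    · rw [h, hzt]
      have h0 := hW _ (hzlt 0 (by omega))
      omega
  have hT : ∀ s, s ≤ w → L.IsRung l (z s) (Y ∩ L.X (z s)) := fun s hs => by
    rcases hs.lt_or_eq with h | h
    · exact (hY.split hG hl (hzZ s hs) ht (hlz s hs) (hW _ (hzlt s h)).2).1
    · rw [h, hzt, Set.inter_eq_left.mpr hY.subset]
      exact hY
  have hsub : ∀ s s', s < s' → s' ≤ w → Y ∩ L.X (z s) ⊆ Y ∩ L.X (z s') := fun s s' hss hs' =>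
    Set.inter_subset_inter_right _
      (L.mono _ (hzZ s (by omega)) _ (hzZ s' hs') (hzmono s s' hss hs'))
  have hinter : ∀ s s', s < s' → s' ≤ w → Y ∩ L.X (z s') ∩ L.X (z s) = Y ∩ L.X (z s) := by
    intro s s' hss hs'
    ext x
    have := L.mono _ (hzZ s (by omega)) _ (hzZ s' hs') (hzmono s s' hss hs') (a := x)
    simp only [Set.mem_inter_iff]
    tauto
  have hsplit := fun s s' (hss : s < s') (hs' : s' ≤ w) =>
    (hT s' hs').split hG hl (hzZ s (by omega)) (hzZ s' hs') (hlz s (by omega)) (hzmono s s' hss hs')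
  have huntY : ∀ S : Set (Fin G.n), S ⊆ Y → ∀ e ∈ F, G.tail e ∉ S ∧ G.head e ∉ S := by
    intro S hS e he
    have hin : ∀ x ∈ S, x ∈ L.X t \ L.X l := fun x hx =>
      ⟨hY.subset (hS hx), fun h => hY.notMem x h (hS hx)⟩
    exact ⟨fun h => (hF e he).1 (hin _ h), fun h => (hF e he).2 (hin _ h)⟩
  have hcutT : ∀ s, s ≤ w → G.cut ∅ (Y ∩ L.X (z s)) = lam + 1 := fun s hs => by
    rw [← (hT s hs).cut_eq, cut_eq_of_untouched (huntY _ Set.inter_subset_left)]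
  -- `l` is the only edge of `K` in these cuts
  have hKT : ∀ s, s ≤ w → ∀ e ∈ K, G.Crosses (Y ∩ L.X (z s)) e → e = l := by
    intro s hs e he hcr
    by_contra hne
    have hcl := (hT s hs).crosses_left hG hl
    obtain ⟨p, q, hp, hq⟩ := crosses_exists hcl
    have h1 := hconn _ p q hp hq
    have h2 := cut_union_eq (F := ∅) (D := K) (by simp) (Y ∩ L.X (z s))
    have h3 : ({e, l} : Finset (Fin G.m)).card ≤
        (K.filter fun e => G.Crosses (Y ∩ L.X (z s)) e).card := by
      refine Finset.card_le_card fun x hx => Finset.mem_filter.mpr ?_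
      simp only [Finset.mem_insert, Finset.mem_singleton] at hx
      rcases hx with rfl | rfl
      · exact ⟨he, hcr⟩
      · exact ⟨hlK, hcl⟩
    rw [Finset.card_pair hne] at h3
    rw [Finset.empty_union, hcutT s hs] at h2
    omega
  have hKT' : ∀ s, s ≤ w → ∀ e ∈ K, e ≠ l →
      (G.tail e ∈ Y ∩ L.X (z s) ↔ G.head e ∈ Y ∩ L.X (z s)) := by
    intro s hs e he hne
    by_contra h
    exact hne (hKT s hs e he ((crosses_iff_of_undirected hG).mpr h))
  -- the parts touched by the other edges of `K`
  set P : ℕ → Set (Fin G.n) := fun s => (Y ∩ L.X (z (s + 1))) \ L.X (z s) with hP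
  have hPT : ∀ s x, x ∈ P s → x ∉ Y ∩ L.X (z s) := fun s x hx h => hx.2 h.2
  set Q := (Finset.range w).filter fun s =>
    ∃ e ∈ K.erase l, G.tail e ∈ P s ∨ G.head e ∈ P s with hQ
  have hends : ∀ s, s < w → ∀ e ∈ K.erase l, (G.tail e ∈ P s ∨ G.head e ∈ P s) →
      G.tail e ∈ Y ∩ L.X (z (s + 1)) ∧ G.tail e ∉ Y ∩ L.X (z s) := by
    intro s hs e he hor
    have h1 := hKT' (s + 1) hs e (Finset.mem_of_mem_erase he) (Finset.ne_of_mem_erase he)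
    have h2 := hKT' s hs.le e (Finset.mem_of_mem_erase he) (Finset.ne_of_mem_erase he)
    rcases hor with h | h
    · exact ⟨h.1, hPT s _ h⟩
    · exact ⟨h1.mpr h.1, fun h' => hPT s _ h (h2.mp h')⟩
  -- An edge of `K` other than `l` crosses none of the nested sets, so both its ends lie in the same
  -- part. Choosing an edge for each touched part is injective.
  have hQcard : Q.card ≤ k - 1 := by
    have hch : ∀ s ∈ Q, ∃ e ∈ K.erase l, G.tail e ∈ P s ∨ G.head e ∈ P s := fun s hs =>
      (Finset.mem_filter.mp hs).2
    choose! g hg hg' using hch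
    rw [← hKk, ← Finset.card_erase_of_mem hlK]
    have haux : ∀ s ∈ Q, ∀ s' ∈ Q, g s = g s' → ¬ s < s' := by
      intro s hs s' hs' hgs hlt
      have hsw := Finset.mem_range.mp (Finset.mem_filter.mp hs).1
      have hsw' := Finset.mem_range.mp (Finset.mem_filter.mp hs').1
      have h1 := (hends s hsw _ (hg s hs) (hg' s hs)).1
      have h2 := (hends s' hsw' _ (hg s' hs') (hg' s' hs')).2
      rw [← hgs] at h2
      rcases (Nat.succ_le_of_lt hlt).eq_or_lt with h | h
      · rw [← h] at h2
        exact h2 h1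
      · exact h2 (hsub (s + 1) s' h hsw'.le h1)
    refine Finset.card_le_card_of_injOn g hg fun s hs s' hs' hgs => ?_
    have h1 := haux s hs s' hs' hgs
    have h2 := haux s' hs' s hs hgs.symm
    omega
  -- Each touched part spoils at most two of the `w - 1 ≥ 2 * k - 1` pairs of consecutive parts, and
  -- there are at most `k - 1` touched parts.
  obtain ⟨s, hsw, hsQ, hsQ'⟩ : ∃ s, s + 1 < w ∧ s ∉ Q ∧ s + 1 ∉ Q := by
    by_contra hcon
    push Not at hcon
    have : Finset.range (w - 1) ⊆ Q ∪ Q.image (fun s => s - 1) := by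
      intro s hs
      have hs' : s + 1 < w := by
        have := Finset.mem_range.mp hs
        omega
      by_cases h : s ∈ Q
      · exact Finset.mem_union_left _ h
      · exact Finset.mem_union_right _ (Finset.mem_image.mpr ⟨s + 1, hcon s hs' h, rfl⟩)
    have h1 := (Finset.card_le_card this).trans (Finset.card_union_le _ _)
    have h2 := Finset.card_image_le (s := Q) (f := fun s => s - 1)
    rw [Finset.card_range] at h1
    omega
  have hlP : ∀ s, s < w → G.tail l ∉ P s ∧ G.head l ∉ P s := by
    intro s hs
    have h1 := L.v_mem l hl _ (hzZ s hs.le) (hlz s hs.le)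
    have h2 := L.u_mem_of_le hl (hzZ s hs.le) (hlz s hs.le).le
    -- A ladder knows the ends of `l` only through the sets that `l` crosses; testing the singleton
    -- of `L.u l` identifies this vertex with the tail or the head.
    have key : ∀ S : Set (Fin G.n), L.u l ∉ S → L.v l ∉ S → G.tail l ∉ S ∧ G.head l ∉ S := by
      intro S hu hv
      have c1 := L.crosses_iff l hl S
      have c2 := L.crosses_iff l hl (S ∪ {L.u l})
      have c3 := L.crosses_iff l hl {L.u l}
      have huv : L.u l ≠ L.v l := fun h => L.v_notMem l hl (h ▸ L.u_mem l hl)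
      have huv' : L.v l ≠ L.u l := huv.symm
      simp only [hu, hv, false_and, and_false, or_false, iff_false,
        crosses_iff_of_undirected hG, not_not] at c1
      simp only [Set.mem_singleton_iff, huv', not_true, not_false_eq_true, true_and, and_false,
        or_false, iff_true, crosses_iff_of_undirected hG] at c3
      by_cases ht : G.tail l = L.u l
      · rw [ht] at c1 ⊢
        exact ⟨hu, fun h => hu (c1.mpr h)⟩
      · have hh : G.head l = L.u l := by tauto
        rw [hh] at c1 ⊢
        exact ⟨fun h => hu (c1.mp h), hu⟩
    exact key _ (fun h => h.2 h2) (fun h => h.2 h1)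
  have hKP : ∀ s, s < w → s ∉ Q → ∀ e ∈ K, G.tail e ∉ P s ∧ G.head e ∉ P s := by
    intro s hs hsQ e he
    by_cases hel : e = l
    · rw [hel]; exact hlP s hs
    · rw [← not_or]
      exact fun h => hsQ (Finset.mem_filter.mpr
        ⟨Finset.mem_range.mpr hs, e, Finset.mem_erase.mpr ⟨hel, he⟩, h⟩)
  have hZh := hzZ (s + 1) hsw.le
  have hne : z (s + 1) ≠ l := fun h => by
    have := hlz (s + 1) hsw.le
    rw [h] at this
    exact lt_irrefl _ this
  have hsp := hsplit s (s + 1) (by omega) hsw.le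
  have hsp' := hsplit (s + 1) (s + 2) (by omega) (by omega)
  have hrA : L.IsRung (z s) (z (s + 1)) (P s) := hsp.2.1
  have hrB : L.IsRung (z (s + 1)) (z (s + 2)) (P (s + 1)) := hsp'.2.1
  have hBT : ∀ x ∈ P (s + 1), x ∉ Y ∩ L.X (z (s + 1)) := fun x hx => hPT _ x hx
  have hPY : ∀ s, P s ⊆ Y := fun s x hx => hx.1.1
  have hhK : z (s + 1) ∉ K := fun h =>
    hne (hKT (s + 1) hsw.le _ h ((hT (s + 1) hsw.le).crosses_right hZh))
  -- The new edge joins the two untouched parts `A` and `B`; `T` is the whole piece of the rung up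
  -- to this edge. The required counts come from splitting at `z s` and at `z (s + 1)`.
  refine ⟨z (s + 1), hzlt _ hsw, hhK, edgeConnectedWithout_exchange hG hK hlK hhK
    (A := P s) (B := P (s + 1)) (T := Y ∩ L.X (z (s + 1))) Set.sdiff_subset hBT ?_ ?_
    (hcutT _ hsw.le) ?_ ?_ ?_ (hdel _ hZh) ((hT (s + 1) hsw.le).crosses_left hG hl)
    (hKP s (by omega) hsQ) (hKP (s + 1) hsw hsQ')⟩
  · rw [← cut_eq_of_untouched (huntY _ (hPY s)), hrA.cut_eq]
  · rw [← cut_eq_of_untouched (huntY _ (hPY _)), hrB.cut_eq]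
  · have := hsp'.2.2.1
    rwa [hinter (s + 1) (s + 2) (by omega) (by omega),
      between_eq_of_untouched (huntY _ Set.inter_subset_left)] at this
  · have := hsp.2.2.2
    rw [hinter s (s + 1) (by omega) (by omega),
      between_eq_of_untouched (huntY _ Set.inter_subset_left)] at this
    have hle := between_mono_right (F := ∅) (Y ∩ L.X (z s))
      (B := P (s + 1)) (B' := (Y ∩ L.X (z (s + 1)) ∪ L.X (z s))ᶜ) (fun x hx h => by
        rcases h with h | h
        · exact hx.2 h.2
        · exact hx.2 (L.mono _ (hzZ s (by omega)) _ hZh (hzmono s (s + 1) (by omega) hsw.le) h))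
    rw [show (Y ∩ L.X (z (s + 1))) \ P s = Y ∩ L.X (z s) by
      rw [← hinter s (s + 1) (by omega) hsw.le]
      ext x
      simp only [hP, Set.mem_sdiff, Set.mem_inter_iff]
      tauto]
    omega
  · have hcA := hrA.crosses_right hZh
    have hu1 := hrA.u_mem
    have hv1 := hrB.v_mem
    rw [crosses_iff_of_undirected hG] at hcA
    have hcU : ¬ G.Crosses (P s ∪ P (s + 1)) (z (s + 1)) := by
      rw [L.crosses_iff _ hZh]
      simp [hu1, hv1]
    rw [crosses_iff_of_undirected hG] at hcU
    simp only [Set.mem_union] at hcU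
    by_cases p1 : G.tail (z (s + 1)) ∈ P s <;> by_cases p2 : G.head (z (s + 1)) ∈ P s
    · exact absurd (iff_of_true p1 p2) hcA
    · exact Or.inl ⟨p1, by simpa [p1, p2] using hcU⟩
    · exact Or.inr ⟨by simpa [p1, p2] using hcU, p2⟩
    · exact absurd (iff_of_false p1 p2) hcA

end MGraph

/-! ### The number of edges of a ladder -/

namespace MGraph

namespace Ladder

variable {G : MGraph} {lam : ℕ} {F : Finset (Fin G.m)} (L : G.Ladder lam F)

theorem edgeConnectedWithout_of_directed (hG : G.directed = true)
    (hF : G.EdgeConnectedWithout lam F) {D : Finset (Fin G.m)} (hD : D ⊆ L.Z) :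
    G.EdgeConnectedWithout lam (F ∪ D) := by
  classical
  rw [edgeConnectedWithout_iff] at hF ⊢
  intro S u v hu hv
  have h1 := cut_le_cut_union F D S
  rcases (D.filter fun e => G.Crosses S e).eq_empty_or_nonempty with h | h
  · have := hF S u v hu hv
    rw [h, Finset.card_empty] at h1
    omega
  · have := L.card_le_cut_of_directed hG h (Y := S) fun e he =>
      ⟨hD (Finset.mem_filter.mp he).1, (Finset.mem_filter.mp he).2⟩
    omega

theorem IsRung.not_edgeConnectedWithout {L : G.Ladder lam F} (hG : G.directed = false)
    (hZF : ∀ e ∈ L.Z, e ∉ F) {i j : Fin G.m}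
    (hi : i ∈ L.Z) (hj : j ∈ L.Z) (hij : L.pos i < L.pos j) {Y : Set (Fin G.n)}
    (h : L.IsRung i j Y) : ¬ G.EdgeConnectedWithout lam (F ∪ {i, j}) := by
  classical
  intro hc
  have h1 := edgeConnectedWithout_iff.mp hc Y _ _ h.v_mem (h.notMem _ (L.u_mem i hi))
  have h2 := cut_union_eq (F := F) (D := {i, j}) (by simp [hZF i hi, hZF j hj]) Y
  rw [Finset.filter_true_of_mem (by
    intro e he
    simp only [Finset.mem_insert, Finset.mem_singleton] at he
    rcases he with rfl | rfl
    · exact h.crosses_left hG hi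
    · exact h.crosses_right hj), Finset.card_pair (fun h => by simp [h] at hij), h.cut_eq] at h2
  omega

/-- A deficient cut must contain both edges, because `lt_cut` leaves room for the deletion of either
one alone. -/
theorem exists_cut_of_not_edgeConnectedWithout (hF : G.EdgeConnectedWithout lam F)
    {i j : Fin G.m} (hi : i ∈ L.Z) (hj : j ∈ L.Z)
    (h : ¬ G.EdgeConnectedWithout lam (F ∪ {i, j})) :
    ∃ Y, G.Crosses Y i ∧ G.Crosses Y j ∧ G.cut F Y ≤ lam + 1 := by
  classical
  rw [edgeConnectedWithout_iff] at h
  push Not at h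
  obtain ⟨S, u, v, hu, hv, hlt⟩ := h
  have h0 := edgeConnectedWithout_iff.mp hF S u v hu hv
  have h1 := cut_le_cut_union F {i, j} S
  have h2 : (({i, j} : Finset (Fin G.m)).filter fun e => G.Crosses S e).card ≤ 2 :=
    (Finset.card_filter_le _ _).trans Finset.card_le_two
  rw [Finset.filter_insert, Finset.filter_singleton] at h1 h2
  refine ⟨S, ?_, ?_, by omega⟩ <;> by_contra hcr
  · by_cases c2 : G.Crosses S j
    · have := L.lt_cut j hj S c2
      rw [if_neg hcr, if_pos c2, Finset.card_singleton] at h1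
      omega
    · rw [if_neg hcr, if_neg c2, Finset.card_empty] at h1
      omega
  · by_cases c2 : G.Crosses S i
    · have := L.lt_cut i hi S c2
      rw [if_neg hcr, if_pos c2] at h1
      simp only [insert_empty_eq, Finset.card_singleton] at h1
      omega
    · rw [if_neg hcr, if_neg c2, Finset.card_empty] at h1
      omega

theorem exists_isRung_of_not_edgeConnectedWithout (hG : G.directed = false)
    (hF : G.EdgeConnectedWithout lam F) {i j : Fin G.m} (hi : i ∈ L.Z) (hj : j ∈ L.Z)
    (hij : L.pos i < L.pos j) (h : ¬ G.EdgeConnectedWithout lam (F ∪ {i, j})) :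
    ∃ Y, L.IsRung i j Y := by
  obtain ⟨Y, h1, h2, h3⟩ := L.exists_cut_of_not_edgeConnectedWithout hF hi hj h
  exact L.exists_isRung hG hi hj hij h1 h2 h3

theorem edgeConnectedWithout_of_pairs (hG : G.directed = false) (hZF : ∀ e ∈ L.Z, e ∉ F)
    (hF : G.EdgeConnectedWithout lam F) {D : Finset (Fin G.m)} (hD : D ⊆ L.Z)
    (hpair : ∀ x ∈ D, ∀ y ∈ D, x ≠ y → G.EdgeConnectedWithout lam (F ∪ {x, y})) :
    G.EdgeConnectedWithout lam (F ∪ D) := by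
  classical
  rw [edgeConnectedWithout_iff] at hF ⊢
  intro S u v hu hv
  have h1 := cut_le_cut_union F D S
  rcases (D.filter fun e => G.Crosses S e).eq_empty_or_nonempty with h | h
  · have := hF S u v hu hv
    rw [h, Finset.card_empty] at h1
    omega
  · have := L.card_le_cut_of_pairs hG (C := D.filter fun e => G.Crosses S e) (Y := S)
      ((Finset.filter_subset _ _).trans hD) (by
        intro x hx y hy hne Y hYx hYy
        have hx' := (Finset.mem_filter.mp hx).1
        have hy' := (Finset.mem_filter.mp hy).1
        obtain ⟨p, q, hp, hq⟩ := crosses_exists hYx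
        have h2 := edgeConnectedWithout_iff.mp (hpair x hx' y hy' hne) Y p q hp hq
        have h3 := cut_union_eq (F := F) (D := {x, y})
          (by simp [hZF x (hD hx'), hZF y (hD hy')]) Y
        rw [Finset.filter_true_of_mem (by simp [hYx, hYy]), Finset.card_pair hne] at h3
        omega) h fun e he => (Finset.mem_filter.mp he).2
    omega

/-- `D` was selected greedily from the edges of the ladder. -/
structure IsGreedy (D : Finset (Fin G.m)) : Prop where
  subset : D ⊆ L.Z
  conn : G.EdgeConnectedWithout lam (F ∪ D)
  maximal : ∀ e ∈ L.Z, e ∉ D →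
    ¬ G.EdgeConnectedWithout lam (F ∪ (insert e (D.filter fun d => L.pos d < L.pos e)))

variable {L} {D : Finset (Fin G.m)}

theorem IsGreedy.eq_of_directed (hG : G.directed = true) (hF : G.EdgeConnectedWithout lam F)
    (h : L.IsGreedy D) : L.Z = D := by
  refine Finset.Subset.antisymm (fun e he => ?_) h.subset
  by_contra hD
  refine h.maximal e he hD (L.edgeConnectedWithout_of_directed hG hF ?_)
  exact Finset.insert_subset he ((Finset.filter_subset _ _).trans h.subset)

/-- A rejected edge forms a bad pair with an earlier selected edge `d`, since only pairs obstruct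
and selected edges are compatible. Splitting the rung from `d` to `e` yields rungs from all ladder
edges in between. -/
theorem IsGreedy.exists_isRung (hG : G.directed = false) (hZF : ∀ e ∈ L.Z, e ∉ F)
    (hF : G.EdgeConnectedWithout lam F) (h : L.IsGreedy D) {e : Fin G.m} (he : e ∈ L.Z)
    (heD : e ∉ D) : ∃ d ∈ D, L.pos d < L.pos e ∧ ∀ d' ∈ L.Z, L.pos d ≤ L.pos d' →
      L.pos d' < L.pos e → ∃ Y, L.IsRung d' e Y := by
  by_contra hcon
  push Not at hcon
  refine h.maximal e he heD (L.edgeConnectedWithout_of_pairs hG hZF hF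
    (Finset.insert_subset he ((Finset.filter_subset _ _).trans h.subset)) ?_)
  have key : ∀ d ∈ D, L.pos d < L.pos e → G.EdgeConnectedWithout lam (F ∪ {d, e}) := by
    intro d hd hde
    by_contra hc
    obtain ⟨Y, hY⟩ := L.exists_isRung_of_not_edgeConnectedWithout hG hF (h.subset hd) he hde hc
    obtain ⟨d', hd', h1, h2, h3⟩ := hcon d hd hde
    rcases h1.eq_or_lt with h1 | h1
    · rw [L.injOn (h.subset hd) hd' h1] at hY
      exact h3 Y hY
    · exact h3 _ (hY.split hG (h.subset hd) hd' he h1 h2).2.1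
  intro x hx y hy hne
  simp only [Finset.mem_insert, Finset.mem_filter] at hx hy
  rcases hx with rfl | ⟨hx, hxe⟩ <;> rcases hy with rfl | ⟨hy, hye⟩
  · exact absurd rfl hne
  · rw [Finset.pair_comm]
    exact key y hy hye
  · exact key x hx hxe
  · refine h.conn.anti (Finset.union_subset_union_right ?_)
    exact Finset.insert_subset hx (Finset.singleton_subset_iff.mpr hy)

/-! ### Counting the edges of a ladder by rank. -/

/-- The number of selected edges up to `e`. -/
def rankIn (L : G.Ladder lam F) (D : Finset (Fin G.m)) (e : Fin G.m) : ℕ :=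
  (D.filter fun d => L.pos d ≤ L.pos e).card

theorem rankIn_le (D : Finset (Fin G.m)) (e : Fin G.m) : L.rankIn D e ≤ D.card :=
  Finset.card_filter_le _ _

theorem rankIn_mono (D : Finset (Fin G.m)) {e e' : Fin G.m} (h : L.pos e ≤ L.pos e') :
    L.rankIn D e ≤ L.rankIn D e' :=
  Finset.card_le_card (Finset.monotone_filter_right _ fun _ _ h' => h'.trans h)

theorem notMem_of_rankIn_eq {e e' : Fin G.m} (h : L.pos e < L.pos e')
    (hr : L.rankIn D e = L.rankIn D e') {d : Fin G.m} (hd : d ∈ D) (h1 : L.pos e < L.pos d) :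
    L.pos e' < L.pos d := by
  by_contra h2
  refine hr.not_lt (Finset.card_lt_card ?_)
  refine Finset.ssubset_iff_of_subset
    (Finset.monotone_filter_right _ fun _ _ h' => h'.trans h.le) |>.mpr ⟨d, ?_, ?_⟩
  · exact Finset.mem_filter.mpr ⟨hd, not_lt.mp h2⟩
  · exact fun h' => absurd (Finset.mem_filter.mp h').2 (not_le.mpr h1)

theorem IsGreedy.one_le_rankIn (hG : G.directed = false) (hZF : ∀ e ∈ L.Z, e ∉ F)
    (hF : G.EdgeConnectedWithout lam F) (h : L.IsGreedy D) {e : Fin G.m} (he : e ∈ L.Z) :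
    1 ≤ L.rankIn D e := by
  refine Finset.card_pos.mpr ?_
  by_cases heD : e ∈ D
  · exact ⟨e, Finset.mem_filter.mpr ⟨heD, le_rfl⟩⟩
  · obtain ⟨d, hd, hlt, -⟩ := h.exists_isRung hG hZF hF he heD
    exact ⟨d, Finset.mem_filter.mpr ⟨hd, hlt.le⟩⟩

/-- Equal ranks mean that no selected edge lies after `e` up to and including `e'`. So `e'` was
rejected, and the selected edge responsible for this does not come after `e`. -/
theorem IsGreedy.isRung_of_rankIn_eq (hG : G.directed = false) (hZF : ∀ e ∈ L.Z, e ∉ F)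
    (hF : G.EdgeConnectedWithout lam F) (h : L.IsGreedy D) {e e' : Fin G.m} (he : e ∈ L.Z)
    (he' : e' ∈ L.Z) (hlt : L.pos e < L.pos e') (hr : L.rankIn D e = L.rankIn D e') :
    ∃ Y, L.IsRung e e' Y := by
  have heD : e' ∉ D := fun hD => lt_irrefl _ (notMem_of_rankIn_eq hlt hr hD hlt)
  obtain ⟨d, hd, hde, hall⟩ := h.exists_isRung hG hZF hF he' heD
  refine hall e he ?_ hlt
  by_contra hcon
  exact lt_asymm hde (notMem_of_rankIn_eq hlt hr hd (not_le.mp hcon))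

/-- The first and the last edge of `W` enclose all the others. -/
theorem exists_three_of_card {W : Finset (Fin G.m)} (hW : W ⊆ L.Z) {q : ℕ} (hq : q + 2 ≤ W.card) :
    ∃ l ∈ W, ∃ t ∈ W, L.pos l < L.pos t ∧
      q ≤ (W.filter fun e => L.pos l < L.pos e ∧ L.pos e < L.pos t).card := by
  classical
  have hne : W.Nonempty := Finset.card_pos.mp (by omega)
  obtain ⟨l, hl, hlmin⟩ := W.exists_min_image L.pos hne
  obtain ⟨t, ht, htmax⟩ := W.exists_max_image L.pos hne
  have hsub : (W.erase l).erase t ⊆ W.filter fun e => L.pos l < L.pos e ∧ L.pos e < L.pos t := by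
    intro e he
    simp only [Finset.mem_erase] at he
    obtain ⟨het, hel, heW⟩ := he
    refine Finset.mem_filter.mpr ⟨heW, ?_, ?_⟩
    · exact lt_of_le_of_ne (hlmin e heW) fun h => hel (L.injOn (hW heW) (hW hl) h.symm)
    · exact lt_of_le_of_ne (htmax e heW) fun h => het (L.injOn (hW heW) (hW ht) h)
  have h1 := Finset.card_le_card hsub
  have h2 := Finset.pred_card_le_card_erase (s := W) (a := l)
  have h3 := Finset.pred_card_le_card_erase (s := W.erase l) (a := t)
  refine ⟨l, hl, t, ht, lt_of_le_of_ne (hlmin t ht) fun h => ?_, by omega⟩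
  have : W.card ≤ 1 := Finset.card_le_one.mpr fun x hx y hy => by
    have a1 := hlmin x hx
    have a2 := htmax x hx
    have a3 := hlmin y hy
    have a4 := htmax y hy
    exact L.injOn (hW hx) (hW hy) (by omega)
  omega

/-- Three edges of equal rank would give a rung with an intermediate edge, and splitting it makes
`lam + 1` even. So each of the ranks `1, …, D.card` occurs at most twice. -/
theorem IsGreedy.card_le_of_even (hG : G.directed = false) (hlam : Even lam)
    (hZF : ∀ e ∈ L.Z, e ∉ F) (hF : G.EdgeConnectedWithout lam F) (h : L.IsGreedy D) :
    L.Z.card ≤ 2 * D.card := by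
  classical
  have hcl := Finset.card_le_mul_card_image (f := L.rankIn D) L.Z 2 (by
    intro c _
    by_contra hcon
    obtain ⟨l, hl, t, ht, hlt, hmid⟩ := exists_three_of_card (L := L)
      (Finset.filter_subset (fun x => L.rankIn D x = c) _) (q := 1) (by omega)
    obtain ⟨e, he⟩ := Finset.card_pos.mp hmid
    simp only [Finset.mem_filter] at he hl ht
    obtain ⟨Y, hY⟩ := h.isRung_of_rankIn_eq hG hZF hF hl.1 ht.1 hlt (hl.2.trans ht.2.symm)
    have := (hY.split hG hl.1 he.1.1 ht.1 he.2.1 he.2.2).2.2.1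
    obtain ⟨r, hr⟩ := hlam
    omega)
  have him : (L.Z.image (L.rankIn D)).card ≤ D.card := by
    refine (Finset.card_le_card (t := Finset.Icc 1 D.card) fun c hc => ?_).trans (by simp)
    obtain ⟨e, he, rfl⟩ := Finset.mem_image.mp hc
    exact Finset.mem_Icc.mpr ⟨h.one_le_rankIn hG hZF hF he, rankIn_le D e⟩
  exact hcl.trans (Nat.mul_le_mul_left 2 him)

open Classical in
/-- The number of ends of edges of `F` in `X e`. -/
noncomputable def endsIn (L : G.Ladder lam F) (e : Fin G.m) : ℕ :=
  (F.filter fun g => G.tail g ∈ L.X e).card + (F.filter fun g => G.head g ∈ L.X e).card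

theorem endsIn_le (e : Fin G.m) : L.endsIn e ≤ 2 * F.card := by
  classical
  have h1 := Finset.card_filter_le F fun g => G.tail g ∈ L.X e
  have h2 := Finset.card_filter_le F fun g => G.head g ∈ L.X e
  unfold endsIn
  omega

open Classical in
theorem endsIn_mono {e e' : Fin G.m} (he : e ∈ L.Z) (he' : e' ∈ L.Z) (h : L.pos e < L.pos e') :
    (F.filter fun g => G.tail g ∈ L.X e) ⊆ (F.filter fun g => G.tail g ∈ L.X e') ∧
    (F.filter fun g => G.head g ∈ L.X e) ⊆ (F.filter fun g => G.head g ∈ L.X e') :=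
  ⟨Finset.monotone_filter_right _ fun _ _ h' => L.mono e he e' he' h h',
    Finset.monotone_filter_right _ fun _ _ h' => L.mono e he e' he' h h'⟩

/-- The sets of ends grow along the ladder, so equal counts mean that no end is added. -/
theorem untouched_of_endsIn_eq {e e' : Fin G.m} (he : e ∈ L.Z) (he' : e' ∈ L.Z)
    (h : L.pos e < L.pos e') (heq : L.endsIn e' ≤ L.endsIn e) :
    ∀ g ∈ F, G.tail g ∉ L.X e' \ L.X e ∧ G.head g ∉ L.X e' \ L.X e := by
  classical
  obtain ⟨s1, s2⟩ := endsIn_mono he he' h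
  have c1 := Finset.card_le_card s1
  have c2 := Finset.card_le_card s2
  unfold endsIn at heq
  have e1 := Finset.eq_of_subset_of_card_le s1 (by omega)
  have e2 := Finset.eq_of_subset_of_card_le s2 (by omega)
  intro g hg
  constructor
  · rintro ⟨h1, h2⟩
    have : g ∈ F.filter fun g => G.tail g ∈ L.X e := e1 ▸ Finset.mem_filter.mpr ⟨hg, h1⟩
    exact h2 (Finset.mem_filter.mp this).2
  · rintro ⟨h1, h2⟩
    have : g ∈ F.filter fun g => G.head g ∈ L.X e := e2 ▸ Finset.mem_filter.mpr ⟨hg, h1⟩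
    exact h2 (Finset.mem_filter.mp this).2

/-- If no window of the ladder can be used to discard an edge, the ladder is short. -/
theorem IsGreedy.card_le_of_no_window (hG : G.directed = false) (hZF : ∀ e ∈ L.Z, e ∉ F)
    (hF : G.EdgeConnectedWithout lam F) (h : L.IsGreedy D) {k : ℕ} {W : Finset (Fin G.m)}
    (hW : W ⊆ L.Z)
    (hwin : ∀ l ∈ W, ∀ t ∈ W, L.pos l < L.pos t →
      2 * k ≤ (W.filter fun e => L.pos l < L.pos e ∧ L.pos e < L.pos t).card →
      G.EdgeConnectedWithout lam (F ∪ {l, t}) ∨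
        ¬ ∀ g ∈ F, G.tail g ∉ L.X t \ L.X l ∧ G.head g ∉ L.X t \ L.X l) :
    W.card ≤ (2 * k + 1) * (D.card + 2 * F.card) := by
  classical
  -- Rank and number of ends both increase weakly along the ladder, so equal sums make both equal.
  -- Among `2 * k + 2` edges with the same sum, the first and last would form a forbidden window.
  have hcl := Finset.card_le_mul_card_image (f := fun e => L.rankIn D e + L.endsIn e) W (2 * k + 1)
    (by
      intro c _
      by_contra hcon
      obtain ⟨l, hl, t, ht, hlt, hmid⟩ := exists_three_of_card (L := L)
        ((Finset.filter_subset (fun x => L.rankIn D x + L.endsIn x = c) W).trans hW)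
        (q := 2 * k) (by omega)
      simp only [Finset.mem_filter] at hl ht
      have hlZ := hW hl.1
      have htZ := hW ht.1
      obtain ⟨s1, s2⟩ := endsIn_mono hlZ htZ hlt
      have c0 : L.endsIn l ≤ L.endsIn t :=
        add_le_add (Finset.card_le_card s1) (Finset.card_le_card s2)
      have c1 := rankIn_mono (L := L) D hlt.le
      have c2 := hl.2.trans ht.2.symm
      obtain ⟨Y, hY⟩ := h.isRung_of_rankIn_eq hG hZF hF hlZ htZ hlt (by omega)
      rcases hwin l hl.1 t ht.1 hlt (hmid.trans (Finset.card_le_card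
        (Finset.filter_subset_filter _ (Finset.filter_subset _ _)))) with hc | hc
      · exact hY.not_edgeConnectedWithout hG hZF hlZ htZ hlt hc
      · exact hc (untouched_of_endsIn_eq hlZ htZ hlt (by omega)))
  -- Ranks are positive, at most `D.card`, and an edge of `F` has two ends.
  have him : (W.image fun e => L.rankIn D e + L.endsIn e).card ≤ D.card + 2 * F.card := by
    refine (Finset.card_le_card (t := Finset.Icc 1 (D.card + 2 * F.card)) fun c hc => ?_).trans
      (by simp)
    obtain ⟨e, he, rfl⟩ := Finset.mem_image.mp hc
    have a1 := h.one_le_rankIn hG hZF hF (hW he)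
    have a2 := rankIn_le (L := L) D e
    have a3 := endsIn_le (L := L) e
    exact Finset.mem_Icc.mpr ⟨by omega, by omega⟩
  exact hcl.trans (Nat.mul_le_mul_left _ him)

end Ladder

end MGraph

/-! ### Flows -/

namespace MGraph

variable {G : MGraph}

/-- The least possible flow on an edge: edges of a graph can be used in both directions. -/
def lo (G : MGraph) : ℤ := if G.directed then 0 else -1

/-- The net flow out of the vertex `w`. -/
def net (G : MGraph) (φ : Fin G.m → ℤ) (w : Fin G.n) : ℤ :=
  ∑ e, φ e * ((if G.tail e = w then 1 else 0) - (if G.head e = w then 1 else 0))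

open Classical in
/-- The net flow out of the vertex set `S`. -/
noncomputable def netCut (G : MGraph) (φ : Fin G.m → ℤ) (S : Set (Fin G.n)) : ℤ :=
  ∑ e, φ e * ((if G.tail e ∈ S then 1 else 0) - (if G.head e ∈ S then 1 else 0))

/-- A flow of value `val` from `s` to `t` in `G - F`, with unit capacities. -/
structure IsFlow (G : MGraph) (F : Finset (Fin G.m)) (φ : Fin G.m → ℤ) (s t : Fin G.n) (val : ℤ) :
    Prop where
  lo_le : ∀ e, G.lo ≤ φ e
  le_one : ∀ e, φ e ≤ 1
  eq_zero : ∀ e ∈ F, φ e = 0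
  net_eq : ∀ w, G.net φ w = val * ((if w = s then 1 else 0) - (if w = t then 1 else 0))

/-- One more unit of flow can be sent from `u` to `w`. -/
def Res (G : MGraph) (F : Finset (Fin G.m)) (φ : Fin G.m → ℤ) (u w : Fin G.n) : Prop :=
  ∃ e, e ∉ F ∧ ((G.tail e = u ∧ G.head e = w ∧ φ e < 1) ∨
    (G.head e = u ∧ G.tail e = w ∧ G.lo < φ e))

theorem lo_nonpos (G : MGraph) : G.lo ≤ 0 := by
  unfold lo
  split_ifs <;> simp

open Classical in
theorem sum_net (φ : Fin G.m → ℤ) (S : Set (Fin G.n)) :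
    ∑ w ∈ Finset.univ.filter (· ∈ S), G.net φ w = G.netCut φ S := by
  unfold net netCut
  rw [Finset.sum_comm]
  refine Finset.sum_congr rfl fun e _ => ?_
  rw [← Finset.mul_sum, Finset.sum_sub_distrib]
  congr 2 <;> simp [Finset.sum_ite_eq]

open Classical in
theorem netCut_eq {φ : Fin G.m → ℤ} {s t : Fin G.n} {val : ℤ}
    (h : ∀ w, G.net φ w = val * ((if w = s then 1 else 0) - (if w = t then 1 else 0)))
    (S : Set (Fin G.n)) :
    G.netCut φ S = val * ((if s ∈ S then 1 else 0) - (if t ∈ S then 1 else 0)) := by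
  rw [← sum_net, Finset.sum_congr rfl fun w _ => h w, ← Finset.mul_sum, Finset.sum_sub_distrib]
  simp [Finset.sum_ite_eq']

section

variable {F : Finset (Fin G.m)} {φ : Fin G.m → ℤ} {s t : Fin G.n} {val : ℤ}

open Classical in
theorem IsFlow.term_le (h : G.IsFlow F φ s t val) (S : Set (Fin G.n)) (e : Fin G.m) :
    φ e * ((if G.tail e ∈ S then 1 else 0) - (if G.head e ∈ S then 1 else 0)) ≤
      if e ∉ F ∧ G.Crosses S e then 1 else 0 := by
  by_cases heF : e ∈ F
  · simp [h.eq_zero e heF, heF]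
  have h1 := h.lo_le e
  have h2 := h.le_one e
  unfold lo at h1
  by_cases c1 : G.tail e ∈ S <;> by_cases c2 : G.head e ∈ S <;> by_cases c3 : G.directed = true <;>
    simp [Crosses, heF, c1, c2, c3] at h1 ⊢ <;> omega

theorem IsFlow.netCut_le (h : G.IsFlow F φ s t val) (S : Set (Fin G.n)) :
    G.netCut φ S ≤ G.cut F S := by
  classical
  unfold netCut cut
  rw [Finset.card_filter]
  push_cast
  exact Finset.sum_le_sum fun e _ => h.term_le S e

/-- Complementary slackness: equality holds edge by edge exactly if all leaving edges are used to
capacity and nothing flows back, that is, no residual arc leaves `S`. -/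
theorem IsFlow.netCut_eq_cut_iff (h : G.IsFlow F φ s t val) (S : Set (Fin G.n)) :
    G.netCut φ S = G.cut F S ↔ ∀ u w, u ∈ S → w ∉ S → ¬ G.Res F φ u w := by
  classical
  unfold netCut cut
  rw [Finset.card_filter]
  push_cast
  rw [Finset.sum_eq_sum_iff_of_le fun e _ => h.term_le S e]
  constructor
  · rintro h' u w hu hw ⟨e, he, ⟨rfl, rfl, hφ⟩ | ⟨rfl, rfl, hφ⟩⟩
    · have := h' e (Finset.mem_univ e)
      simp [hu, hw, he, Crosses] at this
      omega
    · have := h' e (Finset.mem_univ e)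
      unfold lo at hφ
      by_cases c3 : G.directed = true <;> simp [hu, hw, he, Crosses, c3] at this hφ <;> omega
  · intro h' e _
    by_cases heF : e ∈ F
    · simp [h.eq_zero e heF, heF]
    have h1 := h.lo_le e
    have h2 := h.le_one e
    by_cases c1 : G.tail e ∈ S <;> by_cases c2 : G.head e ∈ S
    · simp [Crosses, c1, c2]
    · have : ¬ φ e < 1 := fun hlt => h' _ _ c1 c2 ⟨e, heF, Or.inl ⟨rfl, rfl, hlt⟩⟩
      simp [Crosses, c1, c2, heF]
      omega
    · have : ¬ G.lo < φ e := fun hlt => h' _ _ c2 c1 ⟨e, heF, Or.inr ⟨rfl, rfl, hlt⟩⟩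
      unfold lo at this h1
      by_cases c3 : G.directed = true <;> simp [Crosses, c1, c2, c3, heF] at this h1 ⊢ <;> omega
    · simp [Crosses, c1, c2]

theorem IsFlow.le_cut (h : G.IsFlow F φ s t val) {S : Set (Fin G.n)} (hs : s ∈ S) (ht : t ∉ S) :
    val ≤ G.cut F S := by
  have h1 := h.netCut_le S
  rwa [netCut_eq h.net_eq, if_pos hs, if_neg ht, sub_zero, mul_one] at h1

/-- The vertex at which a flow enters an edge. -/
def src (G : MGraph) (φ : Fin G.m → ℤ) (e : Fin G.m) : Fin G.n :=
  if φ e = 1 then G.tail e else G.head e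

/-- The vertex at which a flow leaves an edge. -/
def dst (G : MGraph) (φ : Fin G.m → ℤ) (e : Fin G.m) : Fin G.n :=
  if φ e = 1 then G.head e else G.tail e

theorem IsFlow.eq_neg_one (h : G.IsFlow F φ s t val) {e : Fin G.m} (h0 : φ e ≠ 0)
    (h1 : φ e ≠ 1) : φ e = -1 ∧ G.directed = false := by
  have h2 := h.lo_le e
  have h3 := h.le_one e
  unfold lo at h2
  by_cases c : G.directed = true
  · rw [if_pos c] at h2
    omega
  · rw [if_neg c] at h2
    exact ⟨by omega, by simpa using c⟩

theorem IsFlow.res_dst_src (h : G.IsFlow F φ s t val) {e : Fin G.m} (h0 : φ e ≠ 0) :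
    G.Res F φ (G.dst φ e) (G.src φ e) := by
  have heF : e ∉ F := fun he => h0 (h.eq_zero e he)
  refine ⟨e, heF, ?_⟩
  by_cases h1 : φ e = 1
  · have := G.lo_nonpos
    exact Or.inr ⟨by simp [dst, h1], by simp [src, h1], by omega⟩
  · have := (h.eq_neg_one h0 h1).1
    exact Or.inl ⟨by simp [dst, h1], by simp [src, h1], by omega⟩

theorem IsFlow.crosses_iff (h : G.IsFlow F φ s t val) {e : Fin G.m} (h0 : φ e ≠ 0)
    (Y : Set (Fin G.n)) : G.Crosses Y e ↔ (G.src φ e ∈ Y ∧ G.dst φ e ∉ Y) ∨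
      (G.directed = false ∧ G.src φ e ∉ Y ∧ G.dst φ e ∈ Y) := by
  by_cases h1 : φ e = 1
  · simp [Crosses, src, dst, h1]
  · have := (h.eq_neg_one h0 h1).2
    simp only [Crosses, src, dst, h1, if_false, this, true_and]
    tauto

/-- An edge that leaves a set without outgoing residual arcs carries flow out of this set. -/
theorem IsFlow.src_mem (h : G.IsFlow F φ s t val) {S : Set (Fin G.n)}
    (hS : ∀ u w, u ∈ S → w ∉ S → ¬ G.Res F φ u w) {e : Fin G.m} (heF : e ∉ F)
    (hcr : G.Crosses S e) : φ e ≠ 0 ∧ G.src φ e ∈ S ∧ G.dst φ e ∉ S := by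
  have h3 := h.le_one e
  have h4 := h.lo_le e
  rcases hcr with ⟨h1, h2⟩ | ⟨hd, h1, h2⟩
  · have : ¬ φ e < 1 := fun hlt => hS _ _ h1 h2 ⟨e, heF, Or.inl ⟨rfl, rfl, hlt⟩⟩
    have h5 : φ e = 1 := by omega
    exact ⟨by omega, by simpa [src, h5] using h1, by simpa [dst, h5] using h2⟩
  · have : ¬ G.lo < φ e := fun hlt => hS _ _ h2 h1 ⟨e, heF, Or.inr ⟨rfl, rfl, hlt⟩⟩
    have hlo : G.lo = -1 := by simp [lo, hd]
    have h5 : φ e = -1 := by omega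
    exact ⟨by omega, by simpa [src, h5] using h2, by simpa [dst, h5] using h1⟩

open Classical in
-- Flow into `S` along an edge would make its reversal a residual arc out of `S`.
theorem IsFlow.term_nonneg (h : G.IsFlow F φ s t val) {S : Set (Fin G.n)}
    (hS : ∀ u w, u ∈ S → w ∉ S → ¬ G.Res F φ u w) (e : Fin G.m) :
    0 ≤ φ e * ((if G.tail e ∈ S then 1 else 0) - (if G.head e ∈ S then 1 else 0)) := by
  by_cases heF : e ∈ F
  · simp [h.eq_zero e heF]
  by_cases c1 : G.tail e ∈ S <;> by_cases c2 : G.head e ∈ S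
  · simp [c1, c2]
  · have : ¬ φ e < 1 := fun hlt => hS _ _ c1 c2 ⟨e, heF, Or.inl ⟨rfl, rfl, hlt⟩⟩
    simp [c1, c2]
    omega
  · have : ¬ G.lo < φ e := fun hlt => hS _ _ c2 c1 ⟨e, heF, Or.inr ⟨rfl, rfl, hlt⟩⟩
    have := G.lo_nonpos
    simp [c1, c2]
    omega
  · simp [c1, c2]

end

/-! ### Blocked edges, tight cuts and trails. -/

/-- The edges that can be deleted from `G - F` but not from `G - F - f`. -/
def Blocked (G : MGraph) (lam : ℕ) (F : Finset (Fin G.m)) (f e : Fin G.m) : Prop :=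
  G.EdgeConnectedWithout lam (insert e F) ∧ ¬ G.EdgeConnectedWithout lam (insert e (insert f F))

section

variable {lam : ℕ} {F : Finset (Fin G.m)} {f : Fin G.m} {φ : Fin G.m → ℤ}

theorem Blocked.notMem (hf : G.EdgeConnectedWithout lam (insert f F)) {e : Fin G.m}
    (he : G.Blocked lam F f e) : e ∉ insert f F := fun h => he.2 (by rwa [Finset.insert_eq_of_mem h])

/-- A set violated by deleting both `e` and `f` is satisfied when only one of them is deleted. So
both edges leave it, and `lam` edges remain without `f`. In a graph, passing to the complement puts
the tail of `f` inside. -/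
theorem Blocked.exists_tight (hfF : f ∉ F) (hf : G.EdgeConnectedWithout lam (insert f F))
    {e : Fin G.m} (he : G.Blocked lam F f e) :
    ∃ S, G.tail f ∈ S ∧ G.head f ∉ S ∧ G.Crosses S e ∧ G.cut (insert f F) S = lam := by
  classical
  have heH := he.notMem hf
  have h2 := he.2
  rw [edgeConnectedWithout_iff] at h2
  push Not at h2
  obtain ⟨S, u, w, hu, hw, hlt⟩ := h2
  have a1 := edgeConnectedWithout_iff.mp hf S u w hu hw
  have a2 := edgeConnectedWithout_iff.mp he.1 S u w hu hw
  have b1 := cut_union_eq (F := insert f F) (D := {e}) (by simpa using heH) S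
  have b2 := cut_union_eq (F := F) (D := {f}) (by simpa using hfF) S
  have b3 := cut_union_eq (F := F) (D := {e})
    (by simpa using fun h => heH (Finset.mem_insert_of_mem h)) S
  rw [Finset.filter_singleton, Finset.union_comm, ← Finset.insert_eq] at b1 b2 b3
  have hcr : G.Crosses S e := by
    by_contra hcr
    rw [if_neg hcr, Finset.card_empty] at b1
    omega
  rw [if_pos hcr, Finset.card_singleton] at b1 b3
  have hcrf : G.Crosses S f := by
    by_contra hcrf
    rw [if_neg hcrf, Finset.card_empty] at b2
    omega
  rcases hcrf with ⟨h1, h2⟩ | ⟨hd, h1, h2⟩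
  · exact ⟨S, h1, h2, hcr, by omega⟩
  · refine ⟨Sᶜ, h1, fun h => h h2, (crosses_compl hd S e).mpr hcr, ?_⟩
    rw [cut_compl hd]
    omega

theorem IsFlow.closed_of_tight {H : Finset (Fin G.m)} {s t : Fin G.n}
    (hφ : G.IsFlow H φ s t lam) {S : Set (Fin G.n)}
    (hs : s ∈ S) (ht : t ∉ S) (hS : G.cut H S = lam) :
    ∀ u w, u ∈ S → w ∉ S → ¬ G.Res H φ u w := by
  refine (hφ.netCut_eq_cut_iff S).mp ?_
  rw [netCut_eq hφ.net_eq, if_pos hs, if_neg ht, hS]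
  ring

/-- If the edges outside `C` carry no flow from `tail f` to `head f`, then `C` contains all blocked
edges. -/
theorem Blocked.mem_of_net_eq_zero (hfF : f ∉ F) (hf : G.EdgeConnectedWithout lam (insert f F))
    (hφ : G.IsFlow (insert f F) φ (G.tail f) (G.head f) lam) {C : Finset (Fin G.m)}
    (hC : ∀ w, G.net (fun e => if e ∈ C then 0 else φ e) w = 0) {e : Fin G.m}
    (he : G.Blocked lam F f e) : e ∈ C := by
  classical
  by_contra heC
  obtain ⟨S, ha, hb, hcr, hS⟩ := he.exists_tight hfF hf
  have hcl := hφ.closed_of_tight ha hb hS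
  have h0 : G.netCut (fun e => if e ∈ C then 0 else φ e) S = 0 := by
    rw [← sum_net]
    exact Finset.sum_eq_zero fun w _ => hC w
  -- The flow outside `C` has net zero through the tight set, but no term is negative and that of
  -- `e`, which is saturated, equals 1.
  refine absurd h0 (ne_of_gt ?_)
  refine Finset.sum_pos' (fun e' _ => ?_) ⟨e, Finset.mem_univ e, ?_⟩
  · by_cases h1 : e' ∈ C
    · simp [h1]
    · simpa only [h1, if_false] using hφ.term_nonneg hcl e'
  · simp only [heC, if_false]
    obtain ⟨h1, h2, h3⟩ := hφ.src_mem hcl (he.notMem hf) hcr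
    by_cases h4 : φ e = 1
    · simp only [src, dst, h4, if_true] at h2 h3
      simp [h2, h3, h4]
    · simp only [src, dst, h4, if_false] at h2 h3
      simp [h2, h3, (hφ.eq_neg_one h1 h4).1]

/-- The vertices that cannot reach `w` in the residual graph. -/
def noReach (G : MGraph) (F : Finset (Fin G.m)) (φ : Fin G.m → ℤ) (w : Fin G.n) : Set (Fin G.n) :=
  {x | ¬ Relation.ReflTransGen (G.Res F φ) x w}

/-- A set `C` of edges carrying one unit of the flow, in the order in which it passes them. -/
structure IsTrail (G : MGraph) (H : Finset (Fin G.m)) (φ : Fin G.m → ℤ) (a b : Fin G.n)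
    (C : Finset (Fin G.m)) (pos : Fin G.m → ℕ) : Prop where
  ne_zero : ∀ e ∈ C, φ e ≠ 0
  injOn : Set.InjOn pos C
  net_eq : ∀ w, G.net (fun e => if e ∈ C then φ e else 0) w =
    (if w = a then 1 else 0) - (if w = b then 1 else 0)
  reach : ∀ e ∈ C, ∀ e' ∈ C, pos e < pos e' →
    Relation.ReflTransGen (G.Res H φ) (G.src φ e') (G.dst φ e)

theorem net_add (φ ψ : Fin G.m → ℤ) (w : Fin G.n) :
    G.net (fun e => φ e + ψ e) w = G.net φ w + G.net ψ w := by
  simp only [net, ← Finset.sum_add_distrib]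
  exact Finset.sum_congr rfl fun e _ => by ring

/-- A tight set through `e` has no residual arc leaving it and misses the far end of `e`; hence it
is contained in `noReach`. -/
theorem Blocked.mem_noReach (hfF : f ∉ F) (hf : G.EdgeConnectedWithout lam (insert f F))
    (hφ : G.IsFlow (insert f F) φ (G.tail f) (G.head f) lam) {e : Fin G.m}
    (he : G.Blocked lam F f e) :
    G.tail f ∈ G.noReach (insert f F) φ (G.dst φ e) ∧
      G.src φ e ∈ G.noReach (insert f F) φ (G.dst φ e) := by
  obtain ⟨S, ha, hb, hcr, hS⟩ := he.exists_tight hfF hf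
  have hcl := hφ.closed_of_tight ha hb hS
  obtain ⟨-, h2, h3⟩ := hφ.src_mem hcl (he.notMem hf) hcr
  have key : ∀ x ∈ S, x ∈ G.noReach (insert f F) φ (G.dst φ e) := fun x hx hr => by
    obtain ⟨y, z, hy, hz, hyz⟩ := exists_mem_notMem_of_reach hr hx h3
    exact hcl y z hy hz hyz
  exact ⟨key _ ha, key _ h2⟩

/-- No residual arc leaves this set, so its cut equals its net flow, which is `lam` or 0. The value
0 would contradict connectivity, because the two ends of `e` are separated. In `G - F` the edge `f`
adds one. -/
theorem Blocked.cut_noReach (hlam : 1 ≤ lam) (hfF : f ∉ F)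
    (hf : G.EdgeConnectedWithout lam (insert f F))
    (hφ : G.IsFlow (insert f F) φ (G.tail f) (G.head f) lam) {e : Fin G.m}
    (he : G.Blocked lam F f e) :
    G.head f ∉ G.noReach (insert f F) φ (G.dst φ e) ∧
      G.cut F (G.noReach (insert f F) φ (G.dst φ e)) = lam + 1 := by
  classical
  obtain ⟨ha, hu⟩ := he.mem_noReach hfF hf hφ
  have hv : G.dst φ e ∉ G.noReach (insert f F) φ (G.dst φ e) :=
    fun h => h Relation.ReflTransGen.refl
  have h1 := (hφ.netCut_eq_cut_iff (G.noReach (insert f F) φ (G.dst φ e))).mpr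
    fun u w hu hw hr => hw fun hr' => hu (Relation.ReflTransGen.head hr hr')
  have h2 := edgeConnectedWithout_iff.mp hf _ _ _ hu hv
  rw [netCut_eq hφ.net_eq, if_pos ha] at h1
  have hb : G.head f ∉ G.noReach (insert f F) φ (G.dst φ e) := fun hb => by
    rw [if_pos hb] at h1
    simp only [sub_self, mul_zero] at h1
    omega
  rw [if_neg hb] at h1
  refine ⟨hb, ?_⟩
  have b2 := cut_union_eq (F := F) (D := {f}) (by simpa using hfF)
    (G.noReach (insert f F) φ (G.dst φ e))
  rw [Finset.filter_singleton, if_pos (show G.Crosses _ f from Or.inl ⟨ha, hb⟩),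
    Finset.card_singleton, Finset.union_comm, ← Finset.insert_eq] at b2
  omega

open Classical in
-- Without the trail, `lam - 1` units still have to cross `Y` on other edges; the crossing edges of
-- the trail and `f` itself are added to these. For the parity, the trail has net flow 1 through `Y`
-- and each crossing edge contributes 1 or -1.
theorem IsTrail.separating (hfF : f ∉ F)
    (hφ : G.IsFlow (insert f F) φ (G.tail f) (G.head f) lam) {C : Finset (Fin G.m)}
    {pos : Fin G.m → ℕ} (hC : G.IsTrail (insert f F) φ (G.tail f) (G.head f) C pos)
    {Y : Set (Fin G.n)} (ha : G.tail f ∈ Y) (hb : G.head f ∉ Y) :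
    lam + (C.filter fun e => G.Crosses Y e).card ≤ G.cut F Y ∧
      (G.directed = false → Odd (C.filter fun e => G.Crosses Y e).card) := by
  have hCH : Disjoint (insert f F) C := by
    rw [Finset.disjoint_left]
    exact fun e he heC => hC.ne_zero e heC (hφ.eq_zero e he)
  constructor
  · have hrest : G.IsFlow (insert f F ∪ C) (fun e => if e ∈ C then 0 else φ e) (G.tail f)
        (G.head f) (lam - 1) := by
      refine ⟨fun e => ?_, fun e => ?_, fun e he => ?_, fun w => ?_⟩
      · by_cases h : e ∈ C
        · simpa [h] using G.lo_nonpos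
        · simpa [h] using hφ.lo_le e
      · by_cases h : e ∈ C
        · simp [h]
        · simpa [h] using hφ.le_one e
      · by_cases h : e ∈ C
        · simp [h]
        · simpa [h] using hφ.eq_zero e ((Finset.mem_union.mp he).resolve_right h)
      · have h1 := net_add (fun e => if e ∈ C then φ e else 0) (fun e => if e ∈ C then 0 else φ e) w
        rw [hC.net_eq, show (fun e => (if e ∈ C then φ e else 0) + if e ∈ C then 0 else φ e) = φ by
          ext e; by_cases h : e ∈ C <;> simp [h], hφ.net_eq] at h1
        linear_combination -h1
    have h1 := hrest.le_cut ha hb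
    have h2 := cut_union_eq hCH Y
    have h3 := cut_union_eq (F := F) (D := {f}) (by simpa using hfF) Y
    rw [Finset.filter_singleton, if_pos (show G.Crosses _ f from Or.inl ⟨ha, hb⟩),
      Finset.card_singleton, Finset.union_comm, ← Finset.insert_eq] at h3
    omega
  · intro hG
    have h1 := netCut_eq (s := G.tail f) (t := G.head f) (val := 1)
      (fun w => by rw [hC.net_eq, one_mul]) Y
    rw [if_pos ha, if_neg hb] at h1
    have h2 : (2 : ℤ) ∣ ((C.filter fun e => G.Crosses Y e).card : ℤ) -
        G.netCut (fun e => if e ∈ C then φ e else 0) Y := by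
      have : (C.filter fun e => G.Crosses Y e) =
          Finset.univ.filter fun e => e ∈ C ∧ G.Crosses Y e := by ext; simp
      rw [this, Finset.card_filter]
      push_cast
      unfold netCut
      rw [← Finset.sum_sub_distrib]
      refine Finset.dvd_sum fun e _ => ?_
      by_cases h : e ∈ C
      · have h0 := hC.ne_zero e h
        have hv : φ e = 1 ∨ φ e = -1 := or_iff_not_imp_left.mpr fun h1 => (hφ.eq_neg_one h0 h1).1
        by_cases c1 : G.tail e ∈ Y <;> by_cases c2 : G.head e ∈ Y <;> rcases hv with hv | hv <;>
          simp [Crosses, h, c1, c2, hG, hv]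
      · simp [h]
    rw [h1] at h2
    rw [← Nat.not_even_iff_odd, even_iff_two_dvd]
    omega

open Classical in
/-- The blocked edges on a trail form a ladder. -/
noncomputable def ladder (hlam : 1 ≤ lam) (hfF : f ∉ F)
    (hf : G.EdgeConnectedWithout lam (insert f F))
    (hφ : G.IsFlow (insert f F) φ (G.tail f) (G.head f) lam) {C : Finset (Fin G.m)}
    {pos : Fin G.m → ℕ}
    (hC : G.IsTrail (insert f F) φ (G.tail f) (G.head f) C pos) : G.Ladder lam F where
  Z := C.filter fun e => G.Blocked lam F f e
  pos := pos
  X := fun e => G.noReach (insert f F) φ (G.dst φ e)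
  u := G.src φ
  v := G.dst φ
  a := G.tail f
  b := G.head f
  injOn := hC.injOn.mono (Finset.coe_subset.mpr (Finset.filter_subset _ _))
  cut_X := fun e he => ((Finset.mem_filter.mp he).2.cut_noReach hlam hfF hf hφ).2
  a_mem := fun e he => ((Finset.mem_filter.mp he).2.mem_noReach hfF hf hφ).1
  b_notMem := fun e he => ((Finset.mem_filter.mp he).2.cut_noReach hlam hfF hf hφ).1
  u_mem := fun e he => ((Finset.mem_filter.mp he).2.mem_noReach hfF hf hφ).2
  v_notMem := fun e _ h => h Relation.ReflTransGen.refl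
  -- From the far end of the later edge `e'` one can go back over `e'` and along the trail to the
  -- far end of `e`. So whoever reaches the former reaches the latter.
  mono := by
    intro e he e' he' hlt x hx hr
    have heC := (Finset.mem_filter.mp he).1
    have heC' := (Finset.mem_filter.mp he').1
    exact hx ((hr.tail (hφ.res_dst_src (hC.ne_zero e' heC'))).trans (hC.reach e heC e' heC' hlt))
  u_notMem := fun e he e' he' hlt h =>
    h (hC.reach e (Finset.mem_filter.mp he).1 e' (Finset.mem_filter.mp he').1 hlt)
  v_mem := fun e he e' he' hlt h => ((Finset.mem_filter.mp he').2.mem_noReach hfF hf hφ).2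
    ((hC.reach e (Finset.mem_filter.mp he).1 e' (Finset.mem_filter.mp he').1 hlt).trans h)
  crosses_iff := fun e he Y => hφ.crosses_iff (hC.ne_zero e (Finset.mem_filter.mp he).1) Y
  lt_cut := fun e he Y hY => by
    have hb := (Finset.mem_filter.mp he).2
    exact hb.1.lt_cut (fun h => hb.notMem hf (Finset.mem_insert_of_mem h)) hY
  separating := fun Y ha hb => by
    obtain ⟨h1, h2⟩ := hC.separating hfF hφ ha hb
    refine ⟨_, Finset.card_le_card ?_, h1, h2⟩
    exact Finset.filter_subset_filter _ (Finset.filter_subset _ _)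

end

end MGraph

/-! ### Conditions and blocks -/

namespace RExpr

/-- The variable in cell 0 of array `a`. -/
def var (a : ℕ) : RExpr := get a (lit 0)

def lt (x y : RExpr) : RExpr := sub y x

def not (x : RExpr) : RExpr := sub (lit 1) x

def and (x y : RExpr) : RExpr := not (add (not x) (not y))

def eq (x y : RExpr) : RExpr := not (add (sub x y) (sub y x))

/-- The tail of the edge whose index is in variable `c`. -/
def tl (c : ℕ) : RExpr := get 1 (var c)

/-- The head of the edge whose index is in variable `c`. -/
def hd (c : ℕ) : RExpr := get 2 (var c)

variable (σ : Store) (x y : RExpr)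

@[simp] theorem eval_var (a : ℕ) : (var a).eval σ = σ a 0 := rfl
@[simp] theorem eval_lit (c : ℕ) : (lit c).eval σ = c := rfl
@[simp] theorem eval_get (a : ℕ) : (get a x).eval σ = σ a (x.eval σ) := rfl
@[simp] theorem eval_add : (add x y).eval σ = x.eval σ + y.eval σ := rfl
@[simp] theorem eval_sub : (sub x y).eval σ = x.eval σ - y.eval σ := rfl
@[simp] theorem eval_tl (c : ℕ) : (tl c).eval σ = σ 1 (σ c 0) := rfl
@[simp] theorem eval_hd (c : ℕ) : (hd c).eval σ = σ 2 (σ c 0) := rfl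

/-- The condition `x` holds. -/
def Holds : Prop := x.eval σ ≠ 0

@[simp] theorem holds_lt : (lt x y).Holds σ ↔ x.eval σ < y.eval σ := by
  simp only [Holds, lt, eval]; omega

@[simp] theorem holds_not : (not x).Holds σ ↔ x.eval σ = 0 := by
  simp only [Holds, not, eval]; omega

@[simp] theorem holds_and : (and x y).Holds σ ↔ x.Holds σ ∧ y.Holds σ := by
  simp only [Holds, and, not, eval]; omega

@[simp] theorem holds_eq : (eq x y).Holds σ ↔ x.eval σ = y.eval σ := by
  simp only [Holds, eq, not, eval]; omega

@[simp] theorem holds_get (a : ℕ) : (get a x).Holds σ ↔ σ a (x.eval σ) ≠ 0 := Iff.rfl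

@[simp] theorem holds_var (a : ℕ) : (var a).Holds σ ↔ σ a 0 ≠ 0 := Iff.rfl

end RExpr

namespace BProg

/-- Assignment to the variable in cell 0 of array `a`. -/
def assign (a : ℕ) (x : RExpr) : BProg := set a (.lit 0) x

/-- A conditional without alternative. -/
def when (b : RExpr) (p : BProg) : BProg := ite b p skip

/-- Sequential execution. -/
def block : List BProg → BProg
  | [] => skip
  | p :: l => seq p (block l)

variable (σ : Store)

@[simp] theorem ex_set (a : ℕ) (i x : RExpr) : (set a i x).ex σ = σ.upd a (i.eval σ) (x.eval σ) := rfl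

@[simp] theorem ex_assign (a : ℕ) (x : RExpr) : (assign a x).ex σ = σ.upd a 0 (x.eval σ) := rfl

@[simp] theorem ex_block_nil : (block []).ex σ = σ := rfl

@[simp] theorem ex_block_cons (p : BProg) (l : List BProg) :
    (block (p :: l)).ex σ = (block l).ex (p.ex σ) := rfl

theorem ex_ite_of {b : RExpr} {p q : BProg} {σ : Store} (h : b.Holds σ) :
    (ite b p q).ex σ = p.ex σ := if_pos h

theorem ex_ite_of_not {b : RExpr} {p q : BProg} {σ : Store} (h : ¬ b.Holds σ) :
    (ite b p q).ex σ = q.ex σ := if_neg h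

theorem ex_when_of {b : RExpr} {p : BProg} {σ : Store} (h : b.Holds σ) :
    (when b p).ex σ = p.ex σ := if_pos h

theorem ex_when_of_not {b : RExpr} {p : BProg} {σ : Store} (h : ¬ b.Holds σ) :
    (when b p).ex σ = σ := if_neg h

end BProg

/-! ### Vertices and edges in memory -/

/-- The memory still contains the input. -/
def HasInput (G : MGraph) (lam k : ℕ) (R : Finset (Fin G.m)) (σ : Store) : Prop :=
  ∀ a < 4, σ a = inputStore G lam k R a

namespace HasInput

variable {G : MGraph} {lam k : ℕ} {R : Finset (Fin G.m)} {σ τ : Store}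

theorem congr (h : HasInput G lam k R σ) (h' : ∀ a < 4, τ a = σ a) : HasInput G lam k R τ :=
  fun a ha => (h' a ha).trans (h a ha)

theorem upd (h : HasInput G lam k R σ) {a : ℕ} (ha : 4 ≤ a) (i v : ℕ) :
    HasInput G lam k R (σ.upd a i v) :=
  h.congr fun _ hb => Store.upd_ne _ _ (by omega)

theorem ex (h : HasInput G lam k R σ) {p : BProg} (hp : ∀ a < 4, a ∉ p.writes) :
    HasInput G lam k R (p.ex σ) :=
  h.congr fun a ha => BProg.ex_frame (hp a ha)

theorem dir (h : HasInput G lam k R σ) : σ 0 0 = if G.directed then 1 else 0 := by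
  rw [h 0 (by omega)]
  rfl

theorem n (h : HasInput G lam k R σ) : σ 0 1 = G.n := by
  rw [h 0 (by omega)]
  rfl

theorem m (h : HasInput G lam k R σ) : σ 0 2 = G.m := by
  rw [h 0 (by omega)]
  rfl

theorem lam_eq (h : HasInput G lam k R σ) : σ 0 3 = lam := by
  rw [h 0 (by omega)]
  rfl

theorem k_eq (h : HasInput G lam k R σ) : σ 0 4 = k := by
  rw [h 0 (by omega)]
  rfl

theorem bound (h : HasInput G lam k R σ) : σ.bound = G.n + G.m + 1 := by
  rw [Store.bound, h.n, h.m]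

theorem tail (h : HasInput G lam k R σ) (e : Fin G.m) : σ 1 e = G.tail e := by
  rw [h 1 (by omega)]
  simp [inputStore]

theorem head (h : HasInput G lam k R σ) (e : Fin G.m) : σ 2 e = G.head e := by
  rw [h 2 (by omega)]
  simp [inputStore]

theorem mem (h : HasInput G lam k R σ) (e : Fin G.m) : σ 3 e ≠ 0 ↔ e ∈ R := by
  rw [h 3 (by omega)]
  simp [inputStore]

end HasInput

/-- The set of edges with indicator function `d`. -/
def edgeSet (G : MGraph) (d : ℕ → ℕ) : Finset (Fin G.m) := Finset.univ.filter fun e => d e ≠ 0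

@[simp] theorem mem_edgeSet {G : MGraph} {d : ℕ → ℕ} {e : Fin G.m} :
    e ∈ edgeSet G d ↔ d e ≠ 0 := by simp [edgeSet]

/-- The flow stored in the array `x`, in which 1 stands for no flow. -/
def flowOf (G : MGraph) (x : ℕ → ℕ) : Fin G.m → ℤ := fun e => (x e : ℤ) - 1

theorem lo_lt_flowOf {G : MGraph} {x : ℕ → ℕ} {e : Fin G.m} :
    G.lo < flowOf G x e ↔ (if G.directed then 1 else 0) < x e := by
  unfold MGraph.lo flowOf
  split_ifs <;> omega

theorem flowOf_lt_one {G : MGraph} {x : ℕ → ℕ} {e : Fin G.m} : flowOf G x e < 1 ↔ x e < 2 := by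
  unfold flowOf
  omega

theorem flowOf_update {G : MGraph} {x : ℕ → ℕ} {e : Fin G.m} {v : ℕ} :
    flowOf G (Function.update x e v) = Function.update (flowOf G x) e ((v : ℤ) - 1) := by
  ext e'
  by_cases h : e' = e
  · subst h; simp [flowOf]
  · have : (e' : ℕ) ≠ e := fun h' => h (Fin.ext h')
    simp [flowOf, Function.update_of_ne h, Function.update_of_ne this]

/-! ### Computing who can reach a vertex -/

namespace MGraph

variable {G : MGraph} {F : Finset (Fin G.m)} {φ : Fin G.m → ℤ} {t : Fin G.n}

/-- The number of vertices with a rank. -/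
def rankCount (G : MGraph) (r : ℕ → ℕ) : ℕ :=
  (Finset.univ.filter fun w : Fin G.n => r w ≠ 0).card

/-- The nonzero entries of `r` are ranks of vertices that can reach `t`. -/
structure PreRank (G : MGraph) (F : Finset (Fin G.m)) (φ : Fin G.m → ℤ) (t : Fin G.n)
    (r : ℕ → ℕ) : Prop where
  target : r t = 1
  desc : ∀ w : Fin G.n, r w ≠ 0 → w ≠ t → ∃ y : Fin G.n, G.Res F φ w y ∧ r y ≠ 0 ∧ r y < r w
  -- Ranks are thereby at most `G.n`, so a path of decreasing ranks fits into one bounded loop.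
  le_count : ∀ w : Fin G.n, r w ≤ G.rankCount r

/-- All vertices that can reach `t` have a rank. -/
def RankClosed (G : MGraph) (F : Finset (Fin G.m)) (φ : Fin G.m → ℤ) (r : ℕ → ℕ) : Prop :=
  ∀ w y : Fin G.n, G.Res F φ w y → r y ≠ 0 → r w ≠ 0

theorem rankCount_le (r : ℕ → ℕ) : G.rankCount r ≤ G.n :=
  (Finset.card_filter_le _ _).trans (by simp)

theorem PreRank.update {r : ℕ → ℕ} (h : G.PreRank F φ t r) {w y : Fin G.n} (hwy : G.Res F φ w y)
    (hy : r y ≠ 0) (hw : r w = 0) : G.PreRank F φ t (Function.update r w (r y + 1)) := by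
  have hne : ∀ z : Fin G.n, z ≠ w → Function.update r (w : ℕ) (r y + 1) z = r z := fun z hz =>
    Function.update_of_ne (fun h => hz (Fin.ext h)) _ _
  have hnw : ∀ z : Fin G.n, r z ≠ 0 → z ≠ w := fun z hz h => hz (h ▸ hw)
  have hcount : G.rankCount r + 1 ≤ G.rankCount (Function.update r w (r y + 1)) := by
    refine Finset.card_lt_card (Finset.ssubset_iff_of_subset ?_ |>.mpr ⟨w, ?_, ?_⟩)
    · refine Finset.monotone_filter_right _ fun z _ hz => ?_
      rw [hne z (hnw z hz)]
      exact hz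
    · simp
    · simp [hw]
  refine ⟨?_, fun z hz hzt => ?_, fun z => ?_⟩
  · rw [hne t (hnw t (by rw [h.target]; omega)), h.target]
  · by_cases hzw : z = w
    · subst hzw
      refine ⟨y, hwy, ?_, ?_⟩ <;> rw [hne y (hnw y hy)]
      · exact hy
      · simp
    · rw [hne z hzw] at hz ⊢
      obtain ⟨x, h1, h2, h3⟩ := h.desc z hz hzt
      exact ⟨x, h1, by rwa [hne x (hnw x h2)], by rwa [hne x (hnw x h2)]⟩
  · by_cases hzw : z = w
    · subst hzw
      have := h.le_count y
      simp only [Function.update_self]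
      omega
    · rw [hne z hzw]
      have := h.le_count z
      omega

/-- Follow decreasing ranks of `r'` down to `t`, then use closedness on the way back. Hence a closed
ranking gains no vertices in further rounds. -/
theorem PreRank.ne_zero_of_closed {r r' : ℕ → ℕ} (h : G.PreRank F φ t r')
    (hr : G.RankClosed F φ r) (ht : r t ≠ 0) (w : Fin G.n) (hw : r' w ≠ 0) : r w ≠ 0 := by
  induction hd : r' w using Nat.strong_induction_on generalizing w with
  | _ d ih =>
    by_cases hwt : w = t
    · rwa [hwt]
    · obtain ⟨y, h1, h2, h3⟩ := h.desc w hw hwt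
      exact hr w y h1 (ih _ (hd ▸ h3) y h2 rfl)

theorem PreRank.reach_iff {r : ℕ → ℕ} (h : G.PreRank F φ t r) (hr : G.RankClosed F φ r)
    (w : Fin G.n) : r w ≠ 0 ↔ Relation.ReflTransGen (G.Res F φ) w t := by
  constructor
  · intro hw
    induction hd : r w using Nat.strong_induction_on generalizing w with
    | _ d ih =>
      by_cases hwt : w = t
      · rw [hwt]
      · obtain ⟨y, h1, h2, h3⟩ := h.desc w hw hwt
        exact Relation.ReflTransGen.head h1 (ih _ (hd ▸ h3) y h2 rfl)
  · intro hw
    induction hw using Relation.ReflTransGen.head_induction_on with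
    | refl => rw [h.target]; omega
    | head h1 _ ih => exact hr _ _ h1 ih

end MGraph

namespace Algo

open BProg RExpr MGraph

/-- The expression for the direction flag. -/
def dirE : RExpr := get 0 (lit 0)

/-- Ranks the vertex `x` if it has a residual arc to the ranked vertex `y`. -/
def relax (b x y : RExpr) : BProg :=
  when (.and (.not (get 7 (var 31))) (.and (get 9 y) (.and (.not (get 9 x)) b)))
    (set 9 x (add (get 9 y) (lit 1)))

/-- One step of the computation of ranks: the edge in variable 31 is used in both directions. -/
def rankEdge : BProg := block [
  relax (.lt (get 8 (var 31)) (lit 2)) (tl 31) (hd 31),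
  relax (.lt dirE (get 8 (var 31))) (hd 31) (tl 31)]

/-- Computes ranks, in array 9, of the vertices that can reach the vertex in variable 14 in the
residual graph of the flow in array 8 after deletion of the edges in array 7. -/
def rankProg : BProg := block [
  forLt 30 1 (set 9 (var 30) (lit 0)),
  set 9 (var 14) (lit 1),
  forN 30 (forLt 31 2 rankEdge)]

variable {G : MGraph} {lam k : ℕ} {R : Finset (Fin G.m)}

theorem relax_spec {τ : Store} {b x y : RExpr} {w z : Fin G.n} {e : Fin G.m} (he : τ 31 0 = e)
    (hx : x.eval τ = w) (hy : y.eval τ = z)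
    (hres : e ∉ edgeSet G (τ 7) → b.Holds τ → G.Res (edgeSet G (τ 7)) (flowOf G (τ 8)) w z)
    {t : Fin G.n} (hr : G.PreRank (edgeSet G (τ 7)) (flowOf G (τ 8)) t (τ 9)) :
    G.PreRank (edgeSet G (τ 7)) (flowOf G (τ 8)) t ((relax b x y).ex τ 9) ∧
    (∀ w : Fin G.n, τ 9 w ≠ 0 → (relax b x y).ex τ 9 w ≠ 0) ∧
    (e ∉ edgeSet G (τ 7) → b.Holds τ → τ 9 z ≠ 0 → (relax b x y).ex τ 9 w ≠ 0) := by
  unfold relax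
  by_cases hb : (RExpr.and (.not (get 7 (var 31)))
      (.and (get 9 y) (.and (.not (get 9 x)) b))).Holds τ
  · rw [ex_when_of hb]
    simp only [holds_and, holds_not, eval_get, eval_var, he, holds_get, hx, hy] at hb
    obtain ⟨h1, h2, h3, h4⟩ := hb
    simp only [ex_set, hx, Store.upd_self, eval_add, eval_get, hy, eval_lit]
    refine ⟨hr.update (hres (by simpa using h1) h4) h2 h3, fun v hv => ?_, fun _ _ _ => by simp⟩
    rw [Function.update_of_ne fun h : (v : ℕ) = w => hv (by rw [h, h3])]
    exact hv
  · rw [ex_when_of_not hb]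
    simp only [holds_and, holds_not, eval_get, eval_var, he, holds_get, hx, hy] at hb
    exact ⟨hr, fun _ h => h, fun h1 h2 h3 h4 => hb ⟨by simpa using h1, h3, h4, h2⟩⟩

theorem relax_frame {b x y : RExpr} {τ : Store} {a : ℕ} (ha : a ≠ 9) :
    (relax b x y).ex τ a = τ a :=
  ex_frame (by simpa [relax, when, writes] using ha)

theorem rankEdge_spec {τ : Store} (h : HasInput G lam k R τ) {e : Fin G.m} (he : τ 31 0 = e)
    {t : Fin G.n} (hr : G.PreRank (edgeSet G (τ 7)) (flowOf G (τ 8)) t (τ 9)) :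
    G.PreRank (edgeSet G (τ 7)) (flowOf G (τ 8)) t (rankEdge.ex τ 9) ∧
    (∀ w : Fin G.n, τ 9 w ≠ 0 → rankEdge.ex τ 9 w ≠ 0) ∧
    (e ∉ edgeSet G (τ 7) → flowOf G (τ 8) e < 1 → τ 9 (G.head e) ≠ 0 →
      rankEdge.ex τ 9 (G.tail e) ≠ 0) ∧
    (e ∉ edgeSet G (τ 7) → G.lo < flowOf G (τ 8) e → τ 9 (G.tail e) ≠ 0 →
      rankEdge.ex τ 9 (G.head e) ≠ 0) := by
  simp only [rankEdge, ex_block_cons, ex_block_nil]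
  obtain ⟨p1, p2, p3⟩ := relax_spec (b := .lt (get 8 (var 31)) (lit 2)) (x := tl 31) (y := hd 31)
    (w := G.tail e) (z := G.head e) he (by simp [he, h.tail]) (by simp [he, h.head])
    (fun h1 h2 => ⟨e, h1, Or.inl ⟨rfl, rfl, flowOf_lt_one.mpr (by simpa [he] using h2)⟩⟩) hr
  have hfr : ∀ a, a ≠ 9 →
      (relax (.lt (get 8 (var 31)) (lit 2)) (tl 31) (hd 31)).ex τ a = τ a := fun a ha =>
    relax_frame ha
  generalize (relax (.lt (get 8 (var 31)) (lit 2)) (tl 31) (hd 31)).ex τ = τ' at *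
  have h' : HasInput G lam k R τ' := h.congr fun a ha => hfr a (by omega)
  have he' : τ' 31 0 = e := by rw [hfr 31 (by omega), he]
  obtain ⟨q1, q2, q3⟩ := relax_spec (τ := τ') (b := .lt dirE (get 8 (var 31))) (x := hd 31)
    (y := tl 31) (w := G.head e) (z := G.tail e) (t := t) he' (by simp [he', h'.head])
    (by simp [he', h'.tail])
    (fun h1 h2 => ⟨e, h1, Or.inr ⟨rfl, rfl, lo_lt_flowOf.mpr
      (by simpa [he', dirE, h'.dir] using h2)⟩⟩)
    (by rw [hfr 7 (by omega), hfr 8 (by omega)]; exact p1)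
  rw [hfr 7 (by omega), hfr 8 (by omega)] at q1
  rw [hfr 7 (by omega)] at q3
  refine ⟨q1, fun w hw => q2 w (p2 w hw), fun h1 h2 h3 => ?_, fun h1 h2 h3 => ?_⟩
  · exact q2 _ (p3 h1 (by simpa [he] using flowOf_lt_one.mp h2) h3)
  · refine q3 h1 ?_ (p2 _ h3)
    have := lo_lt_flowOf.mp h2
    simpa [he', dirE, h'.dir, hfr 8] using this

theorem rankRound_spec {σ : Store} (h : HasInput G lam k R σ)
    {t : Fin G.n} (hr : G.PreRank (edgeSet G (σ 7)) (flowOf G (σ 8)) t (σ 9)) :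
    G.PreRank (edgeSet G (σ 7)) (flowOf G (σ 8)) t ((forLt 31 2 rankEdge).ex σ 9) ∧
    (∀ w : Fin G.n, σ 9 w ≠ 0 → (forLt 31 2 rankEdge).ex σ 9 w ≠ 0) ∧
    (∀ w y : Fin G.n, G.Res (edgeSet G (σ 7)) (flowOf G (σ 8)) w y → σ 9 y ≠ 0 →
      (forLt 31 2 rankEdge).ex σ 9 w ≠ 0) := by
  have key := forLt_rule (c := 31) (j := 2) (p := rankEdge) (σ := σ) (by decide)
    (by rw [h.m, h.bound]; omega)
    (fun i τ => G.PreRank (edgeSet G (σ 7)) (flowOf G (σ 8)) t (τ 9) ∧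
      (∀ w : Fin G.n, σ 9 w ≠ 0 → τ 9 w ≠ 0) ∧
      ∀ e : Fin G.m, e < i → e ∉ edgeSet G (σ 7) →
        (flowOf G (σ 8) e < 1 → σ 9 (G.head e) ≠ 0 → τ 9 (G.tail e) ≠ 0) ∧
        (G.lo < flowOf G (σ 8) e → σ 9 (G.tail e) ≠ 0 → τ 9 (G.head e) ≠ 0))
    (fun i τ v => by simp only [Store.upd_ne _ _ (show 9 ≠ 31 by omega)]; exact id)
    ⟨hr, fun _ h => h, fun e he => absurd he (by omega)⟩ (by
      intro i τ hi hc hfr hI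
      rw [h.m] at hi
      have hin : HasInput G lam k R τ := h.congr fun a ha =>
        hfr a ((by decide : ∀ a < 4, a ∉ (forN 31 rankEdge).writes) a ha)
      have h7 : τ 7 = σ 7 := hfr 7 (by decide)
      have h8 : τ 8 = σ 8 := hfr 8 (by decide)
      obtain ⟨i1, i2, i3⟩ := hI
      obtain ⟨s1, s2, s3, s4⟩ := rankEdge_spec hin (e := ⟨i, hi⟩) hc (t := t)
        (by rw [h7, h8]; exact i1)
      rw [h7, h8] at s1
      rw [h7, h8] at s3 s4
      refine ⟨s1, fun w hw => s2 w (i2 w hw), fun e he heF => ?_⟩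
      rcases Nat.lt_succ_iff_lt_or_eq.mp he with he | he
      · obtain ⟨a1, a2⟩ := i3 e he heF
        exact ⟨fun b1 b2 => s2 _ (a1 b1 b2), fun b1 b2 => s2 _ (a2 b1 b2)⟩
      · obtain rfl : e = ⟨i, hi⟩ := Fin.ext he
        exact ⟨fun b1 b2 => s3 heF b1 (i2 _ b2), fun b1 b2 => s4 heF b1 (i2 _ b2)⟩)
  obtain ⟨k1, k2, k3⟩ := key
  refine ⟨k1, k2, ?_⟩
  rintro w y ⟨e, he, ⟨rfl, rfl, h3⟩ | ⟨rfl, rfl, h3⟩⟩ hy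
  · exact (k3 e (by rw [h.m]; exact e.2) he).1 h3 hy
  · exact (k3 e (by rw [h.m]; exact e.2) he).2 h3 hy

theorem rankProg_spec {σ : Store} (h : HasInput G lam k R σ) {t : Fin G.n} (ht : σ 14 0 = t) :
    G.PreRank (edgeSet G (σ 7)) (flowOf G (σ 8)) t (rankProg.ex σ 9) ∧
    G.RankClosed (edgeSet G (σ 7)) (flowOf G (σ 8)) (rankProg.ex σ 9) := by
  simp only [rankProg, ex_block_cons, ex_block_nil]
  have hz := forLt_rule (c := 30) (j := 1) (p := set 9 (var 30) (lit 0)) (σ := σ) (by decide)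
    (by rw [h.n, h.bound]; omega) (fun i τ => ∀ j < i, τ 9 j = 0)
    (fun i τ v => by simp only [Store.upd_ne _ _ (show 9 ≠ 30 by omega)]; exact id)
    (fun j hj => absurd hj (by omega)) (by
      intro i τ hi hc hfr hI j hj
      simp only [ex_set, Store.upd_self, eval_var, hc, eval_lit]
      by_cases hji : j = i
      · simp [hji]
      · rw [Function.update_of_ne hji]
        exact hI j (by omega))
  rw [h.n] at hz
  have hfr : ∀ a, a ≠ 9 → a ≠ 30 → (forLt 30 1 (set 9 (var 30) (lit 0))).ex σ a = σ a :=
    fun a h9 h30 => ex_frame (by simp [forLt, writes, h9, h30])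
  generalize (forLt 30 1 (set 9 (var 30) (lit 0))).ex σ = τ at hz hfr
  simp only [ex_set, eval_var, eval_lit]
  rw [hfr 14 (by omega) (by omega), ht]
  have hr : G.PreRank (edgeSet G (σ 7)) (flowOf G (σ 8)) t (τ.upd 9 t 1 9) := by
    have hne : ∀ w : Fin G.n, τ.upd 9 t 1 9 w ≠ 0 → w = t := fun w hw => by
      by_contra hwt
      rw [Store.upd_self, Function.update_of_ne (fun h => hwt (Fin.ext h))] at hw
      exact hw (hz w w.2)
    refine ⟨by simp [Store.upd_self], fun w hw hwt => absurd (hne w hw) hwt, fun w => ?_⟩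
    by_cases hw : τ.upd 9 t 1 9 w = 0
    · omega
    · rw [hne w hw]
      simp only [Store.upd_self, Function.update_self]
      exact Finset.card_pos.mpr ⟨t, by simp⟩
  have h' : HasInput G lam k R (τ.upd 9 t 1) :=
    (h.congr fun a ha => hfr a (by omega) (by omega)).upd (by omega) _ _
  have h7 : τ.upd 9 t 1 7 = σ 7 := by rw [Store.upd_ne _ _ (by omega), hfr 7 (by omega) (by omega)]
  have h8 : τ.upd 9 t 1 8 = σ 8 := by rw [Store.upd_ne _ _ (by omega), hfr 8 (by omega) (by omega)]
  generalize τ.upd 9 t 1 = τ' at hr h' h7 h8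
  have key := forN_rule (c := 30) (p := forLt 31 2 rankEdge) (σ := τ') (by decide)
    (fun i ρ => G.PreRank (edgeSet G (σ 7)) (flowOf G (σ 8)) t (ρ 9) ∧
      (G.RankClosed (edgeSet G (σ 7)) (flowOf G (σ 8)) (ρ 9) ∨ i ≤ G.rankCount (ρ 9)))
    (fun i τ v => by simp only [Store.upd_ne _ _ (show 9 ≠ 30 by omega)]; exact id)
    ⟨hr, Or.inr (by omega)⟩ (by
      rintro i ρ hi hc hfr' ⟨i1, i2⟩
      have hin : HasInput G lam k R ρ := h'.congr fun a ha =>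
        hfr' a ((by decide : ∀ a < 4, a ∉ (forN 30 (forLt 31 2 rankEdge)).writes) a ha)
      have e7 : ρ 7 = σ 7 := (hfr' 7 (by decide)).trans h7
      have e8 : ρ 8 = σ 8 := (hfr' 8 (by decide)).trans h8
      obtain ⟨s1, s2, s3⟩ := rankRound_spec hin (t := t) (by rw [e7, e8]; exact i1)
      rw [e7, e8] at s1 s3
      refine ⟨s1, ?_⟩
      -- A round either ranks a new vertex or shows that the ranking is closed. Since there are more
      -- rounds than vertices, it is closed at the end.
      by_cases hsup : ∀ w : Fin G.n, (forLt 31 2 rankEdge).ex ρ 9 w ≠ 0 → ρ 9 w ≠ 0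
      · exact Or.inl fun w y hwy hy => s3 w y hwy (hsup y hy)
      · refine Or.inr ?_
        rcases i2 with i2 | i2
        · exact absurd (s1.ne_zero_of_closed i2 (by rw [i1.target]; omega)) hsup
        · push Not at hsup
          obtain ⟨w, hw, hw'⟩ := hsup
          refine lt_of_le_of_lt i2 (Finset.card_lt_card (Finset.ssubset_iff_of_subset
            (Finset.monotone_filter_right _ fun w _ => s2 w) |>.mpr ⟨w, by simpa using hw, ?_⟩))
          simpa using hw')
  refine ⟨key.1, key.2.resolve_right fun hle => ?_⟩
  have := G.rankCount_le ((forN 30 (forLt 31 2 rankEdge)).ex τ' 9)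
  rw [h'.bound] at hle
  omega

end Algo

/-! ### Augmenting paths and maximum flows -/

namespace MGraph

variable {G : MGraph} {F : Finset (Fin G.m)} {φ : Fin G.m → ℤ} {s t c : Fin G.n} {val : ℤ}

theorem net_update (φ : Fin G.m → ℤ) (e : Fin G.m) (x : ℤ) (w : Fin G.n) :
    G.net (Function.update φ e (φ e + x)) w =
      G.net φ w + x * ((if G.tail e = w then 1 else 0) - (if G.head e = w then 1 else 0)) := by
  have : Function.update φ e (φ e + x) = fun e' => φ e' + if e' = e then x else 0 := by
    ext e'
    by_cases h : e' = e
    · subst h; simp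
    · simp [h]
  rw [this, net_add]
  congr 1
  simp [net]

/-- While a unit of flow is sent down from `s` along decreasing ranks, it has arrived at `c`. -/
structure IsAugmenting (G : MGraph) (F : Finset (Fin G.m)) (r : ℕ → ℕ) (s t : Fin G.n) (val : ℤ)
    (φ : Fin G.m → ℤ) (c : Fin G.n) : Prop where
  lo_le : ∀ e, G.lo ≤ φ e
  le_one : ∀ e, φ e ≤ 1
  eq_zero : ∀ e ∈ F, φ e = 0
  net_eq : ∀ w, G.net φ w = val * ((if w = s then 1 else 0) - (if w = t then 1 else 0)) +
    ((if w = s then 1 else 0) - (if w = c then 1 else 0))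
  ranked : r c ≠ 0
  -- Only residual arcs starting at rank at most `r c` are promised; those already passed by the
  -- augmentation may have vanished.
  desc : ∀ w : Fin G.n, r w ≠ 0 → r w ≤ r c → w ≠ t →
    ∃ y : Fin G.n, G.Res F φ w y ∧ r y ≠ 0 ∧ r y < r w

variable {r : ℕ → ℕ}

/-- Changing the flow on `e` can only affect arcs that join the ends of `e`. -/
theorem Res.update {w y : Fin G.n} (h : G.Res F φ w y) {e : Fin G.m} {x : ℤ}
    (h1 : G.tail e ≠ w ∧ G.head e ≠ w ∨ G.tail e ≠ y ∧ G.head e ≠ y) :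
    G.Res F (Function.update φ e x) w y := by
  obtain ⟨e', he', h⟩ := h
  have hne : e' ≠ e := by
    rintro rfl
    rcases h with ⟨rfl, rfl, -⟩ | ⟨rfl, rfl, -⟩ <;> simp at h1
  refine ⟨e', he', ?_⟩
  rwa [Function.update_of_ne hne]

/-- The residual arcs still needed lead to vertices of rank below that of `y`, hence to neither end
of `e`, and so survive the change of flow. -/
theorem IsAugmenting.step (h : G.IsAugmenting F r s t val φ c) {e : Fin G.m} (heF : e ∉ F)
    {x : ℤ} {y : Fin G.n} (hx : (x = 1 ∧ G.tail e = c ∧ G.head e = y ∧ φ e < 1) ∨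
      (x = -1 ∧ G.head e = c ∧ G.tail e = y ∧ G.lo < φ e)) (hy : r y ≠ 0) (hyc : r y < r c) :
    G.IsAugmenting F r s t val (Function.update φ e (φ e + x)) y := by
  have hl := h.lo_le e
  have hu := h.le_one e
  refine ⟨fun e' => ?_, fun e' => ?_, fun e' he' => ?_, fun w => ?_, hy, fun w hw hwy hwt => ?_⟩
  · by_cases he : e' = e
    · subst he
      rcases hx with ⟨rfl, -⟩ | ⟨rfl, -, -, hx⟩ <;> simp <;> omega
    · rw [Function.update_of_ne he]; exact h.lo_le e'
  · by_cases he : e' = e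
    · subst he
      rcases hx with ⟨rfl, -, -, hx⟩ | ⟨rfl, -⟩ <;> simp <;> omega
    · rw [Function.update_of_ne he]; exact h.le_one e'
  · have : e' ≠ e := by rintro rfl; exact heF he'
    rw [Function.update_of_ne this]
    exact h.eq_zero e' he'
  · rw [net_update, h.net_eq w]
    rcases hx with ⟨rfl, rfl, rfl, -⟩ | ⟨rfl, rfl, rfl, -⟩ <;>
      simp only [eq_comm (a := w)] <;> ring
  · obtain ⟨z, h1, h2, h3⟩ := h.desc w hw (by omega) hwt
    refine ⟨z, h1.update ?_, h2, h3⟩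
    have hwc : w ≠ c := fun h => by rw [h] at hwy; omega
    have hzc : z ≠ c := fun h => by rw [h] at h3; omega
    have hzy : z ≠ y := fun h => by rw [h] at h3; omega
    right
    rcases hx with ⟨-, rfl, rfl, -⟩ | ⟨-, rfl, rfl, -⟩
    · exact ⟨hzc.symm, hzy.symm⟩
    · exact ⟨hzy.symm, hzc.symm⟩

end MGraph

namespace Algo

open BProg RExpr MGraph

variable {G : MGraph} {lam k : ℕ} {R : Finset (Fin G.m)}

/-- The condition that one unit of flow can be sent along the edge in variable 33 from the current
vertex `x` to the vertex `y`, which has a smaller rank. -/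
def canPush (b x y : RExpr) : RExpr :=
  .and (.not (get 7 (var 33))) (.and (.eq (var 10) x) (.and b (.and (get 9 y)
    (.lt (get 9 y) (get 9 x)))))

/-- Sends a unit of flow along the edge in variable 33, if it leads to a vertex of smaller rank. -/
def augEdge : BProg :=
  ite (canPush (.lt (get 8 (var 33)) (lit 2)) (tl 33) (hd 33))
    (block [set 8 (var 33) (add (get 8 (var 33)) (lit 1)), assign 10 (hd 33)])
    (when (canPush (.lt dirE (get 8 (var 33))) (hd 33) (tl 33))
      (block [set 8 (var 33) (sub (get 8 (var 33)) (lit 1)), assign 10 (tl 33)]))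

/-- Augments the flow in array 8 along a path of decreasing ranks that starts in the vertex in
variable 13. -/
def augProg : BProg := block [assign 10 (var 13), forN 32 (forLt 33 2 augEdge)]

theorem augEdge_spec {τ : Store} (h : HasInput G lam k R τ) {e : Fin G.m} (he : τ 33 0 = e)
    {s t c : Fin G.n} {val : ℤ} (hc : τ 10 0 = c)
    (hA : G.IsAugmenting (edgeSet G (τ 7)) (τ 9) s t val (flowOf G (τ 8)) c) :
    ∃ c' : Fin G.n, augEdge.ex τ 10 0 = c' ∧
      G.IsAugmenting (edgeSet G (τ 7)) (τ 9) s t val (flowOf G (augEdge.ex τ 8)) c' ∧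
      (τ 9 c' < τ 9 c ∨ augEdge.ex τ 8 = τ 8 ∧ c' = c ∧ ∀ y : Fin G.n, τ 9 y ≠ 0 → τ 9 y < τ 9 c →
        e ∉ edgeSet G (τ 7) → ¬ (G.tail e = c ∧ G.head e = y ∧ flowOf G (τ 8) e < 1) ∧
        ¬ (G.head e = c ∧ G.tail e = y ∧ G.lo < flowOf G (τ 8) e)) := by
  unfold augEdge
  by_cases h1 : (canPush (.lt (get 8 (var 33)) (lit 2)) (tl 33) (hd 33)).Holds τ
  · rw [ex_ite_of h1]
    simp only [canPush, holds_and, holds_not, holds_eq, holds_lt, holds_get, eval_get, eval_var,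
      eval_lit, eval_tl, eval_hd, he, h.tail, h.head, hc] at h1
    obtain ⟨a1, a2, a3, a4, a5⟩ := h1
    have htc : G.tail e = c := Fin.ext a2.symm
    refine ⟨G.head e, ?_, ?_, Or.inl (htc ▸ a5)⟩
    · simp [Store.upd_ne, Store.upd_self, he, h.head]
    · have := hA.step (e := e) (by simpa using a1)
        (Or.inl ⟨rfl, htc, rfl, flowOf_lt_one.mpr a3⟩) a4 (htc ▸ a5)
      convert this using 1
      simp only [ex_block_cons, ex_block_nil, ex_set, ex_assign,
        Store.upd_ne _ _ (show 8 ≠ 10 by omega), Store.upd_self, eval_var, he, flowOf_update,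
        eval_add, eval_get, eval_lit]
      congr 1
      simp [flowOf]
  rw [ex_ite_of_not h1]
  by_cases h2 : (canPush (.lt dirE (get 8 (var 33))) (hd 33) (tl 33)).Holds τ
  · rw [ex_when_of h2]
    simp only [canPush, holds_and, holds_not, holds_eq, holds_lt, holds_get, eval_get, eval_var,
      eval_lit, eval_tl, eval_hd, he, h.tail, h.head, hc, dirE, h.dir] at h2
    obtain ⟨a1, a2, a3, a4, a5⟩ := h2
    have htc : G.head e = c := Fin.ext a2.symm
    refine ⟨G.tail e, ?_, ?_, Or.inl (htc ▸ a5)⟩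
    · simp [Store.upd_ne, Store.upd_self, he, h.tail]
    · have := hA.step (e := e) (by simpa using a1)
        (Or.inr ⟨rfl, htc, rfl, lo_lt_flowOf.mpr a3⟩) a4 (htc ▸ a5)
      convert this using 1
      simp only [ex_block_cons, ex_block_nil, ex_set, ex_assign,
        Store.upd_ne _ _ (show 8 ≠ 10 by omega), Store.upd_self, eval_var, he, flowOf_update,
        eval_sub, eval_get, eval_lit]
      congr 1
      simp only [flowOf]
      omega
  rw [ex_when_of_not h2]
  refine ⟨c, hc, hA, Or.inr ⟨rfl, rfl, fun y hy hyc heF => ⟨?_, ?_⟩⟩⟩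
  · rintro ⟨b1, b2, b3⟩
    refine h1 ?_
    simp only [canPush, holds_and, holds_not, holds_eq, holds_lt, holds_get, eval_get, eval_var,
      eval_lit, eval_tl, eval_hd, he, h.tail, h.head, hc]
    exact ⟨by simpa using heF, by rw [b1], flowOf_lt_one.mp b3, b2 ▸ hy, b1 ▸ b2 ▸ hyc⟩
  · rintro ⟨b1, b2, b3⟩
    refine h2 ?_
    simp only [canPush, holds_and, holds_not, holds_eq, holds_lt, holds_get, eval_get, eval_var,
      eval_lit, eval_tl, eval_hd, he, h.tail, h.head, hc, dirE, h.dir]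
    exact ⟨by simpa using heF, by rw [b1], lo_lt_flowOf.mp b3, b2 ▸ hy, b1 ▸ b2 ▸ hyc⟩

/-- The invariant of the scan is that the current vertex has moved down, or that nothing has changed
and no edge seen so far was usable. A full scan without a move contradicts `desc`. -/
theorem augRound_spec {σ : Store} (h : HasInput G lam k R σ)
    {s t c : Fin G.n} {val : ℤ} (hc : σ 10 0 = c)
    (hA : G.IsAugmenting (edgeSet G (σ 7)) (σ 9) s t val (flowOf G (σ 8)) c) :
    ∃ c' : Fin G.n, (forLt 33 2 augEdge).ex σ 10 0 = c' ∧
      G.IsAugmenting (edgeSet G (σ 7)) (σ 9) s t val (flowOf G ((forLt 33 2 augEdge).ex σ 8)) c' ∧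
      σ 9 c' ≤ σ 9 c ∧ (c ≠ t → σ 9 c' < σ 9 c) := by
  have key := forLt_rule (c := 33) (j := 2) (p := augEdge) (σ := σ) (by decide)
    (by rw [h.m, h.bound]; omega)
    (fun i τ => ∃ c' : Fin G.n, τ 10 0 = c' ∧
      G.IsAugmenting (edgeSet G (σ 7)) (σ 9) s t val (flowOf G (τ 8)) c' ∧
      (σ 9 c' < σ 9 c ∨ τ 8 = σ 8 ∧ c' = c ∧ ∀ y : Fin G.n, σ 9 y ≠ 0 → σ 9 y < σ 9 c →
        ∀ e : Fin G.m, e < i → e ∉ edgeSet G (σ 7) →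
        ¬ (G.tail e = c ∧ G.head e = y ∧ flowOf G (σ 8) e < 1) ∧
        ¬ (G.head e = c ∧ G.tail e = y ∧ G.lo < flowOf G (σ 8) e)))
    (fun i τ v => by
      simp only [Store.upd_ne _ _ (show 10 ≠ 33 by omega), Store.upd_ne _ _ (show 8 ≠ 33 by omega)]
      exact id)
    ⟨c, hc, hA, Or.inr ⟨rfl, rfl, fun y _ _ e he => absurd he (by omega)⟩⟩ (by
      rintro i τ hi hcnt hfr ⟨c', i1, i2, i3⟩
      rw [h.m] at hi
      have hin : HasInput G lam k R τ := h.congr fun a ha =>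
        hfr a ((by decide : ∀ a < 4, a ∉ (forN 33 augEdge).writes) a ha)
      have h7 : τ 7 = σ 7 := hfr 7 (by decide)
      have h9 : τ 9 = σ 9 := hfr 9 (by decide)
      obtain ⟨d, s1, s2, s3⟩ := augEdge_spec hin (e := ⟨i, hi⟩) hcnt i1 (by rw [h7, h9]; exact i2)
      rw [h7, h9] at s2 s3
      refine ⟨d, s1, s2, ?_⟩
      rcases i3 with i3 | ⟨i3, rfl, i4⟩
      · left
        rcases s3 with s3 | ⟨-, rfl, -⟩
        · exact s3.trans i3
        · exact i3
      · rcases s3 with s3 | ⟨s3, rfl, s4⟩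
        · exact Or.inl s3
        · refine Or.inr ⟨s3.trans i3, rfl, fun y hy hyc e he heF => ?_⟩
          rcases Nat.lt_succ_iff_lt_or_eq.mp he with he | he
          · exact i4 y hy hyc e he heF
          · obtain rfl : e = ⟨i, hi⟩ := Fin.ext he
            rw [← i3]
            exact s4 y hy hyc heF)
  obtain ⟨c', k1, k2, k3⟩ := key
  refine ⟨c', k1, k2, ?_, fun hct => ?_⟩
  · rcases k3 with k3 | ⟨-, rfl, -⟩
    · exact k3.le
    · exact le_rfl
  · rcases k3 with k3 | ⟨-, rfl, k3⟩
    · exact k3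
    · obtain ⟨y, ⟨e, he, hor⟩, y2, y3⟩ := hA.desc c' hA.ranked le_rfl hct
      have := k3 y y2 y3 e (by rw [h.m]; exact e.2) he
      tauto

/-- The effect of augmenting a flow. -/
theorem augProg_spec {σ : Store} (h : HasInput G lam k R σ) {s t : Fin G.n} {val : ℤ}
    (hs : σ 13 0 = s) (hφ : G.IsFlow (edgeSet G (σ 7)) (flowOf G (σ 8)) s t val)
    (hr : G.PreRank (edgeSet G (σ 7)) (flowOf G (σ 8)) t (σ 9)) (hrs : σ 9 s ≠ 0) :
    G.IsFlow (edgeSet G (σ 7)) (flowOf G (augProg.ex σ 8)) s t (val + 1) := by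
  simp only [augProg, ex_block_cons, ex_block_nil, ex_assign, eval_var, hs]
  have h' : HasInput G lam k R (σ.upd 10 0 s) := h.upd (by omega) _ _
  have e7 : σ.upd 10 0 s 7 = σ 7 := Store.upd_ne _ _ (by omega)
  have e8 : σ.upd 10 0 s 8 = σ 8 := Store.upd_ne _ _ (by omega)
  have e9 : σ.upd 10 0 s 9 = σ 9 := Store.upd_ne _ _ (by omega)
  have e10 : σ.upd 10 0 s 10 0 = s := by simp [Store.upd_self]
  generalize σ.upd 10 0 s = τ at h' e7 e8 e9 e10
  have key := forN_rule (c := 32) (p := forLt 33 2 augEdge) (σ := τ) (by decide)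
    (fun i ρ => ∃ c : Fin G.n, ρ 10 0 = c ∧
      G.IsAugmenting (edgeSet G (σ 7)) (σ 9) s t val (flowOf G (ρ 8)) c ∧
      (c = t ∨ σ 9 c + i ≤ σ 9 s))
    (fun i τ v => by
      simp only [Store.upd_ne _ _ (show 10 ≠ 32 by omega), Store.upd_ne _ _ (show 8 ≠ 32 by omega)]
      exact id)
    ⟨s, e10, by
      rw [e8]
      exact ⟨hφ.lo_le, hφ.le_one, hφ.eq_zero, fun w => by rw [hφ.net_eq]; ring, hrs,
        fun w hw _ hwt => hr.desc w hw hwt⟩, Or.inr le_rfl⟩ (by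
      rintro i ρ hi hcnt hfr ⟨c, i1, i2, i3⟩
      have hin : HasInput G lam k R ρ := h'.congr fun a ha =>
        hfr a ((by decide : ∀ a < 4, a ∉ (forN 32 (forLt 33 2 augEdge)).writes) a ha)
      have h7 : ρ 7 = σ 7 := (hfr 7 (by decide)).trans e7
      have h9 : ρ 9 = σ 9 := (hfr 9 (by decide)).trans e9
      obtain ⟨d, s1, s2, s3, s4⟩ := augRound_spec hin i1 (by rw [h7, h9]; exact i2)
      rw [h7, h9] at s2
      rw [h9] at s3 s4
      refine ⟨d, s1, s2, ?_⟩
      by_cases hct : c = t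
      -- The target has rank 1, so a vertex of no larger rank other than the target would have a
      -- successor of rank 0.
      · left
        by_contra hdt
        obtain ⟨y, -, y2, y3⟩ := hr.desc d s2.ranked hdt
        rw [hct, hr.target] at s3
        omega
      · right
        have := s4 hct
        have := i3.resolve_left hct
        omega)
  obtain ⟨c, -, k2, k3⟩ := key
  have hct : c = t := k3.resolve_right fun hle => by
    have := hr.le_count s
    have := G.rankCount_le (σ 9)
    rw [h'.bound] at hle
    omega
  subst hct
  exact ⟨k2.lo_le, k2.le_one, k2.eq_zero, fun w => by rw [k2.net_eq]; ring⟩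

/-- Computes a flow, in array 8, from the vertex in variable 13 to the one in variable 14. Its value
is in variable 11. -/
def flowProg : BProg := block [
  forLt 34 2 (set 8 (var 34) (lit 1)),
  assign 11 (lit 0),
  forN 34 (when (.lt (var 11) (get 0 (lit 3))) (block [
    rankProg,
    when (get 9 (var 13)) (block [augProg, assign 11 (add (var 11) (lit 1))])]))]

theorem cut_le (F : Finset (Fin G.m)) (S : Set (Fin G.n)) : G.cut F S ≤ G.m :=
  (Finset.card_le_univ _).trans (by simp)

/-- The body of the loop of `flowProg`. -/
theorem flowRound_spec {σ : Store} (h : HasInput G lam k R σ) {s t : Fin G.n}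
    (hs : σ 13 0 = s) (ht : σ 14 0 = t)
    (hφ : G.IsFlow (edgeSet G (σ 7)) (flowOf G (σ 8)) s t (σ 11 0)) :
    let τ := (block [rankProg,
      when (get 9 (var 13)) (block [augProg, assign 11 (add (var 11) (lit 1))])]).ex σ
    G.IsFlow (edgeSet G (σ 7)) (flowOf G (τ 8)) s t (τ 11 0) ∧
      (τ 11 0 = σ 11 0 + 1 ∨ τ 11 0 = σ 11 0 ∧ ∃ S, s ∈ S ∧ t ∉ S ∧
        G.cut (edgeSet G (σ 7)) S = σ 11 0) := by
  intro τ
  obtain ⟨r1, r2⟩ := rankProg_spec h ht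
  have hfr : ∀ a, a ∉ rankProg.writes → rankProg.ex σ a = σ a := fun a ha => ex_frame ha
  simp only [τ, ex_block_cons, ex_block_nil]
  have h' : HasInput G lam k R (rankProg.ex σ) := h.ex (by decide)
  have e7 := hfr 7 (by decide)
  have e8 := hfr 8 (by decide)
  have e11 := hfr 11 (by decide)
  have e13 := hfr 13 (by decide)
  generalize rankProg.ex σ = ρ at *
  by_cases hb : (get 9 (var 13)).Holds ρ
  · rw [ex_when_of hb]
    simp only [holds_get, eval_var, e13, hs] at hb
    have := augProg_spec h' (s := s) (t := t) (val := σ 11 0) (by rw [e13, hs])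
      (by rw [e7, e8]; exact hφ) (by rw [e7, e8]; exact r1) hb
    rw [e7] at this
    have e11' : augProg.ex ρ 11 = σ 11 := (ex_frame (by decide)).trans e11
    simp only [ex_block_cons, ex_block_nil, ex_assign, Store.upd_self, eval_add, eval_var, eval_lit,
      e11', Function.update_self, Store.upd_ne _ _ (show 8 ≠ 11 by omega)]
    exact ⟨by exact_mod_cast this, Or.inl trivial⟩
  · rw [ex_when_of_not hb, e8, e11]
    refine ⟨hφ, Or.inr ⟨rfl, {w | ρ 9 w = 0}, ?_, ?_, ?_⟩⟩
    · simpa [e13, hs] using hb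
    · simp [r1.target]
    · have hcl := (hφ.netCut_eq_cut_iff {w : Fin G.n | ρ 9 w = 0}).mpr (by
        intro u w hu hw hres
        exact r2 u w hres hw hu)
      rw [netCut_eq hφ.net_eq, if_pos (by simpa [e13, hs] using hb),
        if_neg (by simp [r1.target])] at hcl
      simp only [sub_zero, mul_one] at hcl
      exact_mod_cast hcl.symm

/-- The flow is augmented only up to value `lam`. If it falls short, the vertices without a rank in
the failed search form a cut as small as the flow. -/
theorem flowProg_spec {σ : Store} (h : HasInput G lam k R σ) {s t : Fin G.n} (hst : s ≠ t)
    (hs : σ 13 0 = s) (ht : σ 14 0 = t) :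
    G.IsFlow (edgeSet G (σ 7)) (flowOf G (flowProg.ex σ 8)) s t (flowProg.ex σ 11 0) ∧
      (flowProg.ex σ 11 0 = lam ∨ flowProg.ex σ 11 0 < lam ∧ ∃ S, s ∈ S ∧ t ∉ S ∧
        G.cut (edgeSet G (σ 7)) S < lam) := by
  simp only [flowProg, ex_block_cons, ex_block_nil, ex_assign, eval_lit]
  have hz := forLt_rule (c := 34) (j := 2) (p := set 8 (var 34) (lit 1)) (σ := σ) (by decide)
    (by rw [h.m, h.bound]; omega) (fun i τ => ∀ j < i, τ 8 j = 1)
    (fun i τ v => by simp only [Store.upd_ne _ _ (show 8 ≠ 34 by omega)]; exact id)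
    (fun j hj => absurd hj (by omega)) (by
      intro i τ hi hc hfr hI j hj
      simp only [ex_set, Store.upd_self, eval_var, hc, eval_lit]
      by_cases hji : j = i
      · simp [hji]
      · rw [Function.update_of_ne hji]
        exact hI j (by omega))
  rw [h.m] at hz
  have hfr : ∀ a, a ≠ 8 → a ≠ 34 → (forLt 34 2 (set 8 (var 34) (lit 1))).ex σ a = σ a :=
    fun a h9 h30 => ex_frame (by simp [forLt, writes, h9, h30])
  generalize (forLt 34 2 (set 8 (var 34) (lit 1))).ex σ = τ at hz hfr
  have h' : HasInput G lam k R (τ.upd 11 0 0) :=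
    (h.congr fun a ha => hfr a (by omega) (by omega)).upd (by omega) _ _
  have e7 : τ.upd 11 0 0 7 = σ 7 := by
    rw [Store.upd_ne _ _ (by omega), hfr 7 (by omega) (by omega)]
  have e13 : τ.upd 11 0 0 13 = σ 13 := by
    rw [Store.upd_ne _ _ (by omega), hfr 13 (by omega) (by omega)]
  have e14 : τ.upd 11 0 0 14 = σ 14 := by
    rw [Store.upd_ne _ _ (by omega), hfr 14 (by omega) (by omega)]
  have e8 : flowOf G (τ.upd 11 0 0 8) = 0 := by
    ext e
    rw [Store.upd_ne _ _ (by omega)]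
    simp [flowOf, hz e e.2]
  have e11 : τ.upd 11 0 0 11 0 = 0 := by simp [Store.upd_self]
  generalize τ.upd 11 0 0 = τ' at h' e7 e8 e11 e13 e14
  have key := forN_rule (c := 34) (p := when (.lt (var 11) (get 0 (lit 3))) (block [
    rankProg,
    when (get 9 (var 13)) (block [augProg, assign 11 (add (var 11) (lit 1))])])) (σ := τ')
    (by decide)
    (fun i ρ => G.IsFlow (edgeSet G (σ 7)) (flowOf G (ρ 8)) s t (ρ 11 0) ∧ ρ 11 0 ≤ lam ∧
      (ρ 11 0 = lam ∨ ρ 11 0 = i ∨ ∃ S, s ∈ S ∧ t ∉ S ∧ G.cut (edgeSet G (σ 7)) S = ρ 11 0))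
    (fun i τ v => by
      simp only [Store.upd_ne _ _ (show 8 ≠ 34 by omega), Store.upd_ne _ _ (show 11 ≠ 34 by omega)]
      exact id)
    ⟨by
      rw [e8, e11]
      refine ⟨fun e => G.lo_nonpos, fun e => by simp, fun e _ => rfl, fun w => by simp [net]⟩,
      by omega, by omega⟩ (by
      rintro i ρ hi hcnt hfr' ⟨i1, i2, i3⟩
      have hin : HasInput G lam k R ρ := h'.congr fun a ha => hfr' a ((by decide : ∀ a < 4, a ∉
        (forN 34 (when (.lt (var 11) (get 0 (lit 3))) (block [rankProg,
          when (get 9 (var 13)) (block [augProg, assign 11 (add (var 11) (lit 1))])]))).writes) a ha)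
      have h7 : ρ 7 = σ 7 := (hfr' 7 (by decide)).trans e7
      have h13 : ρ 13 = σ 13 := (hfr' 13 (by decide)).trans e13
      have h14 : ρ 14 = σ 14 := (hfr' 14 (by decide)).trans e14
      by_cases hb : (RExpr.lt (var 11) (get 0 (lit 3))).Holds ρ
      · rw [ex_when_of hb]
        simp only [holds_lt, eval_var, eval_get, eval_lit, hin.lam_eq] at hb
        obtain ⟨s1, s2⟩ := flowRound_spec hin (by rw [h13, hs]) (by rw [h14, ht])
          (by rw [h7]; exact i1)
        rw [h7] at s1 s2
        refine ⟨s1, ?_⟩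
        rcases s2 with s2 | ⟨s2, s3⟩
        · rw [s2] at s1 ⊢
          refine ⟨hb, ?_⟩
          rcases i3 with i3 | i3 | ⟨S, hS, hS', i3⟩
          · omega
          · omega
          -- A cut equal to the old value rules out an augmentation.
          · have := s1.le_cut hS hS'
            omega
        · rw [s2]
          exact ⟨i2, Or.inr (Or.inr s3)⟩
      · rw [ex_when_of_not hb]
        simp only [holds_lt, eval_var, eval_get, eval_lit, hin.lam_eq] at hb
        exact ⟨i1, i2, Or.inl (by omega)⟩)
  obtain ⟨k1, k2, k3⟩ := key
  refine ⟨k1, ?_⟩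
  rcases k3 with k3 | k3 | ⟨S, hS, hS', k3⟩
  · exact Or.inl k3
  -- More than `m` successful augmentations are impossible, because the source has at most `m`
  -- edges.
  · exfalso
    have h1 := k1.le_cut (S := {s}) rfl hst.symm
    have h2 := cut_le (edgeSet G (σ 7)) ({s} : Set (Fin G.n))
    rw [h'.bound] at k3
    omega
  · rcases k2.eq_or_lt with k2 | k2
    · exact Or.inl k2
    · exact Or.inr ⟨k2, S, hS, hS', by omega⟩

/-! ### Testing edge-connectivity. -/

/-- Sets variable 12 to a nonzero value if and only if the graph without the edges in array 7 is
`lam`-edge-connected. -/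
def connProg : BProg := block [
  assign 12 (lit 1),
  forLt 35 1 (forLt 36 1 (ite (.eq (var 35) (var 36)) skip (block [
    assign 13 (var 35), assign 14 (var 36), flowProg,
    when (.lt (var 11) (get 0 (lit 3))) (assign 12 (lit 0))])))]

/-- The body of the loops of `connProg`. -/
theorem connPair_spec {σ : Store} (h : HasInput G lam k R σ) {s t : Fin G.n}
    (hs : σ 35 0 = s) (ht : σ 36 0 = t) :
    (ite (.eq (var 35) (var 36)) skip (block [
      assign 13 (var 35), assign 14 (var 36), flowProg,
      when (.lt (var 11) (get 0 (lit 3))) (assign 12 (lit 0))])).ex σ 12 0 ≠ 0 ↔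
    σ 12 0 ≠ 0 ∧ ∀ S, s ∈ S → t ∉ S → lam ≤ G.cut (edgeSet G (σ 7)) S := by
  by_cases hb : (RExpr.eq (var 35) (var 36)).Holds σ
  · rw [ex_ite_of hb]
    simp only [holds_eq, eval_var, hs, ht] at hb
    simp only [Fin.ext hb]
    exact ⟨fun h => ⟨h, fun S h1 h2 => absurd h1 h2⟩, fun h => h.1⟩
  rw [ex_ite_of_not hb]
  simp only [holds_eq, eval_var, hs, ht] at hb
  simp only [ex_block_cons, ex_block_nil, ex_assign, eval_var, hs,
    Store.upd_ne _ _ (show 36 ≠ 13 by omega), ht]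
  have h' : HasInput G lam k R ((σ.upd 13 0 s).upd 14 0 t) :=
    (h.upd (by omega) _ _).upd (by omega) _ _
  have e7 : (σ.upd 13 0 s).upd 14 0 t 7 = σ 7 := by simp [Store.upd_ne]
  have e12 : (σ.upd 13 0 s).upd 14 0 t 12 = σ 12 := by simp [Store.upd_ne]
  have e13 : (σ.upd 13 0 s).upd 14 0 t 13 0 = s := by simp [Store.upd_ne, Store.upd_self]
  have e14 : (σ.upd 13 0 s).upd 14 0 t 14 0 = t := by simp [Store.upd_self]
  generalize (σ.upd 13 0 s).upd 14 0 t = τ at *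
  obtain ⟨f1, f2⟩ := flowProg_spec h' (fun h => hb (by rw [h])) e13 e14
  rw [e7] at f1 f2
  have h'' : HasInput G lam k R (flowProg.ex τ) := h'.ex (by decide)
  have e12' : flowProg.ex τ 12 = σ 12 := (ex_frame (by decide)).trans e12
  by_cases hc : (RExpr.lt (var 11) (get 0 (lit 3))).Holds (flowProg.ex τ)
  · rw [ex_when_of hc]
    simp only [holds_lt, eval_var, eval_get, eval_lit, h''.lam_eq] at hc
    obtain ⟨-, S, hS, hS', hlt⟩ := f2.resolve_left (by omega)
    simp only [ex_assign, Store.upd_self, eval_lit, Function.update_self]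
    exact ⟨fun h => absurd rfl h, fun h => absurd (h.2 S hS hS') (by omega)⟩
  · rw [ex_when_of_not hc, e12']
    simp only [holds_lt, eval_var, eval_get, eval_lit, h''.lam_eq] at hc
    refine ⟨fun h => ⟨h, fun S hS hS' => ?_⟩, fun h => h.1⟩
    have := f1.le_cut hS hS'
    omega

/-- By the cut criterion, it suffices to examine all ordered pairs of vertices: a flow of value
`lam` certifies a pair and a small cut refutes it. -/
theorem connProg_spec {σ : Store} (h : HasInput G lam k R σ) :
    connProg.ex σ 12 0 ≠ 0 ↔ G.EdgeConnectedWithout lam (edgeSet G (σ 7)) := by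
  simp only [connProg, ex_block_cons, ex_block_nil, ex_assign, eval_lit]
  have h' : HasInput G lam k R (σ.upd 12 0 1) := h.upd (by omega) _ _
  have e7 : σ.upd 12 0 1 7 = σ 7 := Store.upd_ne _ _ (by omega)
  have e12 : σ.upd 12 0 1 12 0 = 1 := by simp [Store.upd_self]
  generalize σ.upd 12 0 1 = τ at *
  have key := forLt_rule (c := 35) (j := 1) (p := forLt 36 1 (ite (.eq (var 35) (var 36)) skip
      (block [assign 13 (var 35), assign 14 (var 36), flowProg,
        when (.lt (var 11) (get 0 (lit 3))) (assign 12 (lit 0))]))) (σ := τ) (by decide)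
    (by rw [h'.n, h'.bound]; omega)
    (fun i ρ => ρ 12 0 ≠ 0 ↔ ∀ s t : Fin G.n, s < i → ∀ S, s ∈ S → t ∉ S →
      lam ≤ G.cut (edgeSet G (σ 7)) S)
    (fun i τ v => by simp only [Store.upd_ne _ _ (show 12 ≠ 35 by omega)]; exact id)
    (by rw [e12]; simp) (by
      intro i ρ hi hcnt hfr hI
      rw [h'.n] at hi
      have hin : HasInput G lam k R ρ := h'.congr fun a ha => hfr a ((by decide : ∀ a < 4, a ∉
        (forN 35 (forLt 36 1 (ite (.eq (var 35) (var 36)) skip (block [assign 13 (var 35),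
          assign 14 (var 36), flowProg,
          when (.lt (var 11) (get 0 (lit 3))) (assign 12 (lit 0))])))).writes) a ha)
      have h7 : ρ 7 = σ 7 := (hfr 7 (by decide)).trans e7
      have inner := forLt_rule (c := 36) (j := 1) (p := ite (.eq (var 35) (var 36)) skip
          (block [assign 13 (var 35), assign 14 (var 36), flowProg,
            when (.lt (var 11) (get 0 (lit 3))) (assign 12 (lit 0))])) (σ := ρ) (by decide)
        (by rw [hin.n, hin.bound]; omega)
        (fun j ρ' => ρ' 12 0 ≠ 0 ↔ ρ 12 0 ≠ 0 ∧ ∀ t : Fin G.n, t < j → ∀ S, ⟨i, hi⟩ ∈ S → t ∉ S →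
          lam ≤ G.cut (edgeSet G (σ 7)) S)
        (fun i τ v => by simp only [Store.upd_ne _ _ (show 12 ≠ 36 by omega)]; exact id)
        (by simp) (by
          intro j ρ' hj hcnt' hfr' hJ
          rw [hin.n] at hj
          have hin' : HasInput G lam k R ρ' := hin.congr fun a ha => hfr' a ((by decide : ∀ a < 4,
            a ∉ (forN 36 (ite (.eq (var 35) (var 36)) skip (block [assign 13 (var 35),
              assign 14 (var 36), flowProg,
              when (.lt (var 11) (get 0 (lit 3))) (assign 12 (lit 0))]))).writes) a ha)
          have h7' : ρ' 7 = σ 7 := (hfr' 7 (by decide)).trans h7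
          have h35 : ρ' 35 0 = i := by rw [hfr' 35 (by decide), hcnt]
          rw [connPair_spec hin' (s := ⟨i, hi⟩) (t := ⟨j, hj⟩) h35 hcnt', hJ, h7', and_assoc]
          refine and_congr_right fun _ => ⟨fun H t ht => ?_, fun H => ⟨fun t ht => H t (by omega),
            H ⟨j, hj⟩ (Nat.lt_succ_self j)⟩⟩
          rcases Nat.lt_succ_iff_lt_or_eq.mp ht with ht | ht
          · exact H.1 t ht
          · obtain rfl : t = ⟨j, hj⟩ := Fin.ext ht
            exact H.2)
      rw [hin.n] at inner
      rw [inner, hI]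
      refine ⟨fun H s t hs => ?_, fun H => ⟨fun s t hs => H s t (by omega),
        fun t _ => H ⟨i, hi⟩ t (Nat.lt_succ_self i)⟩⟩
      rcases Nat.lt_succ_iff_lt_or_eq.mp hs with hs | hs
      · exact H.1 s t hs
      · obtain rfl : s = ⟨i, hi⟩ := Fin.ext hs
        exact H.2 t t.2)
  rw [h'.n] at key
  rw [key, edgeConnectedWithout_iff]
  exact ⟨fun H S u v hu hv => H u v u.2 S hu hv, fun H s t _ S hs ht => H S s t hs ht⟩

end Algo

/-! ### Decomposing a flow into trails -/

namespace MGraph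

variable {G : MGraph} {H : Finset (Fin G.m)} {φ : Fin G.m → ℤ} {s t cur : Fin G.n} {lam c pc : ℕ}
  {lab pos : ℕ → ℕ}

/-- The edges with label `j`. -/
def labelled (G : MGraph) (lab : ℕ → ℕ) (j : ℕ) : Finset (Fin G.m) :=
  Finset.univ.filter fun e => lab e = j

@[simp] theorem mem_labelled {j : ℕ} {e : Fin G.m} : e ∈ G.labelled lab j ↔ lab e = j := by
  simp [labelled]

/-- The flow on the edges with label `j`. -/
def labelFlow (G : MGraph) (φ : Fin G.m → ℤ) (lab : ℕ → ℕ) (j : ℕ) : Fin G.m → ℤ :=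
  fun e => if e ∈ G.labelled lab j then φ e else 0

/-- The number of edges with a label. -/
def labelCount (G : MGraph) (lab : ℕ → ℕ) : ℕ :=
  (Finset.univ.filter fun e : Fin G.m => lab e ≠ 0).card

/-- In the decomposition of a flow, trails with labels `1, …, c` are complete and the trail with
label `c + 1` has arrived at `cur`. -/
structure IsLabelling (G : MGraph) (H : Finset (Fin G.m)) (φ : Fin G.m → ℤ) (s t : Fin G.n)
    (lam : ℕ) (lab pos : ℕ → ℕ) (pc c : ℕ) (cur : Fin G.n) : Prop where
  done : ∀ j < c, G.IsTrail H φ s t (G.labelled lab (j + 1)) fun e => pos e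
  le : ∀ e : Fin G.m, lab e ≤ c + 1
  ne_zero : ∀ e : Fin G.m, lab e ≠ 0 → φ e ≠ 0
  pc_le : pc ≤ G.labelCount lab
  pos_lt : ∀ e : Fin G.m, lab e ≠ 0 → pos e < pc
  pos_inj : ∀ e e' : Fin G.m, lab e ≠ 0 → lab e' ≠ 0 → pos e = pos e' → e = e'
  net_cur : ∀ w, G.net (G.labelFlow φ lab (c + 1)) w =
    (if w = s then 1 else 0) - (if w = cur then 1 else 0)
  -- The unlabelled edges carry the remaining `lam - c` units, less the part that the unfinished
  -- trail has used.
  net_rest : ∀ w, G.net (G.labelFlow φ lab 0) w =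
    ((lam : ℤ) - c) * ((if w = s then 1 else 0) - (if w = t then 1 else 0)) -
      ((if w = s then 1 else 0) - (if w = cur then 1 else 0))
  reach_cur : ∀ e : Fin G.m, lab e = c + 1 → Relation.ReflTransGen (G.Res H φ) cur (G.dst φ e)
  reach : ∀ e e' : Fin G.m, lab e = c + 1 → lab e' = c + 1 → pos e < pos e' →
    Relation.ReflTransGen (G.Res H φ) (G.src φ e') (G.dst φ e)

theorem IsFlow.mul_ends {val : ℤ} (hφ : G.IsFlow H φ s t val) {e : Fin G.m} (h0 : φ e ≠ 0)
    (w : Fin G.n) :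
    φ e * ((if G.tail e = w then 1 else 0) - (if G.head e = w then 1 else 0)) =
      (if w = G.src φ e then 1 else 0) - (if w = G.dst φ e then 1 else 0) := by
  simp only [eq_comm (a := w)]
  by_cases h1 : φ e = 1
  · simp [src, dst, h1]
  · simp [src, dst, (hφ.eq_neg_one h0 h1).1]

theorem labelCount_le (lab : ℕ → ℕ) : G.labelCount lab ≤ G.m :=
  (Finset.card_filter_le _ _).trans (by simp)

theorem update_apply_fin {α : Type*} {n : ℕ} (f : ℕ → α) (e e' : Fin n) (v : α) :
    Function.update f e v e' = if e' = e then v else f e' := by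
  simp [Function.update_apply, Fin.ext_iff]

theorem lt_labelCount_update {e : Fin G.m} (he : lab e = 0) :
    G.labelCount lab < G.labelCount (Function.update lab e (c + 1)) := by
  refine Finset.card_lt_card (Finset.ssubset_iff_of_subset ?_ |>.mpr ⟨e, by simp, by simp [he]⟩)
  refine Finset.monotone_filter_right _ fun e' _ h => ?_
  rw [update_apply_fin]
  split_ifs
  · omega
  · exact h

/-- Flow on `e` creates a residual arc from its far end back to `cur`; prepending this arc extends
all backward paths along the trail. Positions come from a global counter, so they stay distinct. -/
theorem IsLabelling.step {val : ℤ} (hφ : G.IsFlow H φ s t val)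
    (h : G.IsLabelling H φ s t lam lab pos pc c cur) {e : Fin G.m}
    (he : lab e = 0) (h0 : φ e ≠ 0) (hsrc : G.src φ e = cur) :
    G.IsLabelling H φ s t lam (Function.update lab e (c + 1)) (Function.update pos e pc) (pc + 1) c
      (G.dst φ e) := by
  have hlab : ∀ e' : Fin G.m, Function.update lab e (c + 1) e' = if e' = e then c + 1 else lab e' :=
    fun e' => update_apply_fin _ _ _ _
  have hpos : ∀ e' : Fin G.m, Function.update pos e pc e' = if e' = e then pc else pos e' :=
    fun e' => update_apply_fin _ _ _ _
  have hres := hφ.res_dst_src h0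
  rw [hsrc] at hres
  constructor
  · intro j hj
    have heq : G.labelled (Function.update lab e (c + 1)) (j + 1) = G.labelled lab (j + 1) := by
      ext e'
      rw [mem_labelled, mem_labelled, hlab]
      split_ifs with h1
      · subst h1
        omega
      · rfl
    have hd := h.done j hj
    rw [heq]
    have hp : ∀ e' ∈ G.labelled lab (j + 1), Function.update pos e pc e' = pos e' := by
      intro e' he'
      rw [hpos, if_neg]
      rintro rfl
      rw [mem_labelled] at he'
      omega
    refine ⟨hd.ne_zero, fun e₁ h₁ e₂ h₂ h₁₂ => ?_, hd.net_eq, fun e₁ h₁ e₂ h₂ h₁₂ => ?_⟩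
    · exact hd.injOn h₁ h₂ (by simpa only [hp e₁ h₁, hp e₂ h₂] using h₁₂)
    · exact hd.reach e₁ h₁ e₂ h₂ (by simpa only [hp e₁ h₁, hp e₂ h₂] using h₁₂)
  · intro e'
    rw [hlab]
    split_ifs
    · exact le_rfl
    · exact h.le e'
  · intro e' he'
    rw [hlab] at he'
    split_ifs at he' with h1
    · rwa [h1]
    · exact h.ne_zero e' he'
  · exact h.pc_le.trans_lt (lt_labelCount_update he)
  · intro e' he'
    rw [hlab] at he'
    rw [hpos]
    split_ifs at he' ⊢ with h1
    · omega
    · have := h.pos_lt e' he'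
      omega
  · intro e₁ e₂ h₁ h₂ h₁₂
    rw [hlab] at h₁ h₂
    rw [hpos, hpos] at h₁₂
    split_ifs at h₁ h₂ h₁₂ with a1 a2 a2
    · rw [a1, a2]
    · have := h.pos_lt e₂ h₂
      omega
    · have := h.pos_lt e₁ h₁
      omega
    · exact h.pos_inj e₁ e₂ h₁ h₂ h₁₂
  · intro w
    have : G.labelFlow φ (Function.update lab e (c + 1)) (c + 1) =
        Function.update (G.labelFlow φ lab (c + 1)) e (G.labelFlow φ lab (c + 1) e + φ e) := by
      ext e'
      simp only [labelFlow, mem_labelled, hlab, Function.update_apply]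
      by_cases h1 : e' = e
      · subst h1; simp [he]
      · simp [h1]
    rw [this, net_update, h.net_cur, hφ.mul_ends h0, hsrc]
    ring
  · intro w
    have : G.labelFlow φ (Function.update lab e (c + 1)) 0 =
        Function.update (G.labelFlow φ lab 0) e (G.labelFlow φ lab 0 e + -φ e) := by
      ext e'
      simp only [labelFlow, mem_labelled, hlab, Function.update_apply]
      by_cases h1 : e' = e
      · subst h1; simp [he]
      · simp [h1]
    rw [this, net_update, h.net_rest, neg_mul, hφ.mul_ends h0, hsrc]
    ring
  · intro e' he'
    rw [hlab] at he'
    split_ifs at he' with h1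
    · rw [h1]
    · exact Relation.ReflTransGen.head hres (h.reach_cur e' he')
  · intro e₁ e₂ h₁ h₂ h₁₂
    rw [hlab] at h₁ h₂
    rw [hpos, hpos] at h₁₂
    split_ifs at h₁ h₂ h₁₂ with a1 a2 a2
    · omega
    · have := h.pos_lt e₂ (by omega)
      omega
    · rw [a2, hsrc]
      exact h.reach_cur e₁ h₁
    · exact h.reach e₁ e₂ h₁ h₂ h₁₂

/-- Away from `t`, the net unlabelled flow out of `cur` is at least 1, so an unlabelled edge carries
flow out of `cur`. -/
theorem IsLabelling.exists_next {val : ℤ} (hφ : G.IsFlow H φ s t val)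
    (h : G.IsLabelling H φ s t lam lab pos pc c cur) (hc : c < lam) (ht : cur ≠ t) :
    ∃ e : Fin G.m, lab e = 0 ∧ φ e ≠ 0 ∧ G.src φ e = cur := by
  by_contra hcon
  push Not at hcon
  have h1 := h.net_rest cur
  rw [if_neg ht, if_pos rfl] at h1
  have h2 : G.net (G.labelFlow φ lab 0) cur ≤ 0 := by
    refine Finset.sum_nonpos fun e _ => ?_
    by_cases he : lab e = 0
    · by_cases h0 : φ e = 0
      · simp [labelFlow, h0]
      · simp only [labelFlow, mem_labelled, he, if_true]
        rw [hφ.mul_ends h0, if_neg (hcon e he h0).symm]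
        split_ifs <;> simp
    · simp [labelFlow, he]
  rw [h1] at h2
  split_ifs at h2 <;> omega

theorem IsLabelling.next (h : G.IsLabelling H φ s t lam lab pos pc c t) :
    G.IsLabelling H φ s t lam lab pos pc (c + 1) s := by
  have hnone : ∀ e : Fin G.m, lab e ≠ c + 1 + 1 := fun e he => by
    have := h.le e
    omega
  constructor
  · intro j hj
    rcases Nat.lt_succ_iff_lt_or_eq.mp hj with hj | rfl
    · exact h.done j hj
    · refine ⟨fun e he => h.ne_zero e ?_, fun e he e' he' => h.pos_inj e e' ?_ ?_,
        fun w => h.net_cur w, fun e he e' he' => h.reach e e' (by simpa using he)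
        (by simpa using he')⟩
      · rw [mem_labelled] at he; omega
      · have := mem_labelled.mp he; omega
      · have := mem_labelled.mp he'; omega
  · exact fun e => (h.le e).trans (by omega)
  · exact h.ne_zero
  · exact h.pc_le
  · exact h.pos_lt
  · exact h.pos_inj
  · intro w
    simp [net, labelFlow, hnone]
  · intro w
    rw [h.net_rest]
    push_cast
    ring
  · exact fun e he => absurd he (hnone e)
  · exact fun e e' he => absurd he (hnone e)

/-- The labels and positions describe a decomposition of the flow into `lam` trails. -/
structure IsDecomposition (G : MGraph) (H : Finset (Fin G.m)) (φ : Fin G.m → ℤ) (s t : Fin G.n)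
    (lam : ℕ) (lab pos : ℕ → ℕ) : Prop where
  isTrail : ∀ j < lam, G.IsTrail H φ s t (G.labelled lab (j + 1)) fun e => pos e
  le : ∀ e : Fin G.m, lab e ≤ lam
  pos_lt : ∀ e : Fin G.m, lab e ≠ 0 → pos e < G.m
  net_rest : ∀ w, G.net (G.labelFlow φ lab 0) w = 0

end MGraph

namespace Algo

open BProg RExpr MGraph

variable {G : MGraph} {lam k : ℕ} {R : Finset (Fin G.m)}

/-- Stores the values of `x`, for all edges, in the array `b`. The edge is in variable `c`. -/
def mapProg (c b : ℕ) (x : RExpr) : BProg := forLt c 2 (set b (var c) x)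

theorem mapProg_rule {c b : ℕ} {x : RExpr} {σ : Store} (h : HasInput G lam k R σ) (hc : 4 ≤ c)
    (hb : 4 ≤ b) (hcb : c ≠ b) {P : Fin G.m → ℕ → Prop}
    (hP : ∀ (e : Fin G.m) (τ : Store), τ c 0 = e → (∀ a, a ≠ c → a ≠ b → τ a = σ a) →
      P e (x.eval τ)) (e : Fin G.m) : P e ((mapProg c b x).ex σ b e) := by
  have hz := forLt_rule (c := c) (j := 2) (p := set b (var c) x) (σ := σ)
    (by simp [wf, writes, hcb]; omega)
    (by rw [h.m, h.bound]; omega) (fun i τ => ∀ e : Fin G.m, e < i → P e (τ b e))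
    (fun i τ v => by simp only [Store.upd_ne _ _ hcb.symm]; exact id)
    (fun j hj => absurd hj (by omega)) (by
      intro i τ hi hcnt hfr hI j hj
      rw [h.m] at hi
      simp only [ex_set, Store.upd_self, eval_var, hcnt]
      rcases Nat.lt_succ_iff_lt_or_eq.mp hj with hj | hj
      · rw [Function.update_of_ne (by omega)]
        exact hI j hj
      · rw [hj, Function.update_self]
        obtain rfl : j = ⟨i, hi⟩ := Fin.ext hj
        exact hP _ τ hcnt fun a h1 h2 => hfr a (by simp [writes, h1, h2]))
  rw [h.m] at hz
  exact hz e e.2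

theorem mapProg_spec {c b : ℕ} {x : RExpr} {σ : Store} (h : HasInput G lam k R σ) (hc : 4 ≤ c)
    (hb : 4 ≤ b) (hcb : c ≠ b) {g : Fin G.m → ℕ}
    (hg : ∀ (e : Fin G.m) (τ : Store), τ c 0 = e → (∀ a, a ≠ c → a ≠ b → τ a = σ a) →
      x.eval τ = g e) (e : Fin G.m) : (mapProg c b x).ex σ b e = g e :=
  mapProg_rule (P := fun e v => v = g e) h hc hb hcb hg e

theorem edgeSet_mapProg {c b : ℕ} {x : RExpr} {σ : Store} (h : HasInput G lam k R σ) (hc : 4 ≤ c)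
    (hb : 4 ≤ b) (hcb : c ≠ b) {A : Finset (Fin G.m)}
    (hx : ∀ (e : Fin G.m) (τ : Store), τ c 0 = e → (∀ a, a ≠ c → a ≠ b → τ a = σ a) →
      (x.Holds τ ↔ e ∈ A)) : edgeSet G ((mapProg c b x).ex σ b) = A := by
  ext e
  rw [mem_edgeSet]
  exact mapProg_rule (P := fun e v => v ≠ 0 ↔ e ∈ A) h hc hb hcb hx e

theorem mapProg_frame {c b a : ℕ} {x : RExpr} {σ : Store} (h1 : a ≠ c) (h2 : a ≠ b) :
    (mapProg c b x).ex σ a = σ a :=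
  ex_frame (by simp [mapProg, forLt, writes, h1, h2])

/-- The condition that the edge in variable 41 is not yet labelled and leads away from the current
vertex `x`, which is not the end of the trail. -/
def canLabel (b x : RExpr) : RExpr :=
  .and (.not (get 17 (var 41))) (.and (.not (.eq (var 10) (var 14))) (.and (.eq (var 10) x) b))

/-- Labels the edge in variable 41 and moves on to the vertex `y`. -/
def labelMove (y : RExpr) : BProg := block [
  set 17 (var 41) (add (var 40) (lit 1)),
  set 18 (var 41) (var 19),
  assign 19 (add (var 19) (lit 1)),
  assign 10 y]

/-- Continues the current trail along the edge in variable 41, if possible. -/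
def labelEdge : BProg :=
  ite (canLabel (.lt (lit 1) (get 8 (var 41))) (tl 41)) (labelMove (hd 41))
    (when (canLabel (.lt (get 8 (var 41)) (lit 1)) (hd 41)) (labelMove (tl 41)))

/-- Decomposes the flow in array 8 into trails. The labels of the edges are stored in array 17 and
their order in array 18. -/
def labelProg : BProg := block [
  mapProg 41 17 (lit 0),
  assign 19 (lit 0),
  forLt 40 3 (block [assign 10 (var 13), forN 42 (forLt 41 2 labelEdge)])]

theorem eval_eq_eq_zero (σ : Store) (x y : RExpr) : (RExpr.eq x y).eval σ = 0 ↔ x.eval σ ≠ y.eval σ := by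
  have := holds_eq σ x y
  unfold Holds at this
  tauto

theorem labelMove_spec {τ : Store} {c : ℕ} (hc : τ 40 0 = c)
    {e : Fin G.m} (he : τ 41 0 = e) {s t cur : Fin G.n} {H : Finset (Fin G.m)} {val : ℤ}
    (hφ : G.IsFlow H (flowOf G (τ 8)) s t val)
    (hL : G.IsLabelling H (flowOf G (τ 8)) s t lam (τ 17) (τ 18) (τ 19 0) c cur)
    (h0 : τ 17 e = 0) (h1 : flowOf G (τ 8) e ≠ 0) (h2 : G.src (flowOf G (τ 8)) e = cur)
    {y : RExpr} (hy : ∀ τ', (∀ a, a ≠ 10 → a ≠ 17 → a ≠ 18 → a ≠ 19 → τ' a = τ a) →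
      y.eval τ' = G.dst (flowOf G (τ 8)) e) :
    (labelMove y).ex τ 10 0 = G.dst (flowOf G (τ 8)) e ∧
    G.IsLabelling H (flowOf G (τ 8)) s t lam ((labelMove y).ex τ 17) ((labelMove y).ex τ 18)
      ((labelMove y).ex τ 19 0) c (G.dst (flowOf G (τ 8)) e) ∧
    G.labelCount (τ 17) < G.labelCount ((labelMove y).ex τ 17) := by
  have e17 : (labelMove y).ex τ 17 = Function.update (τ 17) e (c + 1) := by
    simp [labelMove, Store.upd_ne, Store.upd_self, he, hc]
  have e18 : (labelMove y).ex τ 18 = Function.update (τ 18) e (τ 19 0) := by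
    simp [labelMove, Store.upd_ne, Store.upd_self, he]
  have e19 : (labelMove y).ex τ 19 0 = τ 19 0 + 1 := by
    simp [labelMove, Store.upd_ne, Store.upd_self]
  rw [e17, e18, e19]
  refine ⟨?_, hL.step hφ h0 h1 h2, lt_labelCount_update h0⟩
  simp only [labelMove, ex_block_cons, ex_block_nil, ex_assign, ex_set, Store.upd_self,
    Function.update_self]
  exact hy _ fun a a1 a2 a3 a4 => by rw [Store.upd_ne _ _ a4, Store.upd_ne _ _ a3, Store.upd_ne _ _ a2]

theorem labelEdge_spec {τ : Store} (h : HasInput G lam k R τ) {c : ℕ} (hc : τ 40 0 = c)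
    {e : Fin G.m} (he : τ 41 0 = e) {s t cur : Fin G.n} (ht : τ 14 0 = t) (hcur : τ 10 0 = cur)
    {H : Finset (Fin G.m)} {val : ℤ}
    (hφ : G.IsFlow H (flowOf G (τ 8)) s t val)
    (hL : G.IsLabelling H (flowOf G (τ 8)) s t lam (τ 17) (τ 18) (τ 19 0) c cur) :
    ∃ cur' : Fin G.n, labelEdge.ex τ 10 0 = cur' ∧
      G.IsLabelling H (flowOf G (τ 8)) s t lam (labelEdge.ex τ 17) (labelEdge.ex τ 18)
        (labelEdge.ex τ 19 0) c cur' ∧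
      ((cur ≠ t ∧ G.labelCount (τ 17) < G.labelCount (labelEdge.ex τ 17)) ∨
        labelEdge.ex τ 17 = τ 17 ∧ cur' = cur ∧
        (cur ≠ t → ¬ (τ 17 e = 0 ∧ flowOf G (τ 8) e ≠ 0 ∧ G.src (flowOf G (τ 8)) e = cur))) := by
  unfold labelEdge
  by_cases h1 : (canLabel (.lt (lit 1) (get 8 (var 41))) (tl 41)).Holds τ
  · rw [ex_ite_of h1]
    simp only [canLabel, holds_and, holds_not, eval_eq_eq_zero, holds_eq, holds_lt, eval_get,
      eval_var, eval_lit, eval_tl, he, h.tail, hcur, ht] at h1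
    obtain ⟨a1, a2, a3, a4⟩ := h1
    have hone : flowOf G (τ 8) e = 1 := by
      have := hφ.le_one e
      unfold flowOf at this ⊢
      omega
    obtain ⟨b1, b2, b3⟩ := labelMove_spec hc he hφ hL a1 (by omega)
      (by rw [src, if_pos hone]; exact Fin.ext a3.symm) (y := hd 41) (fun τ' hτ' => by
        simp [dst, hone, hτ', he, h.head])
    exact ⟨_, b1, b2, Or.inl ⟨fun h => a2 (by rw [h]), b3⟩⟩
  rw [ex_ite_of_not h1]
  by_cases h2 : (canLabel (.lt (get 8 (var 41)) (lit 1)) (hd 41)).Holds τ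
  · rw [ex_when_of h2]
    simp only [canLabel, holds_and, holds_not, eval_eq_eq_zero, holds_eq, holds_lt, eval_get,
      eval_var, eval_lit, eval_hd, he, h.head, hcur, ht] at h2
    obtain ⟨a1, a2, a3, a4⟩ := h2
    have hone : flowOf G (τ 8) e ≠ 1 := by
      unfold flowOf
      omega
    obtain ⟨b1, b2, b3⟩ := labelMove_spec hc he hφ hL a1 (by unfold flowOf; omega)
      (by rw [src, if_neg hone]; exact Fin.ext a3.symm) (y := tl 41) (fun τ' hτ' => by
        simp [dst, hone, hτ', he, h.tail])
    exact ⟨_, b1, b2, Or.inl ⟨fun h => a2 (by rw [h]), b3⟩⟩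
  rw [ex_when_of_not h2]
  refine ⟨cur, hcur, hL, Or.inr ⟨rfl, rfl, ?_⟩⟩
  rintro hct ⟨b1, b2, b3⟩
  simp only [canLabel, holds_and, holds_not, eval_eq_eq_zero, holds_eq, holds_lt, eval_get,
    eval_var, eval_lit, eval_hd, eval_tl, he, h.head, h.tail, hcur, ht] at h1 h2
  have hct' : (cur : ℕ) ≠ t := fun h => hct (Fin.ext h)
  unfold src at b3
  split_ifs at b3 with hone
  · refine h1 ⟨b1, hct', by rw [b3], ?_⟩
    unfold flowOf at hone
    omega
  · refine h2 ⟨b1, hct', by rw [b3], ?_⟩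
    have := (hφ.eq_neg_one b2 hone).1
    unfold flowOf at this
    omega

theorem labelRound_spec {σ : Store} (h : HasInput G lam k R σ) {c : ℕ} (hc : σ 40 0 = c)
    {s t cur : Fin G.n} (ht : σ 14 0 = t) (hcur : σ 10 0 = cur)
    {H : Finset (Fin G.m)} {val : ℤ} (hcl : c < lam)
    (hφ : G.IsFlow H (flowOf G (σ 8)) s t val)
    (hL : G.IsLabelling H (flowOf G (σ 8)) s t lam (σ 17) (σ 18) (σ 19 0) c cur) :
    let τ := (forLt 41 2 labelEdge).ex σ
    ∃ cur' : Fin G.n, τ 10 0 = cur' ∧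
      G.IsLabelling H (flowOf G (σ 8)) s t lam (τ 17) (τ 18) (τ 19 0) c cur' ∧
      (cur ≠ t → G.labelCount (σ 17) < G.labelCount (τ 17)) ∧ (cur = t → cur' = t) := by
  intro τ
  have key := forLt_rule (c := 41) (j := 2) (p := labelEdge) (σ := σ) (by decide)
    (by rw [h.m, h.bound]; omega)
    (fun i τ => ∃ cur' : Fin G.n, τ 10 0 = cur' ∧
      G.IsLabelling H (flowOf G (σ 8)) s t lam (τ 17) (τ 18) (τ 19 0) c cur' ∧
      ((cur ≠ t ∧ G.labelCount (σ 17) < G.labelCount (τ 17)) ∨ τ 17 = σ 17 ∧ cur' = cur ∧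
        (cur ≠ t → ∀ e : Fin G.m, e < i →
          ¬ (σ 17 e = 0 ∧ flowOf G (σ 8) e ≠ 0 ∧ G.src (flowOf G (σ 8)) e = cur))))
    (fun i τ v => by
      simp only [Store.upd_ne _ _ (show 10 ≠ 41 by omega), Store.upd_ne _ _ (show 17 ≠ 41 by omega),
        Store.upd_ne _ _ (show 18 ≠ 41 by omega), Store.upd_ne _ _ (show 19 ≠ 41 by omega)]
      exact id)
    ⟨cur, hcur, hL, Or.inr ⟨rfl, rfl, fun _ e he => absurd he (by omega)⟩⟩ (by
      rintro i τ hi hcnt hfr ⟨cur', i1, i2, i3⟩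
      rw [h.m] at hi
      have hin : HasInput G lam k R τ := h.congr fun a ha =>
        hfr a ((by decide : ∀ a < 4, a ∉ (forN 41 labelEdge).writes) a ha)
      have h8 : τ 8 = σ 8 := hfr 8 (by decide)
      have h14 : τ 14 = σ 14 := hfr 14 (by decide)
      have h40 : τ 40 = σ 40 := hfr 40 (by decide)
      obtain ⟨d, s1, s2, s3⟩ := labelEdge_spec hin (c := c) (by rw [h40, hc]) (e := ⟨i, hi⟩) hcnt
        (by rw [h14, ht]) i1 (by rw [h8]; exact hφ) (by rw [h8]; exact i2)
      rw [h8] at s2 s3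
      refine ⟨d, s1, s2, ?_⟩
      rcases i3 with ⟨i3, i4⟩ | ⟨i3, rfl, i4⟩
      · refine Or.inl ⟨i3, ?_⟩
        rcases s3 with ⟨-, s3⟩ | ⟨s3, -, -⟩
        · exact i4.trans s3
        · rwa [s3]
      · rcases s3 with ⟨s3, s4⟩ | ⟨s3, rfl, s4⟩
        · exact Or.inl ⟨s3, i3 ▸ s4⟩
        · refine Or.inr ⟨s3.trans i3, rfl, fun hct e he => ?_⟩
          rcases Nat.lt_succ_iff_lt_or_eq.mp he with he | he
          · exact i4 hct e he
          · obtain rfl : e = ⟨i, hi⟩ := Fin.ext he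
            rw [← i3]
            exact s4 hct)
  obtain ⟨cur', k1, k2, k3⟩ := key
  refine ⟨cur', k1, k2, fun hct => ?_, fun hct => ?_⟩
  · rcases k3 with ⟨-, k3⟩ | ⟨-, -, k3⟩
    · exact k3
    · obtain ⟨e, he⟩ := hL.exists_next hφ hcl hct
      exact absurd he (k3 hct e (by rw [h.m]; exact e.2))
  · rcases k3 with ⟨k3, -⟩ | ⟨-, k3, -⟩
    · exact absurd hct k3
    · rw [k3, hct]

theorem labelTrail_spec {σ : Store} (h : HasInput G lam k R σ) {c : ℕ} (hc : σ 40 0 = c)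
    {s t : Fin G.n} (hs : σ 13 0 = s) (ht : σ 14 0 = t)
    {H : Finset (Fin G.m)} {val : ℤ} (hcl : c < lam)
    (hφ : G.IsFlow H (flowOf G (σ 8)) s t val)
    (hL : G.IsLabelling H (flowOf G (σ 8)) s t lam (σ 17) (σ 18) (σ 19 0) c s) :
    let τ := (block [assign 10 (var 13), forN 42 (forLt 41 2 labelEdge)]).ex σ
    G.IsLabelling H (flowOf G (σ 8)) s t lam (τ 17) (τ 18) (τ 19 0) c t := by
  intro τ
  simp only [τ, ex_block_cons, ex_block_nil, ex_assign, eval_var, hs]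
  have h' : HasInput G lam k R (σ.upd 10 0 s) := h.upd (by omega) _ _
  have hfr : ∀ a, a ≠ 10 → σ.upd 10 0 s a = σ a := fun a ha => Store.upd_ne _ _ ha
  have e10 : σ.upd 10 0 s 10 0 = s := by simp [Store.upd_self]
  generalize σ.upd 10 0 s = ρ at *
  have key := forN_rule (c := 42) (p := forLt 41 2 labelEdge) (σ := ρ) (by decide)
    (fun i τ => ∃ cur' : Fin G.n, τ 10 0 = cur' ∧
      G.IsLabelling H (flowOf G (σ 8)) s t lam (τ 17) (τ 18) (τ 19 0) c cur' ∧
      (cur' = t ∨ i ≤ G.labelCount (τ 17)))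
    (fun i τ v => by
      simp only [Store.upd_ne _ _ (show 10 ≠ 42 by omega), Store.upd_ne _ _ (show 17 ≠ 42 by omega),
        Store.upd_ne _ _ (show 18 ≠ 42 by omega), Store.upd_ne _ _ (show 19 ≠ 42 by omega)]
      exact id)
    ⟨s, e10, by rw [hfr 17 (by omega), hfr 18 (by omega), hfr 19 (by omega)]; exact hL,
      Or.inr (by omega)⟩ (by
      rintro i τ hi hcnt hfr' ⟨cur', i1, i2, i3⟩
      have hin : HasInput G lam k R τ := h'.congr fun a ha =>
        hfr' a ((by decide : ∀ a < 4, a ∉ (forN 42 (forLt 41 2 labelEdge)).writes) a ha)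
      have h8 : τ 8 = σ 8 := (hfr' 8 (by decide)).trans (hfr 8 (by omega))
      have h14 : τ 14 = σ 14 := (hfr' 14 (by decide)).trans (hfr 14 (by omega))
      have h40 : τ 40 = σ 40 := (hfr' 40 (by decide)).trans (hfr 40 (by omega))
      obtain ⟨d, s1, s2, s3, s4⟩ := labelRound_spec hin (c := c) (by rw [h40, hc])
        (by rw [h14, ht]) i1 hcl (by rw [h8]; exact hφ) (by rw [h8]; exact i2)
      rw [h8] at s2
      refine ⟨d, s1, s2, ?_⟩
      by_cases hct : cur' = t
      · exact Or.inl (s4 hct)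
      · have := s3 hct
        have := i3.resolve_left hct
        exact Or.inr (by omega))
  obtain ⟨cur', -, k2, k3⟩ := key
  -- Each round labels a further edge unless the trail has arrived, and there are more rounds than
  -- edges.
  have := k3.resolve_right fun hle => by
    have := G.labelCount_le ((forN 42 (forLt 41 2 labelEdge)).ex ρ 17)
    rw [h'.bound] at hle
    omega
  subst this
  exact k2

/-- The assumption `lam ≤ G.m` makes the loop over the trails fit the common loop bound. After `lam`
trails the unlabelled flow is a circulation. -/
theorem labelProg_spec {σ : Store} (h : HasInput G lam k R σ) (hlam : lam ≤ G.m)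
    {s t : Fin G.n} (hs : σ 13 0 = s) (ht : σ 14 0 = t)
    {H : Finset (Fin G.m)} (hφ : G.IsFlow H (flowOf G (σ 8)) s t lam) :
    G.IsDecomposition H (flowOf G (σ 8)) s t lam (labelProg.ex σ 17) (labelProg.ex σ 18) := by
  simp only [labelProg, ex_block_cons, ex_block_nil, ex_assign, eval_lit]
  have h0 : ∀ e : Fin G.m, (mapProg 41 17 (lit 0)).ex σ 17 e = 0 :=
    mapProg_spec (g := fun _ => 0) h (by omega) (by omega) (by omega) fun _ _ _ _ => rfl
  have hfr : ∀ a, a ≠ 41 → a ≠ 17 → a ≠ 19 →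
      ((mapProg 41 17 (lit 0)).ex σ).upd 19 0 0 a = σ a := fun a h1 h2 h3 => by
    rw [Store.upd_ne _ _ h3, mapProg_frame h1 h2]
  rw [← Store.upd_ne (σ := (mapProg 41 17 (lit 0)).ex σ) (a := 19) 0 0 (show 17 ≠ 19 by omega)] at h0
  have h19 : ((mapProg 41 17 (lit 0)).ex σ).upd 19 0 0 19 0 = 0 := by simp [Store.upd_self]
  generalize ((mapProg 41 17 (lit 0)).ex σ).upd 19 0 0 = ρ at *
  have h' : HasInput G lam k R ρ := h.congr fun a ha => hfr a (by omega) (by omega) (by omega)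
  have hrest : G.labelFlow (flowOf G (σ 8)) (ρ 17) 0 = flowOf G (σ 8) := by
    ext e
    simp [labelFlow, h0]
  have hstart : G.IsLabelling H (flowOf G (σ 8)) s t lam (ρ 17) (ρ 18) (ρ 19 0) 0 s := by
    constructor
    · exact fun j hj => absurd hj (by omega)
    · intro e; rw [h0]; omega
    · exact fun e he => absurd (h0 e) he
    · omega
    · exact fun e he => absurd (h0 e) he
    · exact fun e _ he => absurd (h0 e) he
    · intro w
      simp [net, labelFlow, h0]
    · intro w
      rw [hrest, hφ.net_eq]
      push_cast
      ring
    · intro e he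
      rw [h0] at he
      omega
    · intro e _ he
      rw [h0] at he
      omega
  have key := forLt_rule (c := 40) (j := 3)
    (p := block [assign 10 (var 13), forN 42 (forLt 41 2 labelEdge)]) (σ := ρ) (by decide)
    (by rw [h'.lam_eq, h'.bound]; omega)
    (fun i τ => G.IsLabelling H (flowOf G (σ 8)) s t lam (τ 17) (τ 18) (τ 19 0) i s ∧
      ∀ e : Fin G.m, τ 17 e ≤ i)
    (fun i τ v => by
      simp only [Store.upd_ne _ _ (show 17 ≠ 40 by omega),
        Store.upd_ne _ _ (show 18 ≠ 40 by omega), Store.upd_ne _ _ (show 19 ≠ 40 by omega)]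
      exact id)
    ⟨hstart, fun e => (h0 e).le⟩ (by
      rintro i τ hi hcnt hfr' ⟨i1, -⟩
      rw [h'.lam_eq] at hi
      have hin : HasInput G lam k R τ := h'.congr fun a ha => hfr' a
        ((by decide : ∀ a < 4, a ∉ (forN 40
          (block [assign 10 (var 13), forN 42 (forLt 41 2 labelEdge)])).writes) a ha)
      have h8 : τ 8 = σ 8 := (hfr' 8 (by decide)).trans (hfr 8 (by omega) (by omega) (by omega))
      have h13 : τ 13 = σ 13 := (hfr' 13 (by decide)).trans (hfr 13 (by omega) (by omega) (by omega))
      have h14 : τ 14 = σ 14 := (hfr' 14 (by decide)).trans (hfr 14 (by omega) (by omega) (by omega))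
      have := labelTrail_spec hin hcnt (s := s) (t := t) (by rw [h13, hs]) (by rw [h14, ht]) hi
        (by rw [h8]; exact hφ) (by rw [h8]; exact i1)
      rw [h8] at this
      exact ⟨this.next, this.le⟩)
  rw [h'.lam_eq] at key
  obtain ⟨k1, k2⟩ := key
  refine ⟨k1.done, k2, fun e he => ?_, fun w => ?_⟩
  · exact (k1.pos_lt e he).trans_le (k1.pc_le.trans (G.labelCount_le _))
  · rw [k1.net_rest]
    ring

end Algo

/-! ### Correctness of the answers -/

namespace MGraph

variable {G : MGraph} {lam k : ℕ} {F R : Finset (Fin G.m)}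

/-- A correct answer that is not an irrelevant edge if `G` is directed or `lam` is even. -/
structure IsAnswer (G : MGraph) (lam k : ℕ) (R : Finset (Fin G.m)) (ans : Answer G.m) : Prop where
  correct : ans.Correct G lam k R
  of_directed : G.directed = true → ∀ e, ans ≠ Answer.irrelevantEdge e
  of_even : G.directed = false → Even lam → ∀ e, ans ≠ Answer.irrelevantEdge e

theorem IsDeletionSet.isAnswer {K : Finset (Fin G.m)} (h : G.IsDeletionSet lam k K) :
    G.IsAnswer lam k R (Answer.deletionSet K) :=
  ⟨h, fun _ _ => by simp, fun _ _ _ => by simp⟩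

/-- A long rung that is untouched by `F` makes its first edge irrelevant. -/
theorem Ladder.isAnswer_irrelevantEdge (L : G.Ladder lam F) (hR : G.Irrelevant lam k R)
    (hk : 1 ≤ k) (hF : G.EdgeConnectedWithout lam F) {l t : Fin G.m} (hl : l ∈ L.Z) (ht : t ∈ L.Z)
    (hlt : L.pos l < L.pos t) (hlR : l ∉ R) (hlF : G.EdgeConnectedWithout lam (insert l F))
    (hc : ¬ G.EdgeConnectedWithout lam (F ∪ {l, t}))
    (hun : ∀ g ∈ F, G.tail g ∉ L.X t \ L.X l ∧ G.head g ∉ L.X t \ L.X l)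
    {W : Finset (Fin G.m)} (hWZ : W ⊆ L.Z) (hW : ∀ y ∈ W, L.pos l < L.pos y ∧ L.pos y < L.pos t)
    (hWR : ∀ y ∈ W, y ∉ R) (hcard : 2 * k ≤ W.card) :
    G.IsAnswer lam k R (Answer.irrelevantEdge l) := by
  classical
  -- In a digraph `l` and `t` could be deleted together. So the search for irrelevant edges needs no
  -- test of the direction flag.
  have hd : G.directed = false := by
    rw [← Bool.not_eq_true]
    exact fun hd => hc (L.edgeConnectedWithout_of_directed hd hF
      (by simp [Finset.insert_subset_iff, hl, ht]))
  obtain ⟨Y, hY⟩ := L.exists_isRung_of_not_edgeConnectedWithout hd hF hl ht hlt hc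
  refine ⟨⟨hlR, hlF.anti (by simp), ?_⟩, fun h => absurd h (by simp [hd]), fun _ hev => ?_⟩
  · intro hex
    obtain ⟨K, hK, hKR⟩ := hR hex
    by_cases hlK : l ∈ K
    · obtain ⟨y, hy, hyK, hconn⟩ := L.exists_exchange hd
        (fun z hz S hS => (L.lt_cut z hz S hS).trans (cut_anti (Finset.empty_subset _) S))
        hl ht hY hun hWZ hW hcard hK.1 hK.2 hlK
      refine ⟨insert y (K.erase l), ⟨?_, hconn⟩, ?_⟩
      · rw [Finset.card_insert_of_notMem fun h => hyK (Finset.mem_of_mem_erase h),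
          Finset.card_erase_of_mem hlK, hK.1]
        omega
      · rw [Finset.disjoint_left] at hKR ⊢
        intro e he
        have hyl : y ≠ l := fun h => by
          have := (hW y hy).1
          rw [h] at this
          exact lt_irrefl _ this
        rcases Finset.mem_insert.mp he with rfl | he
        · simp [hyl, hWR e hy]
        · simp [Finset.ne_of_mem_erase he, hKR (Finset.mem_of_mem_erase he)]
    · refine ⟨K, hK, ?_⟩
      rw [Finset.disjoint_insert_right]
      exact ⟨hlK, hKR⟩
  -- For even `lam` a rung has no intermediate edge, by parity.
  · obtain ⟨y, hy⟩ : W.Nonempty := Finset.card_pos.mp (by omega)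
    have := (hY.split hd hl (hWZ hy) ht (hW y hy).1 (hW y hy).2).2.2.1
    obtain ⟨c, rfl⟩ := hev
    omega

/-- `D` was selected greedily from those edges of the ladder that satisfy `P`. -/
structure Ladder.IsGreedyOn (L : G.Ladder lam F) (P : Fin G.m → Prop) (D : Finset (Fin G.m)) :
    Prop where
  subset : D ⊆ L.Z
  conn : G.EdgeConnectedWithout lam (F ∪ D)
  mem : ∀ d ∈ D, P d
  maximal : ∀ e ∈ L.Z, P e → e ∉ D →
    ¬ G.EdgeConnectedWithout lam (F ∪ (insert e (D.filter fun d => L.pos d < L.pos e)))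

namespace Ladder.IsGreedyOn

variable {L : G.Ladder lam F} {P Q : Fin G.m → Prop} {D : Finset (Fin G.m)}

theorem isGreedy (h : L.IsGreedyOn P D) (hP : ∀ e ∈ L.Z, P e) : L.IsGreedy D :=
  ⟨h.subset, h.conn, fun e he => h.maximal e he (hP e he)⟩

theorem congr (h : L.IsGreedyOn P D) (hPQ : ∀ e ∈ L.Z, P e ↔ Q e) : L.IsGreedyOn Q D :=
  ⟨h.subset, h.conn, fun d hd => (hPQ d (h.subset hd)).mp (h.mem d hd),
    fun e he heQ => h.maximal e he ((hPQ e he).mpr heQ)⟩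

/-- Edges are treated in order of position, so adding a later edge does not change the comparison
sets of the edges rejected before. -/
theorem insert (h : L.IsGreedyOn P D) {e : Fin G.m} (he : e ∈ L.Z)
    (hP : ∀ e' ∈ L.Z, P e' → L.pos e' ≤ L.pos e)
    (hc : G.EdgeConnectedWithout lam (F ∪ insert e D)) :
    L.IsGreedyOn (fun e' => P e' ∨ e' = e) (insert e D) := by
  refine ⟨Finset.insert_subset he h.subset, hc, fun d hd => ?_, fun e' he' hP' hD => ?_⟩
  · exact (Finset.mem_insert.mp hd).symm.imp_left (h.mem d)
  · rw [Finset.mem_insert, not_or] at hD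
    rw [Finset.filter_insert, if_neg (not_lt.mpr (hP e' he' (hP'.resolve_right hD.1)))]
    exact h.maximal e' he' (hP'.resolve_right hD.1) hD.2

theorem skip (h : L.IsGreedyOn P D) {e : Fin G.m} (he : e ∈ L.Z) (hPe : ¬ P e)
    (hP : ∀ e' ∈ L.Z, P e' → L.pos e' ≤ L.pos e)
    (hc : ¬ G.EdgeConnectedWithout lam (F ∪ Insert.insert e D)) :
    L.IsGreedyOn (fun e' => P e' ∨ e' = e) D := by
  refine ⟨h.subset, h.conn, fun d hd => Or.inl (h.mem d hd), fun e' he' hP' hD => ?_⟩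
  rcases hP' with hP' | rfl
  · exact h.maximal e' he' hP' hD
  · rwa [Finset.filter_true_of_mem fun d hd => ?_]
    refine lt_of_le_of_ne (hP d (h.subset hd) (h.mem d hd)) fun heq => hPe ?_
    rw [← L.injOn (h.subset hd) he heq]
    exact h.mem d hd

end Ladder.IsGreedyOn

section

variable {f : Fin G.m} {φ : Fin G.m → ℤ} {lab pos : ℕ → ℕ}

/-- The unlabelled part of the flow is a circulation, which passes through no tight cut. -/
theorem Blocked.label_ne_zero (hfF : f ∉ F) (hf : G.EdgeConnectedWithout lam (insert f F))
    (hφ : G.IsFlow (insert f F) φ (G.tail f) (G.head f) lam)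
    (hdec : G.IsDecomposition (insert f F) φ (G.tail f) (G.head f) lam lab pos)
    {e : Fin G.m} (he : G.Blocked lam F f e) : lab e ≠ 0 := by
  have := he.mem_of_net_eq_zero hfF hf hφ (C := Finset.univ.filter fun e => lab e ≠ 0) (fun w => by
    refine Eq.trans ?_ (hdec.net_rest w)
    congr 1
    ext e
    by_cases h : lab e = 0 <;> simp [labelFlow, h])
  simpa using this

theorem card_blocked_le (hfF : f ∉ F) (hf : G.EdgeConnectedWithout lam (insert f F))
    (hφ : G.IsFlow (insert f F) φ (G.tail f) (G.head f) lam)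
    (hdec : G.IsDecomposition (insert f F) φ (G.tail f) (G.head f) lam lab pos)
    {S : Finset (Fin G.m)} (hS : ∀ e ∈ S, G.Blocked lam F f e) {b : ℕ}
    (hb : ∀ j < lam, (S.filter fun e : Fin G.m => lab e = j + 1).card ≤ b) : S.card ≤ lam * b := by
  have hlab : ∀ e ∈ S, ∃ j < lam, lab e = j + 1 := fun e he => by
    have h1 := (hS e he).label_ne_zero hfF hf hφ hdec
    have h2 := hdec.le e
    exact ⟨lab e - 1, by omega, by omega⟩
  have h1 := Finset.card_le_mul_card_image (f := fun e : Fin G.m => lab e) S b (by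
    intro c hc
    obtain ⟨e, he, rfl⟩ := Finset.mem_image.mp hc
    obtain ⟨j, hj, hje⟩ := hlab e he
    simp only [hje]
    exact hb j hj)
  have h2 : (S.image fun e : Fin G.m => lab e).card ≤ lam := by
    refine (Finset.card_le_card (t := Finset.Icc 1 lam) fun c hc => ?_).trans (by simp)
    obtain ⟨e, he, rfl⟩ := Finset.mem_image.mp hc
    obtain ⟨j, hj, hje⟩ := hlab e he
    exact Finset.mem_Icc.mpr ⟨by omega, by omega⟩
  rw [mul_comm]
  exact h1.trans (Nat.mul_le_mul_left _ h2)

open Classical in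
/-- The bounds on the number of edges in the set `S` in the three cases. -/
def Bounded (G : MGraph) (lam : ℕ) (R S : Finset (Fin G.m)) (c₁ c₂ c₃ : ℕ) : Prop :=
  (G.directed = true → S.card ≤ c₁) ∧ (G.directed = false → Even lam → S.card ≤ c₂) ∧
    (G.directed = false → (S \ R).card ≤ c₃)

open Classical in
-- Sums over the `lam` trails. Fewer than `k` edges are selected on each; in the third bound the
-- factor `3 * (k - 1)` comes from `D.card + 2 * F.card`.
theorem bounded_blocked (hlam : 1 ≤ lam) (hF : G.EdgeConnectedWithout lam F) (hfF : f ∉ F)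
    (hf : G.EdgeConnectedWithout lam (insert f F))
    (hφ : G.IsFlow (insert f F) φ (G.tail f) (G.head f) lam)
    (hdec : G.IsDecomposition (insert f F) φ (G.tail f) (G.head f) lam lab pos)
    (hgr : ∀ j (hj : j < lam), ∃ D,
      (ladder hlam hfF hf hφ (hdec.isTrail j hj)).IsGreedy D ∧ D.card < k)
    (hFk : F.card < k)
    (hwin : ∀ l t : Fin G.m, G.Blocked lam F f l → G.Blocked lam F f t → l ∉ R → t ∉ R →
      lab l = lab t → pos l < pos t →
      2 * k ≤ (Finset.univ.filter fun y : Fin G.m => G.Blocked lam F f y ∧ y ∉ R ∧ lab y = lab l ∧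
        pos l < pos y ∧ pos y < pos t).card →
      G.EdgeConnectedWithout lam (F ∪ {l, t}) ∨
        ¬ ∀ g ∈ F, G.tail g ∉ G.noReach (insert f F) φ (G.dst φ t) \
            G.noReach (insert f F) φ (G.dst φ l) ∧
          G.head g ∉ G.noReach (insert f F) φ (G.dst φ t) \
            G.noReach (insert f F) φ (G.dst φ l)) :
    G.Bounded lam R (Finset.univ.filter fun e => G.Blocked lam F f e) (lam * (k - 1))
      (lam * (2 * (k - 1))) (lam * ((2 * k + 1) * (3 * (k - 1)))) := by
  have hZ : ∀ j (hj : j < lam), (ladder hlam hfF hf hφ (hdec.isTrail j hj)).Z =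
      (Finset.univ.filter fun e => G.Blocked lam F f e).filter fun e : Fin G.m => lab e = j + 1 := by
    intro j hj
    ext e
    simp [ladder, and_comm]
  have hZF : ∀ j (hj : j < lam), ∀ e ∈ (ladder hlam hfF hf hφ (hdec.isTrail j hj)).Z, e ∉ F := by
    intro j hj e he heF
    rw [hZ j hj] at he
    simp only [Finset.mem_filter, Finset.mem_univ, true_and] at he
    exact he.1.notMem hf (Finset.mem_insert_of_mem heF)
  refine ⟨fun hd => ?_, fun hd hev => ?_, fun hd => ?_⟩
  · refine card_blocked_le hfF hf hφ hdec (fun e he => (Finset.mem_filter.mp he).2) fun j hj => ?_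
    obtain ⟨D, h1, h2⟩ := hgr j hj
    rw [← hZ j hj, h1.eq_of_directed hd hF]
    omega
  · refine card_blocked_le hfF hf hφ hdec (fun e he => (Finset.mem_filter.mp he).2) fun j hj => ?_
    obtain ⟨D, h1, h2⟩ := hgr j hj
    rw [← hZ j hj]
    have := h1.card_le_of_even hd hev (hZF j hj) hF
    omega
  · refine card_blocked_le hfF hf hφ hdec
      (fun e he => (Finset.mem_filter.mp (Finset.mem_sdiff.mp he).1).2) fun j hj => ?_
    obtain ⟨D, h1, h2⟩ := hgr j hj
    refine (h1.card_le_of_no_window hd (hZF j hj) hF (k := k) ?_ ?_).trans ?_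
    · rw [hZ j hj]
      exact Finset.filter_subset_filter _ Finset.sdiff_subset
    · intro l hl t ht hlt hc
      simp only [Finset.mem_filter, Finset.mem_sdiff, Finset.mem_univ, true_and] at hl ht
      refine hwin l t hl.1.1 ht.1.1 hl.1.2 ht.1.2 (hl.2.trans ht.2.symm) hlt (hc.trans ?_)
      refine Finset.card_le_card fun y hy => ?_
      simp only [Finset.mem_filter, Finset.mem_sdiff, Finset.mem_univ, true_and] at hy ⊢
      exact ⟨hy.1.1.1, hy.1.1.2, hy.1.2.trans hl.2.symm, hy.2.1, hy.2.2⟩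
    · exact Nat.mul_le_mul_left _ (by omega)

/-- No cut separates the ends of a loop, so no flow has to be computed for it. -/
theorem not_blocked_of_loop (hfF : f ∉ F) (hf : G.EdgeConnectedWithout lam (insert f F))
    (hloop : G.tail f = G.head f) (e : Fin G.m) : ¬ G.Blocked lam F f e := fun he => by
  obtain ⟨S, h1, h2, -⟩ := he.exists_tight hfF hf
  exact h2 (hloop ▸ h1)

open Classical in
/-- The deletable edges that belong to `F` or can no longer be deleted from `G - F`. -/
noncomputable def settled (G : MGraph) (lam : ℕ) (F : Finset (Fin G.m)) : Finset (Fin G.m) :=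
  Finset.univ.filter fun e => G.Deletable lam e ∧
    (e ∈ F ∨ ¬ G.EdgeConnectedWithout lam (insert e F))

open Classical in
-- When `f` joins `F`, the newly settled edges are `f` and those it blocks. This is the bookkeeping
-- behind the total bounds.
theorem settled_insert_subset :
    G.settled lam (insert f F) ⊆
      insert f (G.settled lam F ∪ Finset.univ.filter fun e => G.Blocked lam F f e) := by
  intro e he
  simp only [settled, Finset.mem_filter, Finset.mem_univ, true_and, Finset.mem_insert,
    Finset.mem_union] at he ⊢
  unfold Blocked
  tauto

open Classical in
theorem Bounded.settled_insert {b₁ b₂ b₃ c : ℕ}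
    (h : G.Bounded lam R (G.settled lam F) (c * (b₁ + 1)) (c * (b₂ + 1)) (c * (b₃ + 1)))
    (hB : G.Bounded lam R (Finset.univ.filter fun e => G.Blocked lam F f e) b₁ b₂ b₃) :
    G.Bounded lam R (G.settled lam (insert f F)) ((c + 1) * (b₁ + 1)) ((c + 1) * (b₂ + 1))
      ((c + 1) * (b₃ + 1)) := by
  have key : (G.settled lam (insert f F)).card ≤ (G.settled lam F).card +
      (Finset.univ.filter fun e => G.Blocked lam F f e).card + 1 := by
    refine (Finset.card_le_card settled_insert_subset).trans ((Finset.card_insert_le _ _).trans ?_)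
    exact Nat.succ_le_succ (Finset.card_union_le _ _)
  refine ⟨fun hd => ?_, fun hd he => ?_, fun hd => ?_⟩
  · have h1 := h.1 hd
    have h2 := hB.1 hd
    rw [add_one_mul]
    omega
  · have h1 := h.2.1 hd he
    have h2 := hB.2.1 hd he
    rw [add_one_mul]
    omega
  · have h1 := h.2.2 hd
    have h2 := hB.2.2 hd
    have h3 : (G.settled lam (insert f F) \ R).card ≤ (G.settled lam F \ R).card +
        ((Finset.univ.filter fun e => G.Blocked lam F f e) \ R).card + 1 := by
      refine (Finset.card_le_card (t := insert f ((G.settled lam F \ R) ∪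
        ((Finset.univ.filter fun e => G.Blocked lam F f e) \ R))) fun e he => ?_).trans
        ((Finset.card_insert_le _ _).trans (Nat.succ_le_succ (Finset.card_union_le _ _)))
      have := settled_insert_subset (Finset.mem_sdiff.mp he).1
      have heR := (Finset.mem_sdiff.mp he).2
      simp only [Finset.mem_insert, Finset.mem_union, Finset.mem_sdiff, heR, not_false_eq_true,
        and_true] at this ⊢
      exact this
    rw [add_one_mul]
    omega

theorem coe_settled (h : ∀ e, e ∈ F ∨ ¬ G.EdgeConnectedWithout lam (insert e F)) :
    (G.settled lam F : Set (Fin G.m)) = {e | G.Deletable lam e} := by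
  ext e
  simp [settled, h e]

/-- The final answer is correct if every edge is settled. -/
theorem Bounded.fewDeletable {c : ℕ} (hlam : 1 ≤ lam) (hc : c < k)
    (h : ∀ e, e ∈ F ∨ ¬ G.EdgeConnectedWithout lam (insert e F))
    (hB : G.Bounded lam R (G.settled lam F) (c * (lam * (k - 1) + 1)) (c * (lam * (2 * (k - 1)) + 1))
      (c * (lam * ((2 * k + 1) * (3 * (k - 1))) + 1))) :
    {e | G.Deletable lam e ∧ e ∉ R}.ncard ≤ 7 * lam * k ^ 3 ∧
      (G.directed = true → {e | G.Deletable lam e}.ncard ≤ lam * k ^ 2) ∧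
      (G.directed = false → Even lam → {e | G.Deletable lam e}.ncard ≤ 2 * lam * k ^ 2) := by
  classical
  obtain ⟨q, rfl⟩ : ∃ q, k = q + 1 := ⟨k - 1, by omega⟩
  obtain ⟨p, rfl⟩ : ∃ p, lam = p + 1 := ⟨lam - 1, by omega⟩
  simp only [Nat.add_sub_cancel] at hB
  have hcq : c ≤ q := by omega
  have h1 : c * ((p + 1) * q + 1) ≤ (p + 1) * (q + 1) ^ 2 :=
    (Nat.mul_le_mul_right _ hcq).trans (by nlinarith [Nat.zero_le (p * q)])
  have h2 : c * ((p + 1) * (2 * q) + 1) ≤ 2 * (p + 1) * (q + 1) ^ 2 :=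
    (Nat.mul_le_mul_right _ hcq).trans (by nlinarith [Nat.zero_le (p * q)])
  -- The cubic coefficient of the product is 6, so 7 leaves room for the lower terms.
  have h3 : c * ((p + 1) * ((2 * (q + 1) + 1) * (3 * q)) + 1) ≤ 7 * (p + 1) * (q + 1) ^ 3 := by
    refine (Nat.mul_le_mul_right _ hcq).trans ?_
    have : 7 * (p + 1) * (q + 1) ^ 3 = q * ((p + 1) * ((2 * (q + 1) + 1) * (3 * q)) + 1) +
        ((p + 1) * (q ^ 3 + 12 * q ^ 2 + 20 * q + 7) + p * q) := by ring
    rw [this]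
    omega
  have h4 : (p + 1) * (q + 1) ^ 2 ≤ 7 * (p + 1) * (q + 1) ^ 3 := by
    calc (p + 1) * (q + 1) ^ 2 ≤ (p + 1) * (q + 1) ^ 3 :=
          Nat.mul_le_mul_left _ (Nat.pow_le_pow_right (by omega) (by omega))
      _ ≤ 7 * ((p + 1) * (q + 1) ^ 3) := by omega
      _ = _ := by ring
  have e1 : {e | G.Deletable (p + 1) e} = (G.settled (p + 1) F : Set (Fin G.m)) := (coe_settled h).symm
  have e2 : {e | G.Deletable (p + 1) e ∧ e ∉ R} = ((G.settled (p + 1) F \ R : Finset (Fin G.m)) : Set _) := by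
    rw [Finset.coe_sdiff, ← e1]
    rfl
  rw [e1, e2, Set.ncard_coe_finset, Set.ncard_coe_finset]
  refine ⟨?_, fun hd => (hB.1 hd).trans h1, fun hd he => (hB.2.1 hd he).trans h2⟩
  cases hd : G.directed
  · exact (hB.2.2 hd).trans h3
  -- For digraphs the cubic bound follows from the quadratic one.
  · exact (Finset.card_le_card Finset.sdiff_subset).trans ((hB.1 hd).trans (h1.trans h4))

end

end MGraph

/-! ### Tests and the decomposition of the blocked edges -/

namespace RExpr

theorem holds_add (σ : Store) (x y : RExpr) : (add x y).Holds σ ↔ x.Holds σ ∨ y.Holds σ := by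
  simp only [Holds, eval]
  omega

end RExpr

namespace Algo

open BProg RExpr MGraph

variable {G : MGraph} {lam k : ℕ} {R F : Finset (Fin G.m)} {f : Fin G.m} {σ τ : Store}

/-- Counts, in variable `b`, the edges for which the condition `x` holds. The edge is in
variable `c`. -/
def countProg (c b : ℕ) (x : RExpr) : BProg := block [
  assign b (lit 0),
  forLt c 2 (when x (assign b (add (var b) (lit 1))))]

theorem countProg_spec {c b : ℕ} {x : RExpr} (h : HasInput G lam k R σ) (hc : 4 ≤ c)
    (hb : 4 ≤ b) (hcb : c ≠ b) {P : Fin G.m → Prop} [DecidablePred P]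
    (hx : ∀ (e : Fin G.m) (τ : Store), τ c 0 = e → (∀ a, a ≠ c → a ≠ b → τ a = σ a) →
      (x.Holds τ ↔ P e)) :
    (countProg c b x).ex σ b 0 = (Finset.univ.filter P).card := by
  simp only [countProg, ex_block_cons, ex_block_nil, ex_assign, eval_lit]
  have h' : HasInput G lam k R (σ.upd b 0 0) := h.upd hb _ _
  have hfr : ∀ a, a ≠ b → σ.upd b 0 0 a = σ a := fun a ha => Store.upd_ne _ _ ha
  have h0 : σ.upd b 0 0 b 0 = 0 := by simp [Store.upd_self]
  generalize σ.upd b 0 0 = ρ at *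
  have key := forLt_rule (c := c) (j := 2) (p := when x (assign b (add (var b) (lit 1)))) (σ := ρ)
    (by simp [wf, when, assign, writes, hcb]; omega) (by rw [h'.m, h'.bound]; omega)
    (fun i τ => τ b 0 = (Finset.univ.filter fun e : Fin G.m => P e ∧ e < i).card)
    (fun i τ v => by simp only [Store.upd_ne _ _ hcb.symm]; exact id)
    (by simp [h0]) (by
      intro i τ hi hcnt hfr' hI
      rw [h'.m] at hi
      have hxi := hx ⟨i, hi⟩ τ hcnt fun a h1 h2 => by
        rw [hfr' a (by simp [writes, when, assign, h1, h2]), hfr a h2]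
      have hsplit : (Finset.univ.filter fun e : Fin G.m => P e ∧ e < i + 1) =
          (Finset.univ.filter fun e : Fin G.m => P e ∧ e < i) ∪
            if P ⟨i, hi⟩ then {⟨i, hi⟩} else ∅ := by
        ext e
        by_cases hei : e = ⟨i, hi⟩
        · subst hei
          by_cases hp : P ⟨i, hi⟩ <;> simp [hp]
        · have : (e : ℕ) ≠ i := fun h => hei (Fin.ext h)
          have h2 : e ∉ (if P ⟨i, hi⟩ then {⟨i, hi⟩} else ∅ : Finset (Fin G.m)) := by
            split_ifs <;> simp [hei]
          simp only [Finset.mem_filter, Finset.mem_univ, true_and, Finset.mem_union, h2, or_false]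
          exact and_congr_right fun _ => by omega
      by_cases hp : P ⟨i, hi⟩
      · rw [ex_when_of (hxi.mpr hp), hsplit, if_pos hp, Finset.card_union_of_disjoint (by simp),
          Finset.card_singleton, ← hI]
        simp [Store.upd_self]
      · rw [ex_when_of_not fun h => hp (hxi.mp h), hsplit, if_neg hp, Finset.union_empty, hI])
  rw [key, h'.m]
  simp

/-- Tests, in variable 12, whether the graph remains connected when the edges with the property `x`
are deleted. The edge is in variable 43. -/
def testProg (x : RExpr) : BProg := block [mapProg 43 7 x, connProg]

theorem testProg_spec {x : RExpr} (h : HasInput G lam k R σ) {A : Finset (Fin G.m)}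
    (hx : ∀ (e : Fin G.m) (τ : Store), τ 43 0 = e → (∀ a, a ≠ 43 → a ≠ 7 → τ a = σ a) →
      (x.Holds τ ↔ e ∈ A)) :
    ((testProg x).ex σ 12 0 ≠ 0 ↔ G.EdgeConnectedWithout lam A) ∧
      edgeSet G ((testProg x).ex σ 7) = A := by
  simp only [testProg, ex_block_cons, ex_block_nil]
  have h1 := edgeSet_mapProg h (by omega) (by omega) (by omega) hx
  have h2 : HasInput G lam k R ((mapProg 43 7 x).ex σ) := h.congr fun a ha =>
    mapProg_frame (by omega) (by omega)
  rw [connProg_spec h2, h1, ex_frame (p := connProg) (a := 7) (by decide), h1]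
  exact ⟨Iff.rfl, rfl⟩

/-- The memory contains the input, the set `F` (in array 6) and the edge `f` (in variable 50). -/
structure HasState (G : MGraph) (lam k : ℕ) (R F : Finset (Fin G.m)) (f : Fin G.m) (σ : Store) :
    Prop where
  input : HasInput G lam k R σ
  mem : ∀ e : Fin G.m, σ 6 e ≠ 0 ↔ e ∈ F
  cur : σ 50 0 = f

theorem HasState.congr (h : HasState G lam k R F f σ)
    (h' : ∀ a ∈ [0, 1, 2, 3, 6, 50], τ a = σ a) : HasState G lam k R F f τ := by
  refine ⟨h.input.congr fun a ha => h' a ?_, ?_, ?_⟩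
  · interval_cases a <;> simp
  · rw [h' 6 (by simp)]; exact h.mem
  · rw [h' 50 (by simp)]; exact h.cur

theorem HasState.ex (h : HasState G lam k R F f σ) {p : BProg}
    (hp : ∀ a ∈ [0, 1, 2, 3, 6, 50], a ∉ p.writes) : HasState G lam k R F f (p.ex σ) :=
  h.congr fun a ha => ex_frame (hp a ha)

/-- The condition that the edge in variable 43 belongs to `F`. -/
def inF : RExpr := get 6 (var 43)

/-- The condition that the edge in variable 43 is the one in variable `c`. -/
def isE (c : ℕ) : RExpr := .eq (var 43) (var c)

theorem HasState.holds_inF (h : HasState G lam k R F f σ) {e : Fin G.m} (he : τ 43 0 = e)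
    (h6 : τ 6 = σ 6) : inF.Holds τ ↔ e ∈ F := by
  rw [inF, holds_get, eval_var, he, h6, h.mem]

theorem holds_isE {c : ℕ} {e e' : Fin G.m} (he : τ 43 0 = e) (he' : τ c 0 = e') :
    (isE c).Holds τ ↔ e = e' := by
  rw [isE, holds_eq, eval_var, eval_var, he, he', Fin.ext_iff]

/-- Tests whether the edge in variable 51 is blocked by the edge in variable 50. -/
def blockedEdge : BProg := block [
  testProg (add (isE 51) inF),
  assign 27 (var 12),
  testProg (add (isE 51) (add (isE 50) inF)),
  set 15 (var 51) (.and (var 27) (.not (var 12)))]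

/-- Computes, in array 15, the edges that are blocked by the edge in variable 50. -/
def blockedProg : BProg := forLt 51 2 blockedEdge

theorem blockedEdge_spec (h : HasState G lam k R F f σ) {e : Fin G.m} (he : σ 51 0 = e) :
    ∃ v, blockedEdge.ex σ 15 = Function.update (σ 15) e v ∧ (v ≠ 0 ↔ G.Blocked lam F f e) := by
  simp only [blockedEdge, ex_block_cons, ex_block_nil]
  obtain ⟨t1, -⟩ := testProg_spec (x := add (isE 51) inF) h.input (A := insert e F) (by
    intro e' τ he' hτ
    rw [holds_add, h.holds_inF he' (hτ 6 (by omega) (by omega)),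
      holds_isE he' (by rw [hτ 51 (by omega) (by omega), he]), Finset.mem_insert])
  have hfr : ∀ a, a ∉ (testProg (add (isE 51) inF)).writes →
    (testProg (add (isE 51) inF)).ex σ a = σ a := fun a ha => ex_frame ha
  have h1 : HasState G lam k R F f ((testProg (add (isE 51) inF)).ex σ) := h.ex (by decide)
  have e15 := hfr 15 (by decide)
  have e51 := hfr 51 (by decide)
  clear hfr
  generalize (testProg (add (isE 51) inF)).ex σ = σ₁ at *
  simp only [ex_assign, eval_var]
  have hfr : ∀ a, a ≠ 27 → σ₁.upd 27 0 (σ₁ 12 0) a = σ₁ a := fun a ha => Store.upd_ne _ _ ha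
  have e27 : σ₁.upd 27 0 (σ₁ 12 0) 27 0 = σ₁ 12 0 := by simp [Store.upd_self]
  generalize σ₁.upd 27 0 (σ₁ 12 0) = σ₂ at *
  have h2 : HasState G lam k R F f σ₂ := h1.congr fun a ha => hfr a (by rintro rfl; simp at ha)
  rw [← hfr 15 (by omega)] at e15
  rw [← hfr 51 (by omega)] at e51
  obtain ⟨t2, -⟩ := testProg_spec (x := add (isE 51) (add (isE 50) inF)) h2.input
    (A := insert e (insert f F)) (by
      intro e' τ he' hτ
      rw [holds_add, holds_add, h2.holds_inF he' (hτ 6 (by omega) (by omega)),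
        holds_isE he' (by rw [hτ 51 (by omega) (by omega), e51, he]),
        holds_isE he' (by rw [hτ 50 (by omega) (by omega), h2.cur]), Finset.mem_insert,
        Finset.mem_insert])
  have hfr' : ∀ a, a ∉ (testProg (add (isE 51) (add (isE 50) inF))).writes →
    (testProg (add (isE 51) (add (isE 50) inF))).ex σ₂ a = σ₂ a := fun a ha => ex_frame ha
  have d15 := hfr' 15 (by decide)
  have d51 := hfr' 51 (by decide)
  have d27 := hfr' 27 (by decide)
  generalize (testProg (add (isE 51) (add (isE 50) inF))).ex σ₂ = σ₃ at *
  refine ⟨(RExpr.and (var 27) (.not (var 12))).eval σ₃, ?_, ?_⟩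
  · rw [ex_set, Store.upd_self, eval_var, d51, e51, he, d15, e15]
  · change RExpr.Holds σ₃ _ ↔ _
    rw [holds_and, holds_not, holds_var, eval_var, d27, e27, t1, Blocked, ← t2, not_not]

theorem blockedProg_spec (h : HasState G lam k R F f σ) (e : Fin G.m) :
    blockedProg.ex σ 15 e ≠ 0 ↔ G.Blocked lam F f e := by
  have key := forLt_rule (c := 51) (j := 2) (p := blockedEdge) (σ := σ) (by decide)
    (by rw [h.input.m, h.input.bound]; omega)
    (fun i τ => ∀ e : Fin G.m, e < i → (τ 15 e ≠ 0 ↔ G.Blocked lam F f e))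
    (fun i τ v => by simp only [Store.upd_ne _ _ (show 15 ≠ 51 by omega)]; exact id)
    (fun e he => absurd he (by omega)) (by
      intro i τ hi hcnt hfr hI e he
      rw [h.input.m] at hi
      obtain ⟨v, h1, h2⟩ := blockedEdge_spec (e := ⟨i, hi⟩) (h.congr (τ := τ) fun a ha => hfr a
        ((by decide : ∀ a ∈ [0, 1, 2, 3, 6, 50], a ∉ (forN 51 blockedEdge).writes) a ha)) hcnt
      rw [h1, update_apply_fin]
      split_ifs with hei
      · rw [hei]; exact h2
      · exact hI e (lt_of_le_of_ne (Nat.lt_succ_iff.mp he) fun h => hei (Fin.ext h)))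
  rw [h.input.m] at key
  exact key e e.2

/-- The memory also contains the blocked edges (in array 15), a flow between the ends of `f` (in
array 16) and its decomposition (in arrays 17 and 18). -/
structure HasFlow (G : MGraph) (lam k : ℕ) (R F : Finset (Fin G.m)) (f : Fin G.m) (σ : Store) :
    Prop extends HasState G lam k R F f σ where
  blocked : ∀ e : Fin G.m, σ 15 e ≠ 0 ↔ G.Blocked lam F f e
  flow : G.IsFlow (insert f F) (flowOf G (σ 16)) (G.tail f) (G.head f) lam
  dec : G.IsDecomposition (insert f F) (flowOf G (σ 16)) (G.tail f) (G.head f) lam (σ 17) (σ 18)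

theorem HasFlow.congr (h : HasFlow G lam k R F f σ)
    (h' : ∀ a ∈ [0, 1, 2, 3, 6, 50, 15, 16, 17, 18], τ a = σ a) : HasFlow G lam k R F f τ := by
  refine ⟨h.toHasState.congr fun a ha => h' a ?_, ?_, ?_, ?_⟩
  · simp only [List.mem_cons, List.not_mem_nil, or_false] at ha ⊢
    omega
  · rw [h' 15 (by simp)]; exact h.blocked
  · rw [h' 16 (by simp)]; exact h.flow
  · rw [h' 16 (by simp), h' 17 (by simp), h' 18 (by simp)]; exact h.dec

theorem HasFlow.ex (h : HasFlow G lam k R F f σ) {p : BProg}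
    (hp : ∀ a ∈ [0, 1, 2, 3, 6, 50, 15, 16, 17, 18], a ∉ p.writes) :
    HasFlow G lam k R F f (p.ex σ) :=
  h.congr fun a ha => ex_frame (hp a ha)

/-- Computes and decomposes a flow between the ends of the edge in variable 50. -/
def decompProg : BProg := block [
  mapProg 43 7 (add (isE 50) inF),
  assign 13 (tl 50),
  assign 14 (hd 50),
  flowProg,
  labelProg,
  mapProg 43 16 (get 8 (var 43))]

/-- Once two vertices exist, a single vertex has `lam` edges leaving it. This is why loops over the
trails have polynomial length although `lam` is given in binary. -/
theorem lam_le_of_ne {u v : Fin G.n} (huv : u ≠ v) (hF : G.EdgeConnectedWithout lam F) :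
    lam ≤ G.m :=
  (edgeConnectedWithout_iff.mp hF {u} u v (by simp) (by simpa using huv.symm)).trans (cut_le _ _)

theorem flowOf_congr {x y : ℕ → ℕ} (h : ∀ e : Fin G.m, x e = y e) : flowOf G x = flowOf G y := by
  ext e
  rw [flowOf, flowOf, h]

theorem decompProg_spec (h : HasState G lam k R F f σ)
    (hb : ∀ e : Fin G.m, σ 15 e ≠ 0 ↔ G.Blocked lam F f e) (hne : G.tail f ≠ G.head f)
    (hf : G.EdgeConnectedWithout lam (insert f F)) : HasFlow G lam k R F f (decompProg.ex σ) := by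
  suffices hmain : G.IsFlow (insert f F) (flowOf G (decompProg.ex σ 16)) (G.tail f) (G.head f) lam ∧
      G.IsDecomposition (insert f F) (flowOf G (decompProg.ex σ 16)) (G.tail f) (G.head f) lam
        (decompProg.ex σ 17) (decompProg.ex σ 18) by
    refine ⟨h.ex (by decide), ?_, hmain.1, hmain.2⟩
    rw [ex_frame (p := decompProg) (a := 15) (by decide)]
    exact hb
  simp only [decompProg, ex_block_cons, ex_block_nil]
  have h7 := edgeSet_mapProg (c := 43) (b := 7) (x := add (isE 50) inF) h.input (by omega) (by omega)
    (by omega) (A := insert f F) (by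
      intro e' τ he' hτ
      rw [holds_add, h.holds_inF he' (hτ 6 (by omega) (by omega)),
        holds_isE he' (by rw [hτ 50 (by omega) (by omega), h.cur]), Finset.mem_insert])
  have h1 : HasState G lam k R F f ((mapProg 43 7 (add (isE 50) inF)).ex σ) := h.ex (by decide)
  generalize (mapProg 43 7 (add (isE 50) inF)).ex σ = σ₁ at *
  obtain ⟨σ₂, hσ₂⟩ : ∃ σ₂, (assign 14 (hd 50)).ex ((assign 13 (tl 50)).ex σ₁) = σ₂ := ⟨_, rfl⟩
  rw [hσ₂]
  simp only [ex_assign, eval_hd, eval_tl, Store.upd_ne _ _ (show 2 ≠ 13 by omega),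
    Store.upd_ne _ _ (show 50 ≠ 13 by omega), h1.cur, h1.input.tail, h1.input.head] at hσ₂
  have hfr : ∀ a, a ≠ 13 → a ≠ 14 → σ₂ a = σ₁ a := fun a a1 a2 => by
    rw [← hσ₂, Store.upd_ne _ _ a2, Store.upd_ne _ _ a1]
  have h13 : σ₂ 13 0 = G.tail f := by
    rw [← hσ₂, Store.upd_ne _ _ (by omega)]; simp [Store.upd_self]
  have h14 : σ₂ 14 0 = G.head f := by rw [← hσ₂]; simp [Store.upd_self]
  have h2 : HasInput G lam k R σ₂ := h1.input.congr fun a ha => hfr a (by omega) (by omega)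
  rw [← hfr 7 (by omega) (by omega)] at h7
  clear hσ₂ hfr
  obtain ⟨f1, f2⟩ := flowProg_spec h2 hne h13 h14
  rw [h7] at f1 f2
  have h3 : HasInput G lam k R (flowProg.ex σ₂) := h2.ex (by decide)
  rw [← ex_frame (p := flowProg) (σ := σ₂) (a := 13) (by decide)] at h13
  rw [← ex_frame (p := flowProg) (σ := σ₂) (a := 14) (by decide)] at h14
  generalize flowProg.ex σ₂ = σ₃ at *
  -- Since `G - F - f` is still `lam`-edge-connected, no smaller cut stops the flow.
  have hval : σ₃ 11 0 = lam := f2.resolve_right fun ⟨_, S, hs, ht, hlt⟩ =>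
    absurd (edgeConnectedWithout_iff.mp hf S _ _ hs ht) (by omega)
  rw [hval] at f1
  have hd := labelProg_spec h3 (lam_le_of_ne hne hf) h13 h14 f1
  have h4 : HasInput G lam k R (labelProg.ex σ₃) := h3.ex (by decide)
  rw [← ex_frame (p := labelProg) (a := 8) (σ := σ₃) (by decide)] at f1 hd
  generalize labelProg.ex σ₃ = σ₄ at *
  have h16 := mapProg_spec (c := 43) (b := 16) (x := get 8 (var 43)) h4 (by omega) (by omega)
    (by omega) (g := fun e => σ₄ 8 e) (by
      intro e τ he hτ
      rw [eval_get, eval_var, he, hτ 8 (by omega) (by omega)])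
  rw [flowOf_congr h16, mapProg_frame (a := 17) (by omega) (by omega),
    mapProg_frame (a := 18) (by omega) (by omega)]
  exact ⟨f1, hd⟩

end Algo

/-! ### Greedy selection along the trails -/

namespace Algo

open BProg RExpr MGraph

variable {G : MGraph} {lam k : ℕ} {R F : Finset (Fin G.m)} {f : Fin G.m} {σ τ : Store}

/-- The memory holds a correct answer of the first or second kind. -/
def Found (G : MGraph) (lam k : ℕ) (R : Finset (Fin G.m)) (σ : Store) : Prop :=
  ∃ ans : Answer G.m, ans ≠ Answer.fewDeletable ∧ ans.HeldBy σ ∧ G.IsAnswer lam k R ans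

theorem Found.congr (h : Found G lam k R σ) (h4 : τ 4 = σ 4) (h5 : τ 5 = σ 5) :
    Found G lam k R τ := by
  obtain ⟨ans, h1, h2, h3⟩ := h
  refine ⟨ans, h1, ?_, h3⟩
  cases ans <;> simpa [Answer.HeldBy, h4, h5] using h2

/-- Either an answer has been found, as indicated by variable 23, or `Q` holds. -/
def FoundOr (G : MGraph) (lam k : ℕ) (R : Finset (Fin G.m)) (Q : Prop) (σ : Store) : Prop :=
  (σ 23 0 ≠ 0 → Found G lam k R σ) ∧ (σ 23 0 = 0 → Q)

theorem FoundOr.congr {Q : Prop} (h : FoundOr G lam k R Q σ) (h4 : τ 4 = σ 4) (h5 : τ 5 = σ 5)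
    (h23 : τ 23 = σ 23) : FoundOr G lam k R Q τ := by
  unfold FoundOr
  rw [h23]
  exact ⟨fun h' => (h.1 h').congr h4 h5, h.2⟩

theorem FoundOr.imp {Q Q' : Prop} (h : FoundOr G lam k R Q σ) (hQ : σ 23 0 = 0 → Q → Q') :
    FoundOr G lam k R Q' σ :=
  ⟨h.1, fun h0 => hQ h0 (h.2 h0)⟩

/-- Outputs the deletion set in array `a`. -/
def outputSet (a : ℕ) : BProg := block [
  mapProg 43 5 (get a (var 43)), assign 4 (lit 0), assign 23 (lit 1)]

theorem outputSet_spec {a : ℕ} (h : HasInput G lam k R σ) (ha : a ≠ 43) (ha' : a ≠ 5)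
    (hdel : G.IsDeletionSet lam k (edgeSet G (σ a))) (Q : Prop) :
    FoundOr G lam k R Q ((outputSet a).ex σ) := by
  have h5 := edgeSet_mapProg (c := 43) (b := 5) (x := get a (var 43)) h (by omega) (by omega)
    (by omega) (A := edgeSet G (σ a)) (by
      intro e τ he hτ
      rw [holds_get, eval_var, he, hτ a ha ha', mem_edgeSet])
  simp only [outputSet, ex_block_cons, ex_block_nil, ex_assign, eval_lit]
  refine ⟨fun _ => ⟨.deletionSet (edgeSet G (σ a)), by simp, ⟨?_, fun e => ?_⟩, hdel.isAnswer⟩, ?_⟩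
  · simp [Store.upd_ne, Store.upd_self]
  · rw [Store.upd_ne _ _ (by omega), Store.upd_ne _ _ (by omega), ← h5, mem_edgeSet]
  · simp [Store.upd_self]

/-- Adds the edge in variable 54 to the set in array 20 if the graph remains connected. -/
def greedyAdd : BProg := block [
  testProg (add (isE 54) (add (get 20 (var 43)) inF)),
  when (var 12) (block [
    set 20 (var 54) (lit 1),
    assign 21 (add (var 21) (lit 1)),
    when (.eq (var 21) (get 0 (lit 4))) (outputSet 20)])]

/-- Treats the edge in variable 54 if it is a blocked edge whose label and position are given by
variables 52 and 53. -/
def greedyEdge : BProg :=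
  when (.and (.not (var 23)) (.and (get 15 (var 54))
    (.and (.eq (get 17 (var 54)) (add (var 52) (lit 1))) (.eq (get 18 (var 54)) (var 53)))))
    greedyAdd

/-- Greedy selection among the edges with a given label. -/
def greedyTrail : BProg := when (.not (var 23)) (block [
  mapProg 43 20 (lit 0),
  assign 21 (lit 0),
  forLt 53 2 (forLt 54 2 greedyEdge)])

/-- Greedy selection on all trails. -/
def greedyProg : BProg := forLt 52 3 greedyTrail

/-- The invariant of the greedy selection. -/
def GreedyInv (k : ℕ) (R : Finset (Fin G.m)) (L : G.Ladder lam F) (P : Fin G.m → Prop)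
    (σ : Store) : Prop :=
  FoundOr G lam k R (L.IsGreedyOn P (edgeSet G (σ 20)) ∧
    σ 21 0 = (edgeSet G (σ 20)).card ∧ σ 21 0 < k) σ

variable {L : G.Ladder lam F} {P Q : Fin G.m → Prop}

theorem GreedyInv.congr (h : GreedyInv k R L P σ)
    (h' : ∀ a ∈ [4, 5, 20, 21, 23], τ a = σ a) : GreedyInv k R L P τ := by
  unfold GreedyInv
  rw [h' 20 (by simp), h' 21 (by simp)]
  exact FoundOr.congr h (h' 4 (by simp)) (h' 5 (by simp)) (h' 23 (by simp))

theorem GreedyInv.mono (h : GreedyInv k R L P σ) (hPQ : ∀ e ∈ L.Z, P e ↔ Q e) :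
    GreedyInv k R L Q σ :=
  FoundOr.imp h fun _ h' => ⟨h'.1.congr hPQ, h'.2⟩

/-- The two outcomes of the test are the two ways of extending `IsGreedyOn` by one edge. If `k`
edges have been selected, they are output at once. -/
theorem greedyAdd_spec (h : HasState G lam k R F f σ) (h23 : σ 23 0 = 0) {e : Fin G.m}
    (he : σ 54 0 = e) (heZ : e ∈ L.Z) (hPe : ¬ P e) (hP : ∀ e' ∈ L.Z, P e' → L.pos e' ≤ L.pos e)
    (hI : GreedyInv k R L P σ) :
    GreedyInv k R L (fun e' => P e' ∨ e' = e) (greedyAdd.ex σ) := by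
  obtain ⟨i1, i2, i3⟩ := hI.2 h23
  simp only [greedyAdd, ex_block_cons, ex_block_nil]
  obtain ⟨t1, -⟩ := testProg_spec (x := add (isE 54) (add (get 20 (var 43)) inF)) h.input
    (A := F ∪ insert e (edgeSet G (σ 20))) (by
      intro e' τ he' hτ
      rw [holds_add, holds_add, h.holds_inF he' (hτ 6 (by omega) (by omega)),
        holds_isE he' (by rw [hτ 54 (by omega) (by omega), he]), holds_get, eval_var, he',
        hτ 20 (by omega) (by omega), Finset.mem_union, Finset.mem_insert, mem_edgeSet]
      tauto)
  have hfr : ∀ a, a ∉ (testProg (add (isE 54) (add (get 20 (var 43)) inF))).writes →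
    (testProg (add (isE 54) (add (get 20 (var 43)) inF))).ex σ a = σ a := fun a ha => ex_frame ha
  have h1 : HasInput G lam k R ((testProg (add (isE 54) (add (get 20 (var 43)) inF))).ex σ) :=
    h.input.ex (by decide)
  have e20 := hfr 20 (by decide)
  have e21 := hfr 21 (by decide)
  have e23 := hfr 23 (by decide)
  have e54 := hfr 54 (by decide)
  clear hfr
  generalize (testProg (add (isE 54) (add (get 20 (var 43)) inF))).ex σ = σ₁ at *
  by_cases hc : (var 12).Holds σ₁
  · rw [ex_when_of hc]
    have hconn := t1.mp hc
    simp only [ex_block_cons, ex_block_nil]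
    obtain ⟨σ₂, hσ₂⟩ : ∃ σ₂, (assign 21 (add (var 21) (lit 1))).ex
      ((set 20 (var 54) (lit 1)).ex σ₁) = σ₂ := ⟨_, rfl⟩
    rw [hσ₂]
    simp only [ex_assign, ex_set, eval_add, eval_var, eval_lit, e54, he,
      Store.upd_ne _ _ (show 21 ≠ 20 by omega), e21] at hσ₂
    have heD : e ∉ edgeSet G (σ 20) := fun h => hPe (i1.mem e h)
    have d20 : edgeSet G (σ₂ 20) = insert e (edgeSet G (σ 20)) := by
      rw [← hσ₂, Store.upd_ne _ _ (by omega), Store.upd_self, e20]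
      ext e'
      rw [mem_edgeSet, update_apply_fin, Finset.mem_insert, mem_edgeSet]
      split_ifs with h' <;> simp [h']
    have d21 : σ₂ 21 0 = (edgeSet G (σ₂ 20)).card := by
      rw [d20, Finset.card_insert_of_notMem heD, ← i2, ← hσ₂]
      simp [Store.upd_self]
    have d21' : σ₂ 21 0 = σ 21 0 + 1 := by
      rw [← hσ₂]
      simp [Store.upd_self]
    have d23 : σ₂ 23 0 = 0 := by
      rw [← hσ₂, Store.upd_ne _ _ (by omega), Store.upd_ne _ _ (by omega), e23, h23]
    have h2 : HasInput G lam k R σ₂ := by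
      rw [← hσ₂]
      exact (h1.upd (by omega) _ _).upd (by omega) _ _
    clear hσ₂
    by_cases hk : (RExpr.eq (var 21) (get 0 (lit 4))).Holds σ₂
    · rw [ex_when_of hk]
      simp only [holds_eq, eval_var, eval_get, eval_lit, h2.k_eq] at hk
      refine outputSet_spec h2 (by omega) (by omega) ⟨by rw [← d21, hk], ?_⟩ _
      rw [d20]
      -- The selection can be deleted together with `F`, hence also alone.
      exact hconn.anti Finset.subset_union_right
    · rw [ex_when_of_not hk]
      simp only [holds_eq, eval_var, eval_get, eval_lit, h2.k_eq] at hk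
      refine ⟨fun h => absurd d23 h, fun _ => ⟨?_, d21, by omega⟩⟩
      rw [d20]
      exact i1.insert heZ hP hconn
  · rw [ex_when_of_not hc]
    refine ⟨fun h => absurd (by rw [e23, h23]) h, fun _ => ?_⟩
    rw [e20, e21]
    exact ⟨i1.skip heZ hPe hP fun h => hc (t1.mpr h), i2, i3⟩

theorem greedyEdge_spec (h : HasFlow G lam k R F f σ) {c p : ℕ} (hc : σ 52 0 = c)
    (hp : σ 53 0 = p) {e : Fin G.m} (he : σ 54 0 = e)
    (hZ : ∀ e' : Fin G.m, e' ∈ L.Z ↔ G.Blocked lam F f e' ∧ σ 17 e' = c + 1)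
    (hpos : ∀ e' : Fin G.m, L.pos e' = σ 18 e')
    (hPe : L.pos e = p → ¬ P e) (hP : ∀ e' ∈ L.Z, P e' → L.pos e' ≤ p)
    (hPQ : ∀ e' ∈ L.Z, Q e' ↔ P e' ∨ e' = e ∧ L.pos e = p)
    (hI : GreedyInv k R L P σ) : GreedyInv k R L Q (greedyEdge.ex σ) := by
  unfold greedyEdge
  by_cases hb : (RExpr.and (.not (var 23)) (.and (get 15 (var 54))
    (.and (.eq (get 17 (var 54)) (add (var 52) (lit 1))) (.eq (get 18 (var 54)) (var 53))))).Holds σ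
  · rw [ex_when_of hb]
    simp only [holds_and, holds_not, holds_eq, holds_get, eval_var, eval_get, eval_add, eval_lit,
      he, hc, hp, h.blocked] at hb
    obtain ⟨b1, b2, b3, b4⟩ := hb
    rw [← hpos] at b4
    exact (greedyAdd_spec h.toHasState b1 he ((hZ e).mpr ⟨b2, b3⟩) (hPe b4) (by rwa [b4]) hI).mono
      fun e' he' => by rw [hPQ e' he', b4]; simp
  · rw [ex_when_of_not hb]
    simp only [holds_and, holds_not, holds_eq, holds_get, eval_var, eval_get, eval_add, eval_lit,
      he, hc, hp, h.blocked] at hb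
    refine FoundOr.imp hI fun h0 h' => ⟨h'.1.congr fun e' he' => ?_, h'.2⟩
    rw [hPQ e' he']
    refine (or_iff_left ?_).symm
    rintro ⟨rfl, h1⟩
    obtain ⟨z1, z2⟩ := (hZ e').mp he'
    exact hb ⟨h0, z1, z2, by rw [← hpos, h1]⟩

/-- Instead of sorting, each pass scans all edges and treats those of position `p`. Within a pass
the treated edges grow in the lexicographic order of position and index. -/
theorem greedyRound_spec (h : HasFlow G lam k R F f σ) {c p : ℕ} (hc : σ 52 0 = c)
    (hp : σ 53 0 = p)
    (hZ : ∀ e' : Fin G.m, e' ∈ L.Z ↔ G.Blocked lam F f e' ∧ σ 17 e' = c + 1)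
    (hpos : ∀ e' : Fin G.m, L.pos e' = σ 18 e')
    (hI : GreedyInv k R L (fun e => L.pos e < p) σ) :
    GreedyInv k R L (fun e => L.pos e < p + 1) ((forLt 54 2 greedyEdge).ex σ) := by
  have key := forLt_rule (c := 54) (j := 2) (p := greedyEdge) (σ := σ) (by decide)
    (by rw [h.input.m, h.input.bound]; omega)
    (fun i τ => GreedyInv k R L (fun e => L.pos e < p ∨ L.pos e = p ∧ e < i) τ)
    (fun i τ v hI => hI.congr fun a ha => Store.upd_ne _ _ (by rintro rfl; simp at ha))
    (hI.mono fun e _ => by simp) (by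
      intro i τ hi hcnt hfr hI
      rw [h.input.m] at hi
      refine greedyEdge_spec (e := ⟨i, hi⟩) (c := c) (p := p) (P := fun e =>
        L.pos e < p ∨ L.pos e = p ∧ e < i) (h.congr (τ := τ) fun a ha => hfr a
        ((by decide : ∀ a ∈ [0, 1, 2, 3, 6, 50, 15, 16, 17, 18],
          a ∉ (forN 54 greedyEdge).writes) a ha)) ?_ ?_ hcnt ?_ ?_ ?_ ?_ ?_ hI
      · rw [hfr 52 (by decide), hc]
      · rw [hfr 53 (by decide), hp]
      · rw [hfr 17 (by decide)]; exact hZ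
      · rw [hfr 18 (by decide)]; exact hpos
      · rintro h1 (h2 | ⟨-, h2⟩)
        · omega
        · exact lt_irrefl _ h2
      · rintro e' - (h1 | ⟨h1, -⟩) <;> omega
      · intro e' _
        have h1 : (e' : ℕ) < i + 1 ↔ (e' : ℕ) < i ∨ e' = ⟨i, hi⟩ := by
          rw [Fin.ext_iff]
          exact Nat.lt_succ_iff_lt_or_eq
        rw [h1]
        by_cases h2 : e' = ⟨i, hi⟩
        · simp [h2]
        · simp [h2])
  refine key.mono fun e _ => ?_
  rw [h.input.m]
  have := e.2
  omega

theorem greedyTrail_spec (h : HasFlow G lam k R F f σ) (hk : 1 ≤ k)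
    (hF : G.EdgeConnectedWithout lam F) (h23 : σ 23 0 = 0) {c : ℕ} (hc : σ 52 0 = c)
    (hZ : ∀ e' : Fin G.m, e' ∈ L.Z ↔ G.Blocked lam F f e' ∧ σ 17 e' = c + 1)
    (hpos : ∀ e' : Fin G.m, L.pos e' = σ 18 e') :
    FoundOr G lam k R (∃ D, L.IsGreedy D ∧ D.card < k) (greedyTrail.ex σ) := by
  unfold greedyTrail
  rw [ex_when_of (by simpa using h23)]
  simp only [ex_block_cons, ex_block_nil, ex_assign, eval_lit]
  have e20 : ∀ e : Fin G.m, (mapProg 43 20 (lit 0)).ex σ 20 e = 0 :=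
    mapProg_spec (g := fun _ => 0) h.input (by omega) (by omega) (by omega) fun _ _ _ _ => rfl
  have hfr : ∀ a, a ≠ 43 → a ≠ 20 → a ≠ 21 →
      ((mapProg 43 20 (lit 0)).ex σ).upd 21 0 0 a = σ a := fun a h1 h2 h3 => by
    rw [Store.upd_ne _ _ h3, mapProg_frame h1 h2]
  rw [← Store.upd_ne (σ := (mapProg 43 20 (lit 0)).ex σ) (a := 21) 0 0
    (show 20 ≠ 21 by omega)] at e20
  have e21 : ((mapProg 43 20 (lit 0)).ex σ).upd 21 0 0 21 0 = 0 := by simp [Store.upd_self]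
  generalize ((mapProg 43 20 (lit 0)).ex σ).upd 21 0 0 = ρ at *
  have h' : HasFlow G lam k R F f ρ := h.congr fun a ha => hfr a
    (by rintro rfl; simp at ha) (by rintro rfl; simp at ha) (by rintro rfl; simp at ha)
  have hempty : edgeSet G (ρ 20) = ∅ := by
    ext e
    simp [e20]
  have hrho : ρ 23 0 = 0 := by rw [hfr 23 (by omega) (by omega) (by omega), h23]
  have key := forLt_rule (c := 53) (j := 2) (p := forLt 54 2 greedyEdge) (σ := ρ) (by decide)
    (by rw [h'.input.m, h'.input.bound]; omega)
    (fun p τ => GreedyInv k R L (fun e => L.pos e < p) τ)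
    (fun i τ v hI => hI.congr fun a ha => Store.upd_ne _ _ (by rintro rfl; simp at ha))
    ⟨fun h => absurd hrho h, fun _ => by
      rw [hempty, e21]
      exact ⟨⟨by simp, by simpa using hF, by simp, fun e _ h => absurd h (by omega)⟩, rfl, hk⟩⟩ (by
      intro p τ _ hcnt hfr' hI
      refine greedyRound_spec (c := c) (p := p) (h'.congr (τ := τ) fun a ha => hfr' a
        ((by decide : ∀ a ∈ [0, 1, 2, 3, 6, 50, 15, 16, 17, 18],
          a ∉ (forN 53 (forLt 54 2 greedyEdge)).writes) a ha)) ?_ hcnt ?_ ?_ hI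
      · rw [hfr' 52 (by decide), hfr 52 (by omega) (by omega) (by omega), hc]
      · rw [hfr' 17 (by decide), hfr 17 (by omega) (by omega) (by omega)]; exact hZ
      · rw [hfr' 18 (by decide), hfr 18 (by omega) (by omega) (by omega)]; exact hpos)
  rw [h'.input.m] at key
  refine FoundOr.imp key fun _ h1 => ⟨_, h1.1.isGreedy fun e he => ?_, by omega⟩
  rw [hpos]
  -- Positions are less than `m`, so `m` passes treat the whole ladder.
  exact h.dec.pos_lt e (by have := ((hZ e).mp he).2; omega)

theorem greedyProg_spec (hlam : 1 ≤ lam) (h : HasFlow G lam k R F f σ) (hk : 1 ≤ k)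
    (hF : G.EdgeConnectedWithout lam F) (hfF : f ∉ F)
    (hf : G.EdgeConnectedWithout lam (insert f F)) (hne : G.tail f ≠ G.head f) (h23 : σ 23 0 = 0) :
    FoundOr G lam k R (∀ j (hj : j < lam), ∃ D,
      (ladder hlam hfF hf h.flow (h.dec.isTrail j hj)).IsGreedy D ∧ D.card < k)
      (greedyProg.ex σ) := by
  have key := forLt_rule (c := 52) (j := 3) (p := greedyTrail) (σ := σ) (by decide)
    (by rw [h.input.lam_eq, h.input.bound]; have := lam_le_of_ne hne hF; omega)
    (fun i τ => FoundOr G lam k R (∀ j (hj : j < lam), j < i → ∃ D,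
      (ladder hlam hfF hf h.flow (h.dec.isTrail j hj)).IsGreedy D ∧ D.card < k) τ)
    (fun i τ v hI => hI.congr (Store.upd_ne _ _ (by omega)) (Store.upd_ne _ _ (by omega))
      (Store.upd_ne _ _ (by omega)))
    ⟨fun h => absurd h23 h, fun _ j _ hj => absurd hj (by omega)⟩ (by
      intro c τ hcl hcnt hfr hI
      rw [h.input.lam_eq] at hcl
      by_cases h0 : τ 23 0 = 0
      · refine (greedyTrail_spec (c := c)
          (L := ladder hlam hfF hf h.flow (h.dec.isTrail c hcl)) (h.congr (τ := τ) fun a ha => hfr a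
          ((by decide : ∀ a ∈ [0, 1, 2, 3, 6, 50, 15, 16, 17, 18],
            a ∉ (forN 52 greedyTrail).writes) a ha)) hk hF h0 hcnt ?_ ?_).imp ?_
        · intro e'
          rw [hfr 17 (by decide)]
          simp [ladder, and_comm]
        · rw [hfr 18 (by decide)]
          exact fun _ => rfl
        · intro _ h1 j hj hjc
          rcases Nat.lt_succ_iff_lt_or_eq.mp hjc with hjc | rfl
          · exact hI.2 h0 j hj hjc
          · exact h1
      · have : greedyTrail.ex τ = τ := ex_when_of_not (by simpa using h0)
        rw [this]
        exact ⟨hI.1, fun h => absurd h h0⟩)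
  rw [h.input.lam_eq] at key
  exact key.imp fun _ h1 j hj => h1 j hj hj

end Algo

/-! ### The search for an irrelevant edge -/

namespace Algo

open BProg RExpr MGraph

variable {G : MGraph} {lam k : ℕ} {R F : Finset (Fin G.m)} {f : Fin G.m} {σ τ : Store}

/-- The condition that the edge in variable `c` is blocked and not in `R`. -/
def candidate (c : ℕ) : RExpr := .and (get 15 (var c)) (.not (get 3 (var c)))

/-- The condition that the edge in variable `c` precedes the one in variable `d` on a trail. -/
def before (c d : ℕ) : RExpr :=
  .and (.eq (get 17 (var c)) (get 17 (var d))) (.lt (get 18 (var c)) (get 18 (var d)))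

/-- The edge `e` precedes the edge `e'` on a trail. -/
def Before (lab pos : ℕ → ℕ) {m : ℕ} (e e' : Fin m) : Prop := lab e = lab e' ∧ pos e < pos e'

theorem HasFlow.holds_candidate (h : HasFlow G lam k R F f σ) {c : ℕ} {e : Fin G.m}
    (he : τ c 0 = e) (h3 : τ 3 = σ 3) (h15 : τ 15 = σ 15) :
    (candidate c).Holds τ ↔ G.Blocked lam F f e ∧ e ∉ R := by
  rw [candidate, holds_and, holds_not, holds_get, eval_get, eval_var, he, h3, h15, h.blocked,
    ← h.input.mem, not_not]

theorem holds_before {c d : ℕ} {e e' : Fin G.m} (he : τ c 0 = e) (he' : τ d 0 = e')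
    (h17 : τ 17 = σ 17) (h18 : τ 18 = σ 18) :
    (before c d).Holds τ ↔ Before (σ 17) (σ 18) e e' := by
  rw [before, holds_and, holds_eq, holds_lt]
  simp only [eval_get, eval_var, he, he', h17, h18, Before]

/-- Stores the vertex to which the flow in array 16 goes along the edge in variable `c`. -/
def setTarget (c : ℕ) : BProg :=
  ite (.eq (get 16 (var c)) (lit 2)) (assign 14 (hd c)) (assign 14 (tl c))

theorem setTarget_spec (h : HasInput G lam k R σ) {c : ℕ} {e : Fin G.m} (he : σ c 0 = e) :
    (setTarget c).ex σ = σ.upd 14 0 (G.dst (flowOf G (σ 16)) e) := by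
  unfold setTarget
  by_cases hb : (RExpr.eq (get 16 (var c)) (lit 2)).Holds σ
  · rw [ex_ite_of hb, ex_assign]
    simp only [holds_eq, eval_get, eval_var, eval_lit, he] at hb
    simp [he, h.head, dst, flowOf, hb]
  · rw [ex_ite_of_not hb, ex_assign]
    simp only [holds_eq, eval_get, eval_var, eval_lit, he] at hb
    rw [eval_tl, he, h.tail, dst, if_neg]
    unfold flowOf
    omega

/-- Computes the vertices from which the target of the edge in variable `c` can be reached. -/
def reachProg (c : ℕ) : BProg := block [setTarget c, rankProg]

theorem reachProg_spec (h : HasInput G lam k R σ) {c : ℕ} {e : Fin G.m} (he : σ c 0 = e)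
    {H : Finset (Fin G.m)} (h7 : edgeSet G (σ 7) = H)
    (h8 : flowOf G (σ 8) = flowOf G (σ 16)) (w : Fin G.n) :
    (reachProg c).ex σ 9 w ≠ 0 ↔
      w ∉ G.noReach H (flowOf G (σ 16)) (G.dst (flowOf G (σ 16)) e) := by
  simp only [reachProg, ex_block_cons, ex_block_nil]
  rw [setTarget_spec h he]
  obtain ⟨h1, h2⟩ := rankProg_spec (σ := σ.upd 14 0 (G.dst (flowOf G (σ 16)) e))
    (h.upd (by omega) _ _) (t := G.dst (flowOf G (σ 16)) e) (by simp [Store.upd_self])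
  rw [Store.upd_ne _ _ (by omega), Store.upd_ne _ _ (by omega), h7, h8] at h1 h2
  rw [h1.reach_iff h2]
  simp [noReach]

/-- Counts, in variable 26, the edges of `F` that touch the rung between the edges in variables 55
and 56. -/
def touchProg : BProg := block [
  mapProg 43 7 (add (isE 50) inF),
  mapProg 43 8 (get 16 (var 43)),
  reachProg 55,
  mapProg 43 25 (get 9 (tl 43)),
  mapProg 43 28 (get 9 (hd 43)),
  reachProg 56,
  countProg 57 26 (.and (get 6 (var 57)) (add
    (.and (.not (get 9 (tl 57))) (get 25 (var 57)))
    (.and (.not (get 9 (hd 57))) (get 28 (var 57)))))]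

theorem touchProg_spec (h : HasFlow G lam k R F f σ) {l t : Fin G.m} (hl : σ 55 0 = l)
    (ht : σ 56 0 = t) : touchProg.ex σ 26 0 = 0 ↔
      ∀ g ∈ F, G.tail g ∉ G.noReach (insert f F) (flowOf G (σ 16)) (G.dst (flowOf G (σ 16)) t) \
            G.noReach (insert f F) (flowOf G (σ 16)) (G.dst (flowOf G (σ 16)) l) ∧
          G.head g ∉ G.noReach (insert f F) (flowOf G (σ 16)) (G.dst (flowOf G (σ 16)) t) \
            G.noReach (insert f F) (flowOf G (σ 16)) (G.dst (flowOf G (σ 16)) l) := by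
  classical
  simp only [touchProg, ex_block_cons, ex_block_nil]
  have e7 := edgeSet_mapProg (c := 43) (b := 7) (x := add (isE 50) inF) h.input (by omega)
    (by omega) (by omega) (A := insert f F) (by
      intro e' τ he' hτ
      rw [holds_add, h.holds_inF he' (hτ 6 (by omega) (by omega)),
        holds_isE he' (by rw [hτ 50 (by omega) (by omega), h.cur]), Finset.mem_insert])
  have hfr : ∀ a, a ≠ 43 → a ≠ 7 → (mapProg 43 7 (add (isE 50) inF)).ex σ a = σ a :=
    fun a h1 h2 => mapProg_frame h1 h2
  generalize (mapProg 43 7 (add (isE 50) inF)).ex σ = σ₁ at *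
  have h1 : HasFlow G lam k R F f σ₁ := h.congr fun a ha => hfr a (by rintro rfl; simp at ha)
    (by rintro rfl; simp at ha)
  rw [← hfr 55 (by omega) (by omega)] at hl
  rw [← hfr 56 (by omega) (by omega)] at ht
  rw [← hfr 16 (by omega) (by omega)]
  clear hfr h
  have e8 := mapProg_spec (c := 43) (b := 8) (x := get 16 (var 43)) h1.input (by omega) (by omega)
    (by omega) (g := fun e => σ₁ 16 e) (by
      intro e τ he hτ
      rw [eval_get, eval_var, he, hτ 16 (by omega) (by omega)])
  have hfr : ∀ a, a ≠ 43 → a ≠ 8 → (mapProg 43 8 (get 16 (var 43))).ex σ₁ a = σ₁ a :=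
    fun a h1 h2 => mapProg_frame h1 h2
  generalize (mapProg 43 8 (get 16 (var 43))).ex σ₁ = σ₂ at *
  have h2 : HasFlow G lam k R F f σ₂ := h1.congr fun a ha => hfr a (by rintro rfl; simp at ha)
    (by rintro rfl; simp at ha)
  rw [← hfr 55 (by omega) (by omega)] at hl
  rw [← hfr 56 (by omega) (by omega)] at ht
  rw [← hfr 7 (by omega) (by omega)] at e7
  rw [← hfr 16 (by omega) (by omega)] at e8 ⊢
  have e8 := flowOf_congr e8
  clear hfr h1
  have hr₁ := reachProg_spec h2.input hl e7 e8
  have h3 : HasFlow G lam k R F f ((reachProg 55).ex σ₂) := h2.ex (by decide)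
  have hfr : ∀ a, a ∉ (reachProg 55).writes → (reachProg 55).ex σ₂ a = σ₂ a := fun a ha => ex_frame ha
  have f7 := hfr 7 (by decide)
  have f8 := hfr 8 (by decide)
  have f16 := hfr 16 (by decide)
  have f56 := hfr 56 (by decide)
  clear hfr
  generalize (reachProg 55).ex σ₂ = σ₃ at *
  rw [← f7] at e7
  rw [← f8, ← f16] at e8
  rw [← f56] at ht
  rw [← f16] at hr₁ ⊢
  clear f7 f8 f16 f56 h2
  have e25 := mapProg_spec (c := 43) (b := 25) (x := get 9 (tl 43)) h3.input (by omega) (by omega)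
    (by omega) (g := fun e => σ₃ 9 (G.tail e)) (by
      intro e τ he hτ
      rw [eval_get, eval_tl, he, hτ 1 (by omega) (by omega), hτ 9 (by omega) (by omega),
        h3.input.tail])
  have hfr : ∀ a, a ≠ 43 → a ≠ 25 → (mapProg 43 25 (get 9 (tl 43))).ex σ₃ a = σ₃ a :=
    fun a h1 h2 => mapProg_frame h1 h2
  generalize (mapProg 43 25 (get 9 (tl 43))).ex σ₃ = σ₄ at *
  have h4 : HasFlow G lam k R F f σ₄ := h3.congr fun a ha => hfr a (by rintro rfl; simp at ha)
    (by rintro rfl; simp at ha)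
  rw [← hfr 56 (by omega) (by omega)] at ht
  rw [← hfr 7 (by omega) (by omega)] at e7
  rw [← hfr 8 (by omega) (by omega), ← hfr 16 (by omega) (by omega)] at e8
  rw [← hfr 9 (by omega) (by omega)] at e25 hr₁
  rw [← hfr 16 (by omega) (by omega)] at hr₁ ⊢
  clear hfr h3
  have e28 := mapProg_spec (c := 43) (b := 28) (x := get 9 (hd 43)) h4.input (by omega) (by omega)
    (by omega) (g := fun e => σ₄ 9 (G.head e)) (by
      intro e τ he hτ
      rw [eval_get, eval_hd, he, hτ 2 (by omega) (by omega), hτ 9 (by omega) (by omega),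
        h4.input.head])
  have hfr : ∀ a, a ≠ 43 → a ≠ 28 → (mapProg 43 28 (get 9 (hd 43))).ex σ₄ a = σ₄ a :=
    fun a h1 h2 => mapProg_frame h1 h2
  generalize (mapProg 43 28 (get 9 (hd 43))).ex σ₄ = σ₅ at *
  have h5 : HasFlow G lam k R F f σ₅ := h4.congr fun a ha => hfr a (by rintro rfl; simp at ha)
    (by rintro rfl; simp at ha)
  rw [← hfr 56 (by omega) (by omega)] at ht
  rw [← hfr 7 (by omega) (by omega)] at e7
  rw [← hfr 8 (by omega) (by omega), ← hfr 16 (by omega) (by omega)] at e8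
  rw [← hfr 25 (by omega) (by omega)] at e25
  rw [← hfr 16 (by omega) (by omega)] at hr₁ ⊢
  clear hfr h4
  have hr₂ := reachProg_spec h5.input ht e7 e8
  have h6 : HasFlow G lam k R F f ((reachProg 56).ex σ₅) := h5.ex (by decide)
  have hfr : ∀ a, a ∉ (reachProg 56).writes → (reachProg 56).ex σ₅ a = σ₅ a := fun a ha => ex_frame ha
  have f25 := hfr 25 (by decide)
  have f28 := hfr 28 (by decide)
  clear hfr
  generalize (reachProg 56).ex σ₅ = σ₆ at *
  rw [← f25] at e25
  rw [← f28] at e28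
  -- A vertex lies in `X t \ X l` if it has no rank with respect to `t` but has one with respect to
  -- `l`. Arrays 25 and 28 keep the latter ranks for the tails and heads.
  rw [countProg_spec (c := 57) (b := 26) (x := .and (get 6 (var 57)) (add
    (.and (.not (get 9 (tl 57))) (get 25 (var 57)))
    (.and (.not (get 9 (hd 57))) (get 28 (var 57))))) h6.input (by omega) (by omega) (by omega)
    (P := fun g => g ∈ F ∧ ((σ₆ 9 (G.tail g) = 0 ∧ σ₄ 9 (G.tail g) ≠ 0) ∨
      (σ₆ 9 (G.head g) = 0 ∧ σ₄ 9 (G.head g) ≠ 0))) (by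
      intro e τ he hτ
      rw [holds_and, holds_get, eval_var, he, holds_add, holds_and, holds_and, holds_not, holds_not,
        holds_get, holds_get, eval_get, eval_get, eval_tl, eval_hd, eval_var, he,
        hτ 6 (by omega) (by omega), hτ 9 (by omega) (by omega), hτ 1 (by omega) (by omega),
        hτ 2 (by omega) (by omega), hτ 25 (by omega) (by omega), hτ 28 (by omega) (by omega),
        h6.input.tail, h6.input.head, e25, e28, h6.mem])]
  rw [Finset.card_eq_zero, Finset.filter_eq_empty_iff]
  have hz : ∀ w : Fin G.n, σ₆ 9 w = 0 ↔
      w ∈ G.noReach (insert f F) (flowOf G (σ₅ 16)) (G.dst (flowOf G (σ₅ 16)) t) := fun w => by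
    rw [← not_iff_not]; exact hr₂ w
  simp only [hz, hr₁, Finset.mem_univ, true_implies, not_and, not_or, Set.mem_sdiff]

/-- If the edges `l` and `t` enclose many candidates, they can be deleted together or some edge of
`F` touches the rung between them. -/
def WindowClosed (G : MGraph) (lam k : ℕ) (R F : Finset (Fin G.m)) (f : Fin G.m)
    (φ : Fin G.m → ℤ) (lab pos : ℕ → ℕ) (l t : Fin G.m) : Prop :=
  (∃ W : Finset (Fin G.m), 2 * k ≤ W.card ∧
    ∀ y ∈ W, (G.Blocked lam F f y ∧ y ∉ R) ∧ Before lab pos l y ∧ Before lab pos y t) →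
  G.EdgeConnectedWithout lam (F ∪ {l, t}) ∨
    ¬ ∀ g ∈ F, G.tail g ∉ G.noReach (insert f F) φ (G.dst φ t) \
        G.noReach (insert f F) φ (G.dst φ l) ∧
      G.head g ∉ G.noReach (insert f F) φ (G.dst φ t) \
        G.noReach (insert f F) φ (G.dst φ l)

/-- Outputs the edge in variable 55 as irrelevant. -/
def outputEdge : BProg := block [set 4 (lit 1) (var 55), assign 4 (lit 1), assign 23 (lit 1)]

theorem outputEdge_spec {l : Fin G.m} (hl : σ 55 0 = l)
    (h : G.IsAnswer lam k R (Answer.irrelevantEdge l)) (Q : Prop) :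
    FoundOr G lam k R Q (outputEdge.ex σ) := by
  simp only [outputEdge, ex_block_cons, ex_block_nil, ex_assign, ex_set, eval_lit, eval_var, hl]
  refine ⟨fun _ => ⟨.irrelevantEdge l, by simp, ⟨?_, ?_⟩, h⟩, ?_⟩ <;> simp [Store.upd_ne, Store.upd_self]

/-- Examines the window between the edges in variables 55 and 56. -/
def windowProg : BProg := block [
  countProg 57 24 (.and (candidate 57) (.and (before 55 57) (before 57 56))),
  when (.not (.lt (var 24) (add (get 0 (lit 4)) (get 0 (lit 4))))) (block [
    testProg (add (isE 55) (add (isE 56) inF)),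
    when (.not (var 12)) (block [
      touchProg,
      when (.not (var 26)) outputEdge])])]

theorem eval_lt_eq_zero (σ : Store) (x y : RExpr) :
    (RExpr.lt x y).eval σ = 0 ↔ y.eval σ ≤ x.eval σ := by
  simp only [RExpr.lt, eval_sub]
  omega

/-- Each test that fails closes the window for its own reason: too few candidates, a deletable pair,
or an edge of `F` touching the region. If all succeed, `isAnswer_irrelevantEdge` applies to `l`. -/
theorem windowProg_spec (hlam : 1 ≤ lam) (h : HasFlow G lam k R F f σ) (hk : 1 ≤ k)
    (hR : G.Irrelevant lam k R) (hF : G.EdgeConnectedWithout lam F) (hfF : f ∉ F)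
    (hf : G.EdgeConnectedWithout lam (insert f F)) (h23 : σ 23 0 = 0) {l t : Fin G.m}
    (hl : σ 55 0 = l) (ht : σ 56 0 = t) (hlB : G.Blocked lam F f l) (htB : G.Blocked lam F f t)
    (hlR : l ∉ R) (hlt : Before (σ 17) (σ 18) l t) :
    FoundOr G lam k R (WindowClosed G lam k R F f (flowOf G (σ 16)) (σ 17) (σ 18) l t)
      (windowProg.ex σ) := by
  classical
  simp only [windowProg, ex_block_cons, ex_block_nil]
  have hcount := countProg_spec (c := 57) (b := 24)
    (x := .and (candidate 57) (.and (before 55 57) (before 57 56))) h.input (by omega) (by omega)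
    (by omega) (P := fun y => (G.Blocked lam F f y ∧ y ∉ R) ∧ Before (σ 17) (σ 18) l y ∧
      Before (σ 17) (σ 18) y t) (by
      intro e τ he hτ
      rw [holds_and, holds_and, h.holds_candidate he (hτ 3 (by omega) (by omega))
        (hτ 15 (by omega) (by omega)),
        holds_before (σ := σ) (by rw [hτ 55 (by omega) (by omega), hl]) he
          (hτ 17 (by omega) (by omega)) (hτ 18 (by omega) (by omega)),
        holds_before (σ := σ) he (by rw [hτ 56 (by omega) (by omega), ht])
          (hτ 17 (by omega) (by omega)) (hτ 18 (by omega) (by omega))])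
  have hfr : ∀ a, a ∉ (countProg 57 24
    (.and (candidate 57) (.and (before 55 57) (before 57 56)))).writes →
    (countProg 57 24 (.and (candidate 57) (.and (before 55 57) (before 57 56)))).ex σ a = σ a :=
      fun a ha => ex_frame ha
  generalize (countProg 57 24 (.and (candidate 57) (.and (before 55 57) (before 57 56)))).ex σ = σ₁
    at *
  have h1 : HasFlow G lam k R F f σ₁ := h.congr fun a ha => hfr a
    ((by decide : ∀ a ∈ [0, 1, 2, 3, 6, 50, 15, 16, 17, 18], a ∉ (countProg 57 24
      (.and (candidate 57) (.and (before 55 57) (before 57 56)))).writes) a ha)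
  rw [← hfr 55 (by decide)] at hl
  rw [← hfr 56 (by decide)] at ht
  rw [← hfr 23 (by decide)] at h23
  rw [← hfr 17 (by decide), ← hfr 18 (by decide)] at hlt hcount ⊢
  rw [← hfr 16 (by decide)]
  clear hfr h
  by_cases hb : (RExpr.not (.lt (var 24) (add (get 0 (lit 4)) (get 0 (lit 4))))).Holds σ₁
  swap
  · rw [ex_when_of_not hb]
    rw [holds_not, eval_lt_eq_zero, eval_add, eval_get, eval_lit, h1.input.k_eq, eval_var,
      hcount, not_le] at hb
    refine ⟨fun h => absurd h23 h, fun _ => ?_⟩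
    rintro ⟨W, hW, hWy⟩
    have := Finset.card_le_card (s := W) (t := Finset.univ.filter fun y =>
      (G.Blocked lam F f y ∧ y ∉ R) ∧ Before (σ₁ 17) (σ₁ 18) l y ∧ Before (σ₁ 17) (σ₁ 18) y t)
      fun y hy => Finset.mem_filter.mpr ⟨Finset.mem_univ y, hWy y hy⟩
    omega
  rw [ex_when_of hb]
  rw [holds_not, eval_lt_eq_zero, eval_add, eval_get, eval_lit, h1.input.k_eq, eval_var,
    hcount] at hb
  simp only [ex_block_cons, ex_block_nil]
  obtain ⟨t1, -⟩ := testProg_spec (x := add (isE 55) (add (isE 56) inF)) h1.input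
    (A := F ∪ {l, t}) (by
      intro e' τ he' hτ
      rw [holds_add, holds_add, h1.holds_inF he' (hτ 6 (by omega) (by omega)),
        holds_isE he' (by rw [hτ 55 (by omega) (by omega), hl]),
        holds_isE he' (by rw [hτ 56 (by omega) (by omega), ht])]
      simp only [Finset.mem_union, Finset.mem_insert, Finset.mem_singleton]
      tauto)
  have h2 : HasFlow G lam k R F f ((testProg (add (isE 55) (add (isE 56) inF))).ex σ₁) :=
    h1.ex (by decide)
  have hfr : ∀ a, a ∉ (testProg (add (isE 55) (add (isE 56) inF))).writes →
    (testProg (add (isE 55) (add (isE 56) inF))).ex σ₁ a = σ₁ a := fun a ha => ex_frame ha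
  rw [← hfr 55 (by decide)] at hl
  rw [← hfr 56 (by decide)] at ht
  rw [← hfr 23 (by decide)] at h23
  rw [← hfr 17 (by decide), ← hfr 18 (by decide)] at hlt hb ⊢
  rw [← hfr 16 (by decide)]
  clear hfr hcount
  generalize (testProg (add (isE 55) (add (isE 56) inF))).ex σ₁ = σ₂ at *
  by_cases hc : (RExpr.not (var 12)).Holds σ₂
  swap
  · rw [ex_when_of_not hc]
    rw [holds_not, eval_var] at hc
    exact ⟨fun h => absurd h23 h, fun _ _ => Or.inl (t1.mp hc)⟩
  rw [ex_when_of hc]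
  rw [holds_not, eval_var] at hc
  have hconn : ¬ G.EdgeConnectedWithout lam (F ∪ {l, t}) := fun h => t1.mpr h hc
  simp only [ex_block_cons, ex_block_nil]
  have hun := touchProg_spec h2 hl ht
  have hfr : ∀ a, a ∉ touchProg.writes → touchProg.ex σ₂ a = σ₂ a := fun a ha => ex_frame ha
  rw [← hfr 55 (by decide)] at hl
  rw [← hfr 23 (by decide)] at h23
  clear hfr
  generalize touchProg.ex σ₂ = σ₃ at *
  by_cases hu : (RExpr.not (var 26)).Holds σ₃
  swap
  · rw [ex_when_of_not hu]
    rw [holds_not, eval_var] at hu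
    exact ⟨fun h => absurd h23 h, fun _ _ => Or.inr fun h => hu (hun.mpr h)⟩
  rw [ex_when_of hu]
  rw [holds_not, eval_var] at hu
  refine outputEdge_spec hl ?_ _
  -- A blocked edge has a nonzero label, which determines the trail and thus the ladder.
  have hlab := hlB.label_ne_zero hfF hf h2.flow h2.dec
  have hle := h2.dec.le l
  obtain ⟨j, hj⟩ : ∃ j, σ₂ 17 l = j + 1 := ⟨σ₂ 17 l - 1, by omega⟩
  have hjl : j < lam := by omega
  refine (ladder hlam hfF hf h2.flow (h2.dec.isTrail j hjl)).isAnswer_irrelevantEdge hR hk hF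
    (l := l) (t := t) ?_ ?_ hlt.2 hlR hlB.1 hconn (hun.mp hu) (W := Finset.univ.filter fun y =>
      (G.Blocked lam F f y ∧ y ∉ R) ∧ Before (σ₂ 17) (σ₂ 18) l y ∧ Before (σ₂ 17) (σ₂ 18) y t)
    ?_ ?_ ?_ (by omega)
  · simp [ladder, hlB, hj]
  · simp [ladder, htB, ← hlt.1, hj]
  · intro y hy
    simp only [Finset.mem_filter, Finset.mem_univ, true_and] at hy
    simp [ladder, hy.1.1, ← hy.2.1.1, hj]
  · intro y hy
    simp only [Finset.mem_filter, Finset.mem_univ, true_and] at hy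
    exact ⟨hy.2.1.2, hy.2.2.2⟩
  · intro y hy
    simp only [Finset.mem_filter, Finset.mem_univ, true_and] at hy
    exact hy.1.2

/-- Examines all windows. -/
def irrelevantProg : BProg := forLt 55 2 (forLt 56 2 (when (.and (.not (var 23))
  (.and (candidate 55) (.and (candidate 56) (before 55 56)))) windowProg))

/-- All windows that begin with `l` and end before the edge with index `i` are closed. -/
def WindowsClosed (G : MGraph) (lam k : ℕ) (R F : Finset (Fin G.m)) (f : Fin G.m)
    (φ : Fin G.m → ℤ) (lab pos : ℕ → ℕ) (l : Fin G.m) (i : ℕ) : Prop :=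
  ∀ t : Fin G.m, t < i → G.Blocked lam F f l ∧ l ∉ R → G.Blocked lam F f t ∧ t ∉ R →
    Before lab pos l t → WindowClosed G lam k R F f φ lab pos l t

theorem windowsFrom_spec (hlam : 1 ≤ lam) (h : HasFlow G lam k R F f σ) (hk : 1 ≤ k)
    (hR : G.Irrelevant lam k R) (hF : G.EdgeConnectedWithout lam F) (hfF : f ∉ F)
    (hf : G.EdgeConnectedWithout lam (insert f F)) {Q : Prop} (hQ : FoundOr G lam k R Q σ)
    {l : Fin G.m} (hl : σ 55 0 = l) :
    FoundOr G lam k R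
      (Q ∧ WindowsClosed G lam k R F f (flowOf G (σ 16)) (σ 17) (σ 18) l G.m)
      ((forLt 56 2 (when (.and (.not (var 23))
        (.and (candidate 55) (.and (candidate 56) (before 55 56)))) windowProg)).ex σ) := by
  have key := forLt_rule (c := 56) (j := 2) (p := when (.and (.not (var 23))
    (.and (candidate 55) (.and (candidate 56) (before 55 56)))) windowProg) (σ := σ) (by decide)
    (by rw [h.input.m, h.input.bound]; omega)
    (fun i τ => FoundOr G lam k R
      (Q ∧ WindowsClosed G lam k R F f (flowOf G (σ 16)) (σ 17) (σ 18) l i) τ)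
    (fun i τ v hI => hI.congr (Store.upd_ne _ _ (by omega)) (Store.upd_ne _ _ (by omega))
      (Store.upd_ne _ _ (by omega)))
    (hQ.imp fun _ hq => ⟨hq, fun t ht => absurd ht (by omega)⟩) (by
      intro i τ hi hcnt hfr hI
      rw [h.input.m] at hi
      have h' : HasFlow G lam k R F f τ := h.congr fun a ha => hfr a
        ((by decide : ∀ a ∈ [0, 1, 2, 3, 6, 50, 15, 16, 17, 18], a ∉ (forN 56 (when (.and
          (.not (var 23)) (.and (candidate 55) (.and (candidate 56) (before 55 56))))
          windowProg)).writes) a ha)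
      rw [← hfr 55 (by decide)] at hl
      rw [← hfr 16 (by decide), ← hfr 17 (by decide), ← hfr 18 (by decide)] at hI ⊢
      have hholds : (RExpr.and (.not (var 23)) (.and (candidate 55) (.and (candidate 56)
          (before 55 56)))).Holds τ ↔ τ 23 0 = 0 ∧ (G.Blocked lam F f l ∧ l ∉ R) ∧
          (G.Blocked lam F f ⟨i, hi⟩ ∧ ⟨i, hi⟩ ∉ R) ∧ Before (τ 17) (τ 18) l ⟨i, hi⟩ := by
        rw [holds_and, holds_and, holds_and, holds_not, h'.holds_candidate hl rfl rfl,
          h'.holds_candidate (e := ⟨i, hi⟩) hcnt rfl rfl,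
          holds_before (σ := τ) (e' := ⟨i, hi⟩) hl hcnt rfl rfl, eval_var]
      have hstep : ∀ t : Fin G.m, t < i + 1 → t < i ∨ t = ⟨i, hi⟩ := fun t ht => by
        rw [Fin.ext_iff]
        exact Nat.lt_succ_iff_lt_or_eq.mp ht
      by_cases hb : (RExpr.and (.not (var 23)) (.and (candidate 55) (.and (candidate 56)
          (before 55 56)))).Holds τ
      · rw [ex_when_of hb]
        obtain ⟨b1, b2, b3, b4⟩ := hholds.mp hb
        refine (windowProg_spec hlam h' hk hR hF hfF hf b1 hl hcnt b2.1 b3.1 b2.2 b4).imp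
          fun _ hw => ⟨(hI.2 b1).1, fun t ht a1 a2 a3 => ?_⟩
        rcases hstep t ht with ht | rfl
        · exact (hI.2 b1).2 t ht a1 a2 a3
        · exact hw
      · rw [ex_when_of_not hb]
        refine hI.imp fun h0 hq => ⟨hq.1, fun t ht a1 a2 a3 => ?_⟩
        rcases hstep t ht with ht | rfl
        · exact hq.2 t ht a1 a2 a3
        · exact absurd (hholds.mpr ⟨h0, a1, a2, a3⟩) hb)
  rw [h.input.m] at key
  exact key

/-- The proposition `Q` carries the result of the greedy selection through the search. -/
theorem irrelevantProg_spec (hlam : 1 ≤ lam) (h : HasFlow G lam k R F f σ) (hk : 1 ≤ k)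
    (hR : G.Irrelevant lam k R) (hF : G.EdgeConnectedWithout lam F) (hfF : f ∉ F)
    (hf : G.EdgeConnectedWithout lam (insert f F)) {Q : Prop} (hQ : FoundOr G lam k R Q σ) :
    FoundOr G lam k R
      (Q ∧ ∀ l, WindowsClosed G lam k R F f (flowOf G (σ 16)) (σ 17) (σ 18) l G.m)
      (irrelevantProg.ex σ) := by
  have key := forLt_rule (c := 55) (j := 2) (p := forLt 56 2 (when (.and (.not (var 23))
    (.and (candidate 55) (.and (candidate 56) (before 55 56)))) windowProg)) (σ := σ) (by decide)
    (by rw [h.input.m, h.input.bound]; omega)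
    (fun i τ => FoundOr G lam k R (Q ∧ ∀ l : Fin G.m, l < i →
      WindowsClosed G lam k R F f (flowOf G (σ 16)) (σ 17) (σ 18) l G.m) τ)
    (fun i τ v hI => hI.congr (Store.upd_ne _ _ (by omega)) (Store.upd_ne _ _ (by omega))
      (Store.upd_ne _ _ (by omega)))
    (hQ.imp fun _ hq => ⟨hq, fun t ht => absurd ht (by omega)⟩) (by
      intro i τ hi hcnt hfr hI
      rw [h.input.m] at hi
      have h' : HasFlow G lam k R F f τ := h.congr fun a ha => hfr a
        ((by decide : ∀ a ∈ [0, 1, 2, 3, 6, 50, 15, 16, 17, 18], a ∉ (forN 55 (forLt 56 2 (when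
          (.and (.not (var 23)) (.and (candidate 55) (.and (candidate 56) (before 55 56))))
          windowProg))).writes) a ha)
      rw [← hfr 16 (by decide), ← hfr 17 (by decide), ← hfr 18 (by decide)] at hI ⊢
      refine (windowsFrom_spec hlam h' hk hR hF hfF hf hI (l := ⟨i, hi⟩) hcnt).imp
        fun _ hq => ⟨hq.1.1, fun l hl => ?_⟩
      rcases Nat.lt_succ_iff_lt_or_eq.mp hl with hl | hl
      · exact hq.1.2 l hl
      · obtain rfl : l = ⟨i, hi⟩ := Fin.ext hl
        exact hq.2)
  rw [h.input.m] at key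
  exact key.imp fun _ hq => ⟨hq.1, fun l => hq.2 l l.2⟩

end Algo

/-! ### The algorithm -/

namespace Algo

open BProg RExpr MGraph

variable {G : MGraph} {lam k : ℕ} {R F : Finset (Fin G.m)} {f : Fin G.m} {σ τ : Store}

/-- Searches the edges that are blocked by the edge in variable 50. -/
def searchProg : BProg := block [
  blockedProg,
  when (.not (.eq (tl 50) (hd 50))) (block [decompProg, greedyProg, irrelevantProg])]

open Classical in
theorem searchProg_spec (hlam : 1 ≤ lam) (h : HasState G lam k R F f σ)
    (hR : G.Irrelevant lam k R) (hF : G.EdgeConnectedWithout lam F) (hfF : f ∉ F)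
    (hf : G.EdgeConnectedWithout lam (insert f F)) (hFk : F.card < k) (h23 : σ 23 0 = 0) :
    FoundOr G lam k R (G.Bounded lam R (Finset.univ.filter fun e => G.Blocked lam F f e)
      (lam * (k - 1)) (lam * (2 * (k - 1))) (lam * ((2 * k + 1) * (3 * (k - 1)))))
      (searchProg.ex σ) := by
  have hk : 1 ≤ k := by omega
  simp only [searchProg, ex_block_cons, ex_block_nil]
  have hb := blockedProg_spec h
  have h1 : HasState G lam k R F f (blockedProg.ex σ) := h.ex (by decide)
  rw [← ex_frame (p := blockedProg) (σ := σ) (a := 23) (by decide)] at h23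
  generalize blockedProg.ex σ = σ₁ at *
  have hholds : (RExpr.not (.eq (tl 50) (hd 50))).Holds σ₁ ↔ G.tail f ≠ G.head f := by
    rw [holds_not, eval_eq_eq_zero, eval_tl, eval_hd, h1.cur, h1.input.tail, h1.input.head, Ne,
      Ne, Fin.ext_iff]
  -- A flow needs distinct ends; a loop blocks nothing.
  by_cases hne : G.tail f = G.head f
  · rw [ex_when_of_not fun h => hholds.mp h hne]
    refine ⟨fun h => absurd h23 h, fun _ => ?_⟩
    rw [Finset.filter_false_of_mem fun e _ => not_blocked_of_loop hfF hf hne e]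
    simp [Bounded]
  rw [ex_when_of (hholds.mpr hne)]
  simp only [ex_block_cons, ex_block_nil]
  have h2 := decompProg_spec h1 hb hne hf
  rw [← ex_frame (p := decompProg) (σ := σ₁) (a := 23) (by decide)] at h23
  generalize decompProg.ex σ₁ = σ₂ at *
  have hg := greedyProg_spec hlam h2 hk hF hfF hf hne h23
  have h3 : HasFlow G lam k R F f (greedyProg.ex σ₂) := h2.ex (by decide)
  have e16 := ex_frame (p := greedyProg) (σ := σ₂) (a := 16) (by decide)
  have e17 := ex_frame (p := greedyProg) (σ := σ₂) (a := 17) (by decide)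
  have e18 := ex_frame (p := greedyProg) (σ := σ₂) (a := 18) (by decide)
  generalize greedyProg.ex σ₂ = σ₃ at *
  have hw := irrelevantProg_spec hlam h3 hk hR hF hfF hf hg
  rw [e16, e17, e18] at hw
  refine hw.imp fun _ ⟨q1, q2⟩ => bounded_blocked hlam hF hfF hf h2.flow h2.dec q1 hFk ?_
  intro l t hl ht hlR htR hlab hpos hcard
  refine q2 l t t.2 ⟨hl, hlR⟩ ⟨ht, htR⟩ ⟨hlab, hpos⟩ ⟨_, hcard, fun y hy => ?_⟩
  simp only [Finset.mem_filter, Finset.mem_univ, true_and] at hy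
  exact ⟨⟨hy.1, hy.2.1⟩, ⟨hy.2.2.1.symm, hy.2.2.2.1⟩, ⟨hy.2.2.1.trans hlab, hy.2.2.2.2⟩⟩

/-- Treats the edge in variable 50. -/
def stepProg : BProg := when (.not (var 23)) (block [
  testProg (add (isE 50) inF),
  when (var 12) (ite (.eq (add (var 22) (lit 1)) (get 0 (lit 4))) (outputSet 7)
    (block [searchProg, set 6 (var 50) (lit 1), assign 22 (add (var 22) (lit 1))]))])

/-- The edges with index less than `i` have been treated. -/
structure Treated (G : MGraph) (lam k : ℕ) (R F : Finset (Fin G.m)) (i : ℕ) : Prop where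
  conn : G.EdgeConnectedWithout lam F
  card_lt : F.card < k
  lt : ∀ e ∈ F, e < i
  settled : ∀ e : Fin G.m, e < i → e ∈ F ∨ ¬ G.EdgeConnectedWithout lam (insert e F)
  bounded : G.Bounded lam R (G.settled lam F) (F.card * (lam * (k - 1) + 1))
    (F.card * (lam * (2 * (k - 1)) + 1)) (F.card * (lam * ((2 * k + 1) * (3 * (k - 1))) + 1))

/-- The invariant of the algorithm. -/
def MainInv (G : MGraph) (lam k : ℕ) (R : Finset (Fin G.m)) (i : ℕ) (σ : Store) : Prop :=
  FoundOr G lam k R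
    (Treated G lam k R (edgeSet G (σ 6)) i ∧ σ 22 0 = (edgeSet G (σ 6)).card) σ

/-- The edge `f` is rejected, completes a deletion set, or joins `F` after its blocked edges have
been searched. Only the last case changes the count, by one for `f` and by the bound for the blocked
edges. -/
theorem stepProg_spec (hlam : 1 ≤ lam) (h : HasInput G lam k R σ) (hR : G.Irrelevant lam k R)
    (hf : σ 50 0 = f) (hI : MainInv G lam k R f σ) : MainInv G lam k R (f + 1) (stepProg.ex σ) := by
  unfold stepProg
  by_cases h23 : σ 23 0 = 0
  swap
  · rw [ex_when_of_not (by simpa using h23)]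
    exact ⟨hI.1, fun h => absurd h h23⟩
  rw [ex_when_of (by simpa using h23)]
  obtain ⟨hT, hcount⟩ := hI.2 h23
  have hst : HasState G lam k R (edgeSet G (σ 6)) f σ := ⟨h, fun e => mem_edgeSet.symm, hf⟩
  obtain ⟨F, hF⟩ : ∃ F, edgeSet G (σ 6) = F := ⟨_, rfl⟩
  rw [hF] at hT hcount hst
  clear hI h
  have hfF : f ∉ F := fun h => lt_irrefl _ (hT.lt f h)
  simp only [ex_block_cons, ex_block_nil]
  obtain ⟨t1, t2⟩ := testProg_spec (x := add (isE 50) inF) hst.input (A := insert f F) (by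
    intro e' τ he' hτ
    rw [holds_add, hst.holds_inF he' (hτ 6 (by omega) (by omega)),
      holds_isE he' (by rw [hτ 50 (by omega) (by omega), hst.cur]), Finset.mem_insert])
  have h1 : HasState G lam k R F f ((testProg (add (isE 50) inF)).ex σ) := hst.ex (by decide)
  have hfr : ∀ a, a ∉ (testProg (add (isE 50) inF)).writes →
    (testProg (add (isE 50) inF)).ex σ a = σ a := fun a ha => ex_frame ha
  rw [← hfr 6 (by decide)] at hF
  rw [← hfr 22 (by decide)] at hcount
  rw [← hfr 23 (by decide)] at h23
  clear hfr hst hf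
  generalize (testProg (add (isE 50) inF)).ex σ = σ₁ at *
  have hstep : ∀ e : Fin G.m, e < (f : ℕ) + 1 → e < (f : ℕ) ∨ e = f := fun e he => by
    rw [Fin.ext_iff]
    exact Nat.lt_succ_iff_lt_or_eq.mp he
  by_cases hc : (var 12).Holds σ₁
  swap
  · rw [ex_when_of_not hc]
    refine ⟨fun h => absurd h23 h, fun _ => ?_⟩
    rw [hF]
    refine ⟨⟨hT.conn, hT.card_lt, fun e he => (hT.lt e he).trans (Nat.lt_succ_self _),
      fun e he => ?_, hT.bounded⟩, hcount⟩
    rcases hstep e he with he | rfl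
    · exact hT.settled e he
    · exact Or.inr fun h => hc (t1.mpr h)
  rw [ex_when_of hc]
  have hconn := t1.mp hc
  by_cases hk : (RExpr.eq (add (var 22) (lit 1)) (get 0 (lit 4))).Holds σ₁
  · rw [ex_ite_of hk]
    simp only [holds_eq, eval_add, eval_var, eval_lit, eval_get, h1.input.k_eq] at hk
    -- Array 7 still contains `insert f F` from the test.
    refine outputSet_spec h1.input (by omega) (by omega) ⟨?_, ?_⟩ _
    · rw [t2, Finset.card_insert_of_notMem hfF, ← hcount, hk]
    · rwa [t2]
  rw [ex_ite_of_not hk]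
  simp only [holds_eq, eval_add, eval_var, eval_lit, eval_get, h1.input.k_eq] at hk
  simp only [ex_block_cons, ex_block_nil]
  have hs := searchProg_spec hlam h1 hR hT.conn hfF hconn hT.card_lt h23
  have h2 : HasState G lam k R F f (searchProg.ex σ₁) := h1.ex (by decide)
  rw [← ex_frame (p := searchProg) (σ := σ₁) (a := 6) (by decide)] at hF
  rw [← ex_frame (p := searchProg) (σ := σ₁) (a := 22) (by decide)] at hcount hk
  clear t1 t2 hc h23 h1
  generalize searchProg.ex σ₁ = σ₂ at *
  simp only [ex_set, ex_assign, eval_var, eval_lit, eval_add, h2.cur,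
    Store.upd_ne _ _ (show 22 ≠ 6 by omega)]
  have d6 : edgeSet G (((σ₂.upd 6 f 1).upd 22 0 (σ₂ 22 0 + 1)) 6) = insert f F := by
    rw [Store.upd_ne _ _ (by omega), Store.upd_self, ← hF]
    ext e'
    rw [mem_edgeSet, update_apply_fin, Finset.mem_insert, mem_edgeSet]
    split_ifs with h' <;> simp [h']
  have d22 : ((σ₂.upd 6 f 1).upd 22 0 (σ₂ 22 0 + 1)) 22 0 = σ₂ 22 0 + 1 := by
    simp [Store.upd_self]
  unfold MainInv
  rw [d6, d22, Finset.card_insert_of_notMem hfF]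
  refine (hs.congr (τ := (σ₂.upd 6 f 1).upd 22 0 (σ₂ 22 0 + 1)) ?_ ?_ ?_).imp fun _ hB =>
    ⟨⟨hconn, ?_, fun e he => ?_, fun e he => ?_, ?_⟩, by rw [hcount]⟩
  · rw [Store.upd_ne _ _ (by omega), Store.upd_ne _ _ (by omega)]
  · rw [Store.upd_ne _ _ (by omega), Store.upd_ne _ _ (by omega)]
  · rw [Store.upd_ne _ _ (by omega), Store.upd_ne _ _ (by omega)]
  · rw [Finset.card_insert_of_notMem hfF, ← hcount]
    have := hT.card_lt
    omega
  · rcases Finset.mem_insert.mp he with rfl | he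
    · exact Nat.lt_succ_self _
    · exact (hT.lt e he).trans (Nat.lt_succ_self _)
  · rcases hstep e he with he | rfl
    -- Settled edges stay settled, because deletability only decreases as `F` grows.
    · refine (hT.settled e he).imp Finset.mem_insert_of_mem fun h h' => h (h'.anti ?_)
      exact Finset.insert_subset_insert _ (Finset.subset_insert _ _)
    · exact Or.inl (Finset.mem_insert_self _ _)
  · rw [Finset.card_insert_of_notMem hfF]
    exact hT.bounded.settled_insert hB

/-- The algorithm. -/
def mainProg : BProg := block [
  when (.not (get 0 (lit 4))) (assign 23 (lit 1)),
  forLt 50 2 stepProg,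
  when (.not (var 23)) (assign 4 (lit 2))]

theorem wf_mainProg : mainProg.wf = true := by decide

theorem mainProg_spec (hlam : 1 ≤ lam) (hG : G.EdgeConnected lam) (hR : G.Irrelevant lam k R) :
    ∃ ans : Answer G.m, ans.HeldBy (mainProg.ex (inputStore G lam k R)) ∧
      G.IsAnswer lam k R ans ∧ (ans = Answer.fewDeletable →
        (G.directed = true → {e | G.Deletable lam e}.ncard ≤ lam * k ^ 2) ∧
        (G.directed = false → Even lam → {e | G.Deletable lam e}.ncard ≤ 2 * lam * k ^ 2)) := by
  simp only [mainProg, ex_block_cons, ex_block_nil]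
  have h : HasInput G lam k R (inputStore G lam k R) := fun _ _ => rfl
  have hz : ∀ a i, 4 ≤ a → inputStore G lam k R a i = 0 := fun a i ha => by
    match a, ha with
    | a + 4, _ => rfl
  have hempty : edgeSet G (inputStore G lam k R 6) = ∅ := by
    ext e
    simp [hz]
  generalize inputStore G lam k R = σ at *
  have h0 : MainInv G lam k R 0 ((when (.not (get 0 (lit 4))) (assign 23 (lit 1))).ex σ) ∧
      HasInput G lam k R ((when (.not (get 0 (lit 4))) (assign 23 (lit 1))).ex σ) := by
    by_cases hk : k = 0
    -- For `k = 0` the empty set is the answer, and the zero-initialised output arrays already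
    -- encode it.
    · rw [ex_when_of (by simp [h.k_eq, hk]), ex_assign]
      refine ⟨⟨fun _ => ⟨.deletionSet ∅, by simp, ⟨?_, fun e => ?_⟩, IsDeletionSet.isAnswer
        ⟨by simp [hk], hG⟩⟩, fun h => ?_⟩, h.upd (by omega) _ _⟩
      · rw [Store.upd_ne _ _ (by omega), hz 4 0 (by omega)]
      · rw [Store.upd_ne _ _ (by omega), hz 5 e (by omega)]
        simp
      · simp [Store.upd_self] at h
    · rw [ex_when_of_not (by simp [h.k_eq, hk])]
      refine ⟨⟨fun h => absurd (hz 23 0 (by omega)) h, fun _ => ?_⟩, h⟩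
      rw [hempty, hz 22 0 (by omega)]
      refine ⟨⟨hG, by simp; omega, by simp, fun e he => absurd he (by omega), ?_⟩, by simp⟩
      have : G.settled lam ∅ = ∅ := by
        ext e
        simp [settled, Deletable]
      rw [this]
      simp [Bounded]
  clear hempty hz h
  generalize (when (.not (get 0 (lit 4))) (assign 23 (lit 1))).ex σ = σ₁ at *
  obtain ⟨hI, h⟩ := h0
  have key := forLt_rule (c := 50) (j := 2) (p := stepProg) (σ := σ₁) (by decide)
    (by rw [h.m, h.bound]; omega) (fun i τ => MainInv G lam k R i τ)
    (fun i τ v hI => by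
      unfold MainInv
      rw [Store.upd_ne _ _ (show 6 ≠ 50 by omega), Store.upd_ne _ _ (show 22 ≠ 50 by omega)]
      exact FoundOr.congr hI (Store.upd_ne _ _ (by omega)) (Store.upd_ne _ _ (by omega))
        (Store.upd_ne _ _ (by omega))) hI (by
      intro i τ hi hcnt hfr hI
      rw [h.m] at hi
      exact stepProg_spec (f := ⟨i, hi⟩) hlam (h.congr fun a ha => hfr a
        ((by decide : ∀ a < 4, a ∉ (forN 50 stepProg).writes) a ha)) hR hcnt hI)
  rw [h.m] at key
  generalize (forLt 50 2 stepProg).ex σ₁ = σ₂ at *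
  by_cases h23 : σ₂ 23 0 = 0
  · rw [ex_when_of (by simpa using h23), ex_assign]
    obtain ⟨hT, -⟩ := key.2 h23
    obtain ⟨b1, b2⟩ := hT.bounded.fewDeletable hlam hT.card_lt fun e => hT.settled e e.2
    refine ⟨.fewDeletable, ?_, ⟨b1, by simp, by simp⟩, fun _ => b2⟩
    simp [Answer.HeldBy, Store.upd_self]
  · rw [ex_when_of_not (by simpa using h23)]
    obtain ⟨ans, a1, a2, a3⟩ := key.1 h23
    exact ⟨ans, a2, a3, fun h => absurd h a1⟩

end Algo

theorem theorem1 :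
    ∃ (P : Prog) (c d : ℕ), ∀ (G : MGraph) (lam k : ℕ) (R : Finset (Fin G.m)),
      1 ≤ lam → G.EdgeConnected lam → G.Irrelevant lam k R →
      ∃ (t : ℕ) (σ : Store) (ans : Answer G.m),
        Run P (inputStore G lam k R) t σ ∧
        t ≤ c * (inputSize G lam k + 1) ^ d ∧
        ans.HeldBy σ ∧
        ans.Correct G lam k R ∧
        (G.directed = true →
          (∀ e, ans ≠ Answer.irrelevantEdge e) ∧
          (ans = Answer.fewDeletable → {e | G.Deletable lam e}.ncard ≤ lam * k ^ 2)) ∧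
        (G.directed = false → Even lam →
          (∀ e, ans ≠ Answer.irrelevantEdge e) ∧
          (ans = Answer.fewDeletable → {e | G.Deletable lam e}.ncard ≤ 2 * lam * k ^ 2)) := by
  obtain ⟨A, d, hrun⟩ := BProg.run_compile Algo.wf_mainProg
  -- The time bound is in terms of `n + m + 2`, which is at most twice the input size plus one.
  refine ⟨Algo.mainProg.compile, A * 2 ^ d, d, fun G lam k R hlam hG hR => ?_⟩
  obtain ⟨t, h1, h2⟩ := hrun (inputStore G lam k R)
  obtain ⟨ans, a1, a2, a3⟩ := Algo.mainProg_spec hlam hG hR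
  refine ⟨t, _, ans, h1, h2.trans ?_, a1, a2.correct, fun hd => ⟨a2.of_directed hd, fun h =>
    (a3 h).1 hd⟩, fun hd he => ⟨a2.of_even hd he, fun h => (a3 h).2 hd he⟩⟩
  have hin : HasInput G lam k R (inputStore G lam k R) := fun _ _ => rfl
  rw [hin.bound, mul_assoc, ← mul_pow]
  refine Nat.mul_le_mul_left _ (Nat.pow_le_pow_left ?_ _)
  unfold inputSize
  omega
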